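/- An instance of \textsc{Balance-fair Shortest Path} is $I=(G,\chi,s,t)$, where $G=(V,E)$ is a finite simple undirected graph with $n=|V|$ vertices, $\chi\colon V\to\{1,\dots,c\}$ is a vertex coloring, and $s,t\in V$. It is a yes-instance if there is a shortest $s$-$t$-path $P$ in $G$ that is balance-fair, that is, the numbers of vertices of color $i$ and of color $j$ on $P$ differ by at most one for all colors $i,j\in\{1,\dots,c\}$. For an integer $h\ge 1$, let $P_h$ be the path on $h$ vertices. A graph is $P_h$-free if it has no induced subgraph isomorphic to $P_h$, and the vertex-deletion distance of $G$ to $P_h$-free graphs is the smallest number of vertices whose deletion from $G$ leaves a $P_h$-free graph. Let $\omega$ be the exponent of matrix multiplication (over any fixed field), that is, the infimum of all real $\tau$ such that two $n\times n$ matrices can be multiplied by a bilinear algorithm with $O(n^\tau)$ multiplications. Running times are counted on a word RAM with words of $O(\log(n+c))$ bits, where the constant may depend on $h$. Theorem. There is an absolute constant $C$ such that the following holds for every fixed integer $h\ge 1$. There are an algorithm and a computable function $f$ such that, given any instance $I=(G,\chi,s,t)$ of \textsc{Balance-fair Shortest Path}, the algorithm computes in $O(n^{\omega h}+n^4)$ time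 (the hidden constant may depend on $h$) an instance $I'=(G',\chi',s',t')$ of the same problem with the following properties, where $k$ and $k'$ are the vertex-deletion distances of $G$ and $G'$ to $P_h$-free graphs: 1. $I'$ is a yes-instance if and only if $I$ is a yes-instance; 2. $G'$ has at most $C\,h^{h+2}(k+1)^{h+1}$ vertices; 3. $|I'|+k'\le f(k)$, where $|I'|$ is the length of the encoding of $I'$ in bits. In other words, \textsc{Balance-fair Shortest Path} parameterized by the vertex-deletion distance $k$ to $P_h$-free graphs has a kernel with $O(h^{h+2}(k+1)^{h+1})$ vertices that can be computed in $O(n^{\omega h}+n^4)$ time. -/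

import Mathlib

/-! ### The problem: balance-fair shortest paths -/

/-- An instance of Balance-fair Shortest Path: a finite simple graph `G` on the `n` vertices
`0, …, n - 1`, a colouring `χ` of the vertices with `c` colours, and two vertices `s`, `t`. -/
structure BFSPInstance where
  n : ℕ
  c : ℕ
  G : SimpleGraph (Fin n)
  χ : Fin n → Fin c
  s : Fin n
  t : Fin n

namespace BFSPInstance

/-- The number of vertices of colour `i` on the walk `p`. -/
def colorCount (I : BFSPInstance) {u v : Fin I.n} (p : I.G.Walk u v) (i : Fin I.c) : ℕ :=
  (p.support.toFinset.filter (fun w => I.χ w = i)).card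

/-- The numbers of vertices of any two colours on `p` differ by at most one, that is,
the largest of these numbers exceeds the smallest by at most one. -/
def BalanceFair (I : BFSPInstance) {u v : Fin I.n} (p : I.G.Walk u v) : Prop :=
  ∀ i j : Fin I.c, I.colorCount p i ≤ I.colorCount p j + 1

/-- `I` is a yes-instance: some shortest `s`-`t`-path is balance-fair. -/
def IsYes (I : BFSPInstance) : Prop :=
  ∃ p : I.G.Walk I.s I.t, p.IsPath ∧ p.length = I.G.dist I.s I.t ∧ I.BalanceFair p

/-- The length in bits of the natural encoding of `I`: the numbers `n`, `s`, `t` and `c` in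
binary, the colour of every vertex in binary, and the adjacency matrix. -/
def bitLength (I : BFSPInstance) : ℕ :=
  3 * Nat.size I.n + Nat.size I.c + I.n * Nat.size I.c + I.n ^ 2

end BFSPInstance

/-! ### The parameter: vertex-deletion distance to `P_h`-free graphs -/

/-- `G` has no induced subgraph isomorphic to the path on `h` vertices. -/
def PathFree {V : Type*} (h : ℕ) (G : SimpleGraph V) : Prop :=
  ¬ (SimpleGraph.pathGraph h).IsIndContained G

/-- The smallest number of vertices whose deletion makes `G` a `P_h`-free graph. -/
noncomputable def distToPathFree {V : Type*} (h : ℕ) (G : SimpleGraph V) : ℕ :=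
  sInf {k : ℕ | ∃ S : Finset V, S.card = k ∧ PathFree h (G.induce {v : V | v ∉ S})}

/-! ### The matrix multiplication exponent -/

/-- Over `F`, the product of two `n × n` matrices can be computed by a bilinear algorithm with `r`
essential multiplications; equivalently, the `n × n` matrix multiplication tensor has rank at
most `r`. -/
def HasBilinearAlgorithm (F : Type*) [Field F] (n r : ℕ) : Prop :=
  ∃ (f g : Fin r → (Matrix (Fin n) (Fin n) F →ₗ[F] F)) (M : Fin r → Matrix (Fin n) (Fin n) F),
    ∀ A B : Matrix (Fin n) (Fin n) F, A * B = ∑ i, (f i A * g i B) • M i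

/-- The exponent `ω` of matrix multiplication over `F`: the infimum of all real `τ` such that
`n × n` matrices can be multiplied with `O(n ^ τ)` essential multiplications. -/
noncomputable def matMulExponent (F : Type*) [Field F] : ℝ :=
  sInf {τ : ℝ | ∃ C : ℝ, ∀ n : ℕ, 1 ≤ n →
    ∃ r : ℕ, (r : ℝ) ≤ C * (n : ℝ) ^ τ ∧ HasBilinearAlgorithm F n r}

/-! ### The machine model: a word RAM

Programs are structured programs over finitely many variables and arrays that hold natural
numbers. Every elementary operation (reading a constant, a variable or an array cell, an
arithmetic operation, a comparison, a write, a test) takes one step. Every number that is computed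
in a run has to fit into a machine word, that is, to be at most a given bound `W`. -/

namespace WordRAM

/-- The elementary binary operations; subtraction is truncated at zero. -/
inductive BinOp where
  | add | sub | mul | div | mod | eq | lt

/-- The value of an elementary operation; comparisons return `1` for true and `0` for false. -/
def BinOp.apply : BinOp → ℕ → ℕ → ℕ
  | .add, a, b => a + b
  | .sub, a, b => a - b
  | .mul, a, b => a * b
  | .div, a, b => a / b
  | .mod, a, b => a % b
  | .eq, a, b => if a = b then 1 else 0
  | .lt, a, b => if a < b then 1 else 0

/-- The memory: `var x` is the content of the variable number `x` and `arr a i` is the content of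
the cell `i` of the array number `a`. -/
@[ext]
structure State where
  var : ℕ → ℕ
  arr : ℕ → ℕ → ℕ

def State.setVar (σ : State) (x v : ℕ) : State :=
  { σ with var := Function.update σ.var x v }

def State.setArr (σ : State) (a i v : ℕ) : State :=
  { σ with arr := Function.update σ.arr a (Function.update (σ.arr a) i v) }

/-- Expressions: a constant, a variable, a cell of an array, or an elementary operation. -/
inductive Expr where
  | lit (k : ℕ)
  | var (x : ℕ)
  | get (a : ℕ) (i : Expr)
  | op (o : BinOp) (e₁ e₂ : Expr)

/-- The value of an expression. -/
def Expr.eval (σ : State) : Expr → ℕ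
  | .lit k => k
  | .var x => σ.var x
  | .get a i => σ.arr a (i.eval σ)
  | .op o e₁ e₂ => o.apply (e₁.eval σ) (e₂.eval σ)

/-- The number of steps in which an expression is evaluated. -/
def Expr.cost : Expr → ℕ
  | .lit _ => 1
  | .var _ => 1
  | .get _ i => i.cost + 1
  | .op _ e₁ e₂ => e₁.cost + e₂.cost + 1

/-- Every number that occurs in the evaluation of the expression is at most `W`. -/
def Expr.Fits (W : ℕ) (σ : State) : Expr → Prop
  | .lit k => k ≤ W
  | .var x => σ.var x ≤ W
  | .get a i => i.Fits W σ ∧ σ.arr a (i.eval σ) ≤ W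
  | .op o e₁ e₂ => e₁.Fits W σ ∧ e₂.Fits W σ ∧ o.apply (e₁.eval σ) (e₂.eval σ) ≤ W

/-- Programs. -/
inductive Program where
  | skip
  | assign (x : ℕ) (e : Expr)
  | store (a : ℕ) (i e : Expr)
  | seq (p q : Program)
  | ite (e : Expr) (p q : Program)
  | loop (e : Expr) (p : Program)

/-- `Exec W p σ T τ`: started in the state `σ`, the program `p` halts after exactly `T` steps in
the state `τ`, and every number that occurs in this run is at most `W`. The program `ite e p q`
runs `p` if the value of `e` is not zero, and `q` otherwise; `loop e p` repeats `p` as long as the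
value of `e` is not zero. -/
inductive Exec (W : ℕ) : Program → State → ℕ → State → Prop
  | skip (σ : State) : Exec W .skip σ 1 σ
  | assign (σ : State) (x : ℕ) (e : Expr) (he : e.Fits W σ) :
      Exec W (.assign x e) σ (e.cost + 1) (σ.setVar x (e.eval σ))
  | store (σ : State) (a : ℕ) (i e : Expr) (hi : i.Fits W σ) (he : e.Fits W σ) :
      Exec W (.store a i e) σ (i.cost + e.cost + 1) (σ.setArr a (i.eval σ) (e.eval σ))
  | seq {p q : Program} {σ τ ρ : State} {T U : ℕ} (hp : Exec W p σ T τ) (hq : Exec W q τ U ρ) :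
      Exec W (.seq p q) σ (T + U) ρ
  | iteTrue {e : Expr} {p q : Program} {σ τ : State} {T : ℕ} (hf : e.Fits W σ)
      (he : e.eval σ ≠ 0) (hp : Exec W p σ T τ) :
      Exec W (.ite e p q) σ (e.cost + 1 + T) τ
  | iteFalse {e : Expr} {p q : Program} {σ τ : State} {T : ℕ} (hf : e.Fits W σ)
      (he : e.eval σ = 0) (hq : Exec W q σ T τ) :
      Exec W (.ite e p q) σ (e.cost + 1 + T) τ
  | loopFalse {e : Expr} {p : Program} {σ : State} (hf : e.Fits W σ) (he : e.eval σ = 0) :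
      Exec W (.loop e p) σ (e.cost + 1) σ
  | loopTrue {e : Expr} {p : Program} {σ τ ρ : State} {T U : ℕ} (hf : e.Fits W σ)
      (he : e.eval σ ≠ 0) (hp : Exec W p σ T τ) (hl : Exec W (.loop e p) τ U ρ) :
      Exec W (.loop e p) σ (e.cost + 1 + T + U) ρ

end WordRAM

/-! ### Instances in the memory of the machine -/

namespace BFSPInstance

/-- The state `σ` holds the instance `I`: the variables `0, 1, 2, 3` hold `n, c, s, t`, the array
`0` holds the colours of the vertices, and the array `1` holds the adjacency matrix row by row. -/
def StoredIn (I : BFSPInstance) (σ : WordRAM.State) : Prop :=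
  σ.var 0 = I.n ∧ σ.var 1 = I.c ∧ σ.var 2 = I.s ∧ σ.var 3 = I.t ∧
    (∀ v : Fin I.n, σ.arr 0 v = I.χ v) ∧
    (∀ u v : Fin I.n, I.G.Adj u v → σ.arr 1 ((u : ℕ) * I.n + v) = 1) ∧
    (∀ u v : Fin I.n, ¬ I.G.Adj u v → σ.arr 1 ((u : ℕ) * I.n + v) = 0)

/-- The state `σ` is the start state on the input `I`: it holds `I`, and all variables and cells
that are not used for this are zero. -/
def IsInput (I : BFSPInstance) (σ : WordRAM.State) : Prop :=
  I.StoredIn σ ∧ (∀ x : ℕ, 4 ≤ x → σ.var x = 0) ∧ (∀ i : ℕ, I.n ≤ i → σ.arr 0 i = 0) ∧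
    (∀ i : ℕ, I.n ^ 2 ≤ i → σ.arr 1 i = 0) ∧ (∀ a i : ℕ, 2 ≤ a → σ.arr a i = 0)

end BFSPInstance

/-! Let `d` be the distance of the terminals and `m = d + 1`. Any `h` consecutive vertices of a
shortest path form an induced `P_h`. So a set `S` that contains `s` and `t` and meets all induced
copies of `P_h` cuts every shortest path into segments with fewer than `h` inner vertices
(`pathSeq_indPath`, `exists_pathSeq_in`). The vertices of a maximal family of disjoint induced
copies, together with the terminals, form such a set. A minimum deletion set meets each of the
copies, so `|S| ≤ h k + 2` (`GreedyInv`). Cutting a shortest path into blocks gives `m < h (k + 1)`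
in the same way (`terminalDist_lt`).

For each pair in `S` and each `q < h`, at most `m ^ q` segments with `q` inner vertices need to be
kept. There are two regimes. If `c > m`, a path is fair exactly if its colours are distinct
(`fairSeq_iff_injOn`), and a replacement segment has to avoid the fewer than `m` colours on the rest
of the path. If `c ≤ m`, it suffices that the replacement has the same colour at each position. In
both regimes a segment is dropped exactly if, for some set `B` of its positions, at least `m ^ (q -
|B|)` kept segments match it on `B` (`Covered`). Counting then yields a replacement for every
dropped segment (`Sparse.exists_disjoint`, `Sparse.exists_same_colors`), and `B = ∅` bounds the
family by `m ^ q`. The kernel is induced by `S` and the kept segments.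

Two further points matter. Without a fair shortest path the kernel could lose all shortest paths and
gain a longer fair one; a second selection, with all vertices in one colour, preserves the distance
(`IsRestriction.isYes_iff`). And if the colours outnumber the kept vertices by more than one, only
equality of colours matters, so they are renamed.

The vertex count is `|S| + 2 |S|² ∑ q m ^ q`, see `kernel_card_le`. For the time, each of `n²` pairs
and `n ^ q` candidates is compared with at most `n ^ q` kept segments for constantly many `B`, so `q
≤ h - 1` gives `n ^ (2 h)`. No fast matrix multiplication is used: `ω ≥ 2` already makes `n ^ (2 h)
≤ n ^ (ω h)` (`two_le_matMulExponent`). -/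

namespace WordRAM

/-! ### A program logic for the word RAM -/

open Classical in
/-- The indicator of a proposition, as a natural number. -/
noncomputable def ind (p : Prop) : ℕ := if p then 1 else 0

theorem ind_pos {p : Prop} (h : p) : ind p = 1 := if_pos h

theorem ind_neg {p : Prop} (h : ¬p) : ind p = 0 := if_neg h

theorem ind_le_one (p : Prop) : ind p ≤ 1 := by unfold ind; split <;> simp

theorem ind_eq_zero {p : Prop} : ind p = 0 ↔ ¬p := by unfold ind; split <;> simp_all

theorem ind_congr {p q : Prop} (h : p ↔ q) : ind p = ind q := by rw [propext h]

instance : Add Expr := ⟨.op .add⟩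
instance : Sub Expr := ⟨.op .sub⟩
instance : Mul Expr := ⟨.op .mul⟩
instance : Div Expr := ⟨.op .div⟩
instance : Mod Expr := ⟨.op .mod⟩

/-- The expression can be evaluated within the word bound, and its value is `v`. -/
def Expr.Ev (W : ℕ) (σ : State) (e : Expr) (v : ℕ) : Prop := e.Fits W σ ∧ e.eval σ = v

/-! ### Evaluation of expressions within the word bound. -/

namespace Expr

variable {W : ℕ} {σ : State}

/-- Fitting includes the root of the expression, so an evaluated expression carries its own bound.
This is why subtraction, division and remainder need no overflow hypothesis. -/
theorem Ev.le {e : Expr} {v : ℕ} (h : e.Ev W σ v) : v ≤ W := by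
  obtain ⟨h, rfl⟩ := h
  cases e with
  | lit k => exact h
  | var x => exact h
  | get a i => exact h.2
  | op o e₁ e₂ => exact h.2.2

theorem Ev.cast {e : Expr} {v w : ℕ} (h : e.Ev W σ v) (hvw : v = w) : e.Ev W σ w := hvw ▸ h

theorem Ev.lit {k : ℕ} (h : k ≤ W) : (Expr.lit k).Ev W σ k := ⟨h, rfl⟩

theorem Ev.var {x v : ℕ} (h : σ.var x = v) (hv : v ≤ W) : (Expr.var x).Ev W σ v :=
  ⟨h.le.trans hv, h⟩

theorem Ev.get {a j v : ℕ} {i : Expr} (hi : i.Ev W σ j) (h : σ.arr a j = v) (hv : v ≤ W) :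
    (Expr.get a i).Ev W σ v := by
  obtain ⟨hi, rfl⟩ := hi
  exact ⟨⟨hi, h ▸ hv⟩, h⟩

theorem Ev.op {o : BinOp} {e₁ e₂ : Expr} {a b : ℕ} (h₁ : e₁.Ev W σ a) (h₂ : e₂.Ev W σ b)
    (h : o.apply a b ≤ W) : (Expr.op o e₁ e₂).Ev W σ (o.apply a b) := by
  obtain ⟨h₁, rfl⟩ := h₁
  obtain ⟨h₂, rfl⟩ := h₂
  exact ⟨⟨h₁, h₂, h⟩, rfl⟩

variable {e₁ e₂ : Expr} {a b : ℕ}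

theorem Ev.add (h₁ : e₁.Ev W σ a) (h₂ : e₂.Ev W σ b) (h : a + b ≤ W) :
    (e₁ + e₂).Ev W σ (a + b) := Ev.op (o := .add) h₁ h₂ h

theorem Ev.mul (h₁ : e₁.Ev W σ a) (h₂ : e₂.Ev W σ b) (h : a * b ≤ W) :
    (e₁ * e₂).Ev W σ (a * b) := Ev.op (o := .mul) h₁ h₂ h

theorem Ev.sub (h₁ : e₁.Ev W σ a) (h₂ : e₂.Ev W σ b) : (e₁ - e₂).Ev W σ (a - b) :=
  Ev.op (o := .sub) h₁ h₂ ((Nat.sub_le a b).trans h₁.le)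

theorem Ev.div (h₁ : e₁.Ev W σ a) (h₂ : e₂.Ev W σ b) : (e₁ / e₂).Ev W σ (a / b) :=
  Ev.op (o := .div) h₁ h₂ ((Nat.div_le_self a b).trans h₁.le)

theorem Ev.mod (h₁ : e₁.Ev W σ a) (h₂ : e₂.Ev W σ b) : (e₁ % e₂).Ev W σ (a % b) :=
  Ev.op (o := .mod) h₁ h₂ ((Nat.mod_le a b).trans h₁.le)

theorem Ev.eq (hW : 1 ≤ W) (h₁ : e₁.Ev W σ a) (h₂ : e₂.Ev W σ b) :
    (Expr.op .eq e₁ e₂).Ev W σ (ind (a = b)) := by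
  have h : BinOp.eq.apply a b = ind (a = b) := by
    simp only [BinOp.apply, ind]; split <;> simp_all
  exact h ▸ Ev.op h₁ h₂ (h ▸ (ind_le_one _).trans hW)

theorem Ev.lt (hW : 1 ≤ W) (h₁ : e₁.Ev W σ a) (h₂ : e₂.Ev W σ b) :
    (Expr.op .lt e₁ e₂).Ev W σ (ind (a < b)) := by
  have h : BinOp.lt.apply a b = ind (a < b) := by
    simp only [BinOp.apply, ind]
    by_cases hab : a < b <;> simp [hab]
  exact h ▸ Ev.op h₁ h₂ (h ▸ (ind_le_one _).trans hW)

theorem Ev.and {p q : Prop} (h₁ : e₁.Ev W σ (ind p)) (h₂ : e₂.Ev W σ (ind q)) :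
    (e₁ * e₂).Ev W σ (ind (p ∧ q)) := by
  have h : ind p * ind q = ind (p ∧ q) := by
    by_cases hp : p <;> by_cases hq : q <;> simp [ind, hp, hq]
  have hle := h₁.le
  refine h ▸ Ev.mul h₁ h₂ ?_
  calc ind p * ind q ≤ ind p * 1 := Nat.mul_le_mul_left _ (ind_le_one _)
    _ ≤ W := by simpa using hle

/-- Negation of a truth value. -/
def not (e : Expr) : Expr := .op .eq e (.lit 0)

theorem Ev.not {e : Expr} {p : Prop} (hW : 1 ≤ W) (h : e.Ev W σ (ind p)) :
    e.not.Ev W σ (ind (¬p)) :=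
  (Ev.eq hW h (Ev.lit (Nat.zero_le W))).cast (ind_congr ind_eq_zero)

/-- The conjunction of the truth values `f 0, …, f (q - 1)`. -/
def all (f : ℕ → Expr) : ℕ → Expr
  | 0 => .lit 1
  | q + 1 => all f q * f q

theorem Ev.all {f : ℕ → Expr} {p : ℕ → Prop} (hW : 1 ≤ W) (q : ℕ)
    (h : ∀ i < q, (f i).Ev W σ (ind (p i))) : (all f q).Ev W σ (ind (∀ i < q, p i)) := by
  induction q with
  | zero => exact (Ev.lit hW).cast (ind_pos (by simp)).symm
  | succ q ih =>
    refine (Ev.and (ih fun i hi => h i (by omega)) (h q (by omega))).cast (ind_congr ?_)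
    simp only [Nat.lt_succ_iff_lt_or_eq]
    aesop

/-- The disjunction of the truth values `f 0, …, f (q - 1)`. -/
def any (f : ℕ → Expr) (q : ℕ) : Expr := (all (fun i => (f i).not) q).not

theorem Ev.any {f : ℕ → Expr} {p : ℕ → Prop} (hW : 1 ≤ W) (q : ℕ)
    (h : ∀ i < q, (f i).Ev W σ (ind (p i))) : (any f q).Ev W σ (ind (∃ i < q, p i)) := by
  refine (Ev.not hW (Ev.all hW q fun i hi => Ev.not hW (h i hi))).cast (ind_congr ?_)
  push Not
  rfl

theorem Ev.imp {p q : Prop} (hW : 1 ≤ W) (h₁ : e₁.Ev W σ (ind p)) (h₂ : e₂.Ev W σ (ind q)) :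
    (e₁ * e₂.not).not.Ev W σ (ind (p → q)) :=
  (Ev.not hW (Ev.and h₁ (Ev.not hW h₂))).cast (ind_congr (by tauto))

/-- The product of the values `f 0, …, f (q - 1)`. -/
def prod (f : ℕ → Expr) : ℕ → Expr
  | 0 => .lit 1
  | q + 1 => prod f q * f q

theorem Ev.prod {f : ℕ → Expr} {v : ℕ → ℕ} {N : ℕ} (hN : 1 ≤ N) (q : ℕ)
    (h : ∀ i < q, (f i).Ev W σ (v i)) (hv : ∀ i < q, v i ≤ N) (hW : N ^ q ≤ W) :
    (prod f q).Ev W σ (∏ i ∈ Finset.range q, v i) := by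
  induction q with
  | zero => exact Ev.lit (by simpa using hW)
  | succ q ih =>
    rw [Finset.prod_range_succ]
    refine Ev.mul (ih (fun i hi => h i (by omega)) (fun i hi => hv i (by omega))
      ((Nat.pow_le_pow_right hN (by omega)).trans hW)) (h q (by omega)) ?_
    rw [← Finset.prod_range_succ]
    refine le_trans ?_ hW
    calc ∏ i ∈ Finset.range (q + 1), v i ≤ ∏ i ∈ Finset.range (q + 1), N :=
          Finset.prod_le_prod' fun i hi => hv i (Finset.mem_range.1 hi)
      _ = N ^ (q + 1) := by simp

/-- The power with a fixed exponent. -/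
def pow (e : Expr) (q : ℕ) : Expr := prod (fun _ => e) q

theorem Ev.pow {e : Expr} {v : ℕ} (hv : 1 ≤ v) (h : e.Ev W σ v) (q : ℕ) (hW : v ^ q ≤ W) :
    (pow e q).Ev W σ (v ^ q) :=
  (Ev.prod (f := fun _ => e) (v := fun _ => v) hv q (fun _ _ => h)
    (fun _ _ => le_rfl) hW).cast (by simp)

end Expr

/-! ### Frames -/

/-- The program contains an assignment to the variable `x`. -/
def Program.WritesVar (x : ℕ) : Program → Prop
  | .skip => False
  | .assign y _ => x = y
  | .store _ _ _ => False
  | .seq p q => p.WritesVar x ∨ q.WritesVar x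
  | .ite _ p q => p.WritesVar x ∨ q.WritesVar x
  | .loop _ p => p.WritesVar x

/-- The program contains a write to the array `a`. -/
def Program.WritesArr (a : ℕ) : Program → Prop
  | .skip => False
  | .assign _ _ => False
  | .store b _ _ => a = b
  | .seq p q => p.WritesArr a ∨ q.WritesArr a
  | .ite _ p q => p.WritesArr a ∨ q.WritesArr a
  | .loop _ p => p.WritesArr a

/-- The states agree on everything that the program does not write. -/
def Frame (p : Program) (σ τ : State) : Prop :=
  (∀ x, ¬p.WritesVar x → τ.var x = σ.var x) ∧ ∀ a, ¬p.WritesArr a → τ.arr a = σ.arr a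

theorem setVar_var (σ : State) (x v y : ℕ) :
    (σ.setVar x v).var y = if y = x then v else σ.var y := by
  simp [State.setVar, Function.update_apply]

theorem setVar_var_self (σ : State) (x v : ℕ) : (σ.setVar x v).var x = v := by
  simp [setVar_var]

theorem setVar_var_ne (σ : State) {x y : ℕ} (v : ℕ) (h : y ≠ x) :
    (σ.setVar x v).var y = σ.var y := by
  simp [setVar_var, h]

theorem setVar_arr (σ : State) (x v : ℕ) : (σ.setVar x v).arr = σ.arr := rfl

theorem setArr_var (σ : State) (a i v : ℕ) : (σ.setArr a i v).var = σ.var := rfl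

theorem setArr_arr_self (σ : State) (a i v : ℕ) :
    (σ.setArr a i v).arr a = Function.update (σ.arr a) i v := by
  simp [State.setArr]

theorem setArr_arr_ne (σ : State) {a b : ℕ} (i v : ℕ) (h : b ≠ a) :
    (σ.setArr a i v).arr b = σ.arr b := by
  simp [State.setArr, h]

theorem Frame.refl (p : Program) (σ : State) : Frame p σ σ := ⟨fun _ _ => rfl, fun _ _ => rfl⟩

theorem Frame.trans {p : Program} {σ τ ρ : State} (h₁ : Frame p σ τ) (h₂ : Frame p τ ρ) :
    Frame p σ ρ :=
  ⟨fun x hx => (h₂.1 x hx).trans (h₁.1 x hx), fun a ha => (h₂.2 a ha).trans (h₁.2 a ha)⟩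

theorem Frame.mono {p q : Program} {σ τ : State} (h : Frame p σ τ)
    (hv : ∀ x, p.WritesVar x → q.WritesVar x) (ha : ∀ a, p.WritesArr a → q.WritesArr a) :
    Frame q σ τ :=
  ⟨fun x hx => h.1 x fun h' => hx (hv x h'), fun a hx => h.2 a fun h' => hx (ha a h')⟩

/-- The frame is read off the syntax of the program. Facts about untouched variables and arrays thus
survive a program without being part of any invariant. -/
theorem Exec.frame {W : ℕ} {p : Program} {σ τ : State} {T : ℕ} (h : Exec W p σ T τ) :
    Frame p σ τ := by
  induction h with
  | skip σ => exact Frame.refl _ _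
  | assign σ x e he => exact ⟨fun y hy => setVar_var_ne _ _ hy, fun _ _ => rfl⟩
  | store σ a i e hi he => exact ⟨fun _ _ => rfl, fun b hb => setArr_arr_ne _ _ _ hb⟩
  | seq _ _ ih₁ ih₂ =>
    exact (ih₁.mono (fun _ => Or.inl) fun _ => Or.inl).trans
      (ih₂.mono (fun _ => Or.inr) fun _ => Or.inr)
  | iteTrue _ _ _ ih => exact ih.mono (fun _ => Or.inl) fun _ => Or.inl
  | iteFalse _ _ _ ih => exact ih.mono (fun _ => Or.inr) fun _ => Or.inr
  | loopFalse _ _ => exact Frame.refl _ _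
  | loopTrue _ _ _ _ ih₁ ih₂ => exact (ih₁.mono (fun _ h => h) fun _ h => h).trans ih₂

/-! ### Total correctness with a step bound -/

/-- Started in `σ`, the program halts after at most `B` steps in a state that satisfies `Q`. -/
def Runs (W : ℕ) (p : Program) (σ : State) (B : ℕ) (Q : State → Prop) : Prop :=
  ∃ T τ, T ≤ B ∧ Exec W p σ T τ ∧ Q τ

namespace Runs

variable {W B B' : ℕ} {p q : Program} {σ : State} {Q Q' : State → Prop}

theorem mono (h : Runs W p σ B Q) (hB : B ≤ B') (hQ : ∀ τ, Frame p σ τ → Q τ → Q' τ) :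
    Runs W p σ B' Q' := by
  obtain ⟨T, τ, hT, hE, hτ⟩ := h
  exact ⟨T, τ, hT.trans hB, hE, hQ τ hE.frame hτ⟩

theorem le (h : Runs W p σ B Q) (hB : B ≤ B') : Runs W p σ B' Q := h.mono hB fun _ _ h => h

theorem skip (h : Q σ) : Runs W .skip σ 1 Q := ⟨1, σ, le_rfl, .skip σ, h⟩

theorem assign {x v : ℕ} {e : Expr} (he : e.Ev W σ v) (h : Q (σ.setVar x v)) :
    Runs W (.assign x e) σ (e.cost + 1) Q := by
  obtain ⟨he, rfl⟩ := he
  exact ⟨_, _, le_rfl, .assign σ x e he, h⟩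

theorem store {a j v : ℕ} {i e : Expr} (hi : i.Ev W σ j) (he : e.Ev W σ v)
    (h : Q (σ.setArr a j v)) : Runs W (.store a i e) σ (i.cost + e.cost + 1) Q := by
  obtain ⟨hi, rfl⟩ := hi
  obtain ⟨he, rfl⟩ := he
  exact ⟨_, _, le_rfl, .store σ a i e hi he, h⟩

theorem seq {R : State → Prop} (hp : Runs W p σ B R)
    (hq : ∀ τ, Frame p σ τ → R τ → Runs W q τ B' Q) : Runs W (.seq p q) σ (B + B') Q := by
  obtain ⟨T, τ, hT, hE, hτ⟩ := hp
  obtain ⟨U, ρ, hU, hE', hρ⟩ := hq τ hE.frame hτ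
  exact ⟨T + U, ρ, by omega, .seq hE hE', hρ⟩

theorem seq_assign {x v : ℕ} {e : Expr} (he : e.Ev W σ v)
    (hq : Runs W q (σ.setVar x v) B Q) : Runs W (.seq (.assign x e) q) σ (e.cost + 1 + B) Q :=
  seq (assign (Q := fun τ => τ = σ.setVar x v) he rfl) fun _ _ h => h ▸ hq

theorem seq_store {a j v : ℕ} {i e : Expr} (hi : i.Ev W σ j) (he : e.Ev W σ v)
    (hq : Runs W q (σ.setArr a j v) B Q) :
    Runs W (.seq (.store a i e) q) σ (i.cost + e.cost + 1 + B) Q :=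
  seq (store (Q := fun τ => τ = σ.setArr a j v) hi he rfl) fun _ _ h => h ▸ hq

theorem ite {c : Prop} {e : Expr} (he : e.Ev W σ (ind c)) (hp : c → Runs W p σ B Q)
    (hq : ¬c → Runs W q σ B Q) : Runs W (.ite e p q) σ (e.cost + 1 + B) Q := by
  obtain ⟨hf, hv⟩ := he
  by_cases hc : c
  · obtain ⟨T, τ, hT, hE, hτ⟩ := hp hc
    exact ⟨_, τ, by omega, .iteTrue hf (by rw [hv, ind_pos hc]; exact one_ne_zero) hE, hτ⟩
  · obtain ⟨T, τ, hT, hE, hτ⟩ := hq hc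
    exact ⟨_, τ, by omega, .iteFalse hf (by rw [hv, ind_neg hc]) hE, hτ⟩

end Runs

/-- `p`, if the value of `e` is not zero. -/
def Program.when (e : Expr) (p : Program) : Program := .ite e p .skip

theorem Runs.when {W B : ℕ} {p : Program} {σ : State} {Q : State → Prop} {c : Prop} {e : Expr}
    (hB : 1 ≤ B) (he : e.Ev W σ (ind c)) (hp : c → Runs W p σ B Q) (hq : ¬c → Q σ) :
    Runs W (.when e p) σ (e.cost + 1 + B) Q :=
  Runs.ite he hp fun hc => (Runs.skip (hq hc)).le hB

/-- `p`, for all values of the variable `i` from `0` to the value of the variable `x` minus one. -/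
def Program.for (i x : ℕ) (p : Program) : Program :=
  .seq (.assign i (.lit 0))
    (.loop (.op .lt (.var i) (.var x)) (.seq p (.assign i (.var i + .lit 1))))

@[simp] theorem Program.writesVar_for (i x y : ℕ) (p : Program) :
    (Program.for i x p).WritesVar y ↔ y = i ∨ p.WritesVar y := by
  simp only [Program.for, Program.WritesVar]; tauto

@[simp] theorem Program.writesArr_for (i x a : ℕ) (p : Program) :
    (Program.for i x p).WritesArr a ↔ p.WritesArr a := by
  simp [Program.for, Program.WritesArr]

@[simp] theorem Program.writesVar_when (e : Expr) (y : ℕ) (p : Program) :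
    (Program.when e p).WritesVar y ↔ p.WritesVar y := by
  simp [Program.when, Program.WritesVar]

@[simp] theorem Program.writesArr_when (e : Expr) (a : ℕ) (p : Program) :
    (Program.when e p).WritesArr a ↔ p.WritesArr a := by
  simp [Program.when, Program.WritesArr]

/-- Each round costs 4 for the test, `B` for the body and 4 for the increment; the initialization
costs 2 and the final failing test 4. -/
theorem Runs.for {W B i x N : ℕ} {p : Program} {σ : State} {Q : State → Prop}
    (Inv : ℕ → State → Prop) (hx : σ.var x = N) (hN : N < W) (hix : i ≠ x)
    (hpi : ¬p.WritesVar i) (hpx : ¬p.WritesVar x) (h0 : Inv 0 (σ.setVar i 0))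
    (hstep : ∀ k < N, ∀ τ, Frame (.for i x p) σ τ → τ.var i = k → Inv k τ →
      Runs W p τ B fun ρ => Inv (k + 1) (ρ.setVar i (k + 1)))
    (hQ : ∀ τ, Frame (.for i x p) σ τ → Inv N τ → Q τ) :
    Runs W (.for i x p) σ (6 + N * (B + 8)) Q := by
  have hfx : ∀ τ, Frame (.for i x p) σ τ → τ.var x = N := fun τ hτ => by
    rw [hτ.1 x (by simp [hix.symm, hpx]), hx]
  -- Here `r` is the number of rounds that are left.
  have main : ∀ r k τ, k + r = N → Frame (.for i x p) σ τ → τ.var i = k → Inv k τ →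
      Runs W (.loop (.op .lt (.var i) (.var x)) (.seq p (.assign i (.var i + .lit 1)))) τ
        (4 + r * (B + 8)) Q := by
    intro r
    induction r with
    | zero =>
      intro k τ hk hf hi hinv
      have hev : (Expr.op .lt (.var i) (.var x)).Ev W τ (ind (k < N)) :=
        Expr.Ev.lt (by omega) (Expr.Ev.var hi (by omega)) (Expr.Ev.var (hfx τ hf) hN.le)
      obtain rfl : k = N := by omega
      exact ⟨_, τ, by simp [Expr.cost], .loopFalse hev.1 (by rw [hev.2, ind_neg (lt_irrefl _)]), hQ τ hf hinv⟩
    | succ r ih =>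
      intro k τ hk hf hi hinv
      have hev : (Expr.op .lt (.var i) (.var x)).Ev W τ (ind (k < N)) :=
        Expr.Ev.lt (by omega) (Expr.Ev.var hi (by omega)) (Expr.Ev.var (hfx τ hf) hN.le)
      obtain ⟨T, ρ, hT, hE, hρ⟩ := hstep k (by omega) τ hf hi hinv
      have hρi : ρ.var i = k := by rw [hE.frame.1 i hpi, hi]
      have hinc : (Expr.var i + Expr.lit 1).Ev W ρ (k + 1) :=
        Expr.Ev.add (Expr.Ev.var hρi (by omega)) (Expr.Ev.lit (by omega)) (by omega)
      have hbody : Exec W (.seq p (.assign i (.var i + .lit 1))) τ (T + 4)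
          (ρ.setVar i (k + 1)) := by
        have := Exec.assign ρ i _ hinc.1
        rw [hinc.2] at this
        exact .seq hE this
      have hf' : Frame (.for i x p) σ (ρ.setVar i (k + 1)) := by
        refine hf.trans (hbody.frame.mono ?_ ?_)
        · intro y hy; simp [Program.WritesVar] at hy ⊢; tauto
        · intro y hy; simp [Program.WritesArr] at hy ⊢; tauto
      obtain ⟨U, τ', hU, hE', hτ'⟩ := ih (k + 1) _ (by omega) hf' (setVar_var_self _ _ _) hρ
      refine ⟨_, τ', ?_, .loopTrue hev.1 (by rw [hev.2, ind_pos (by omega)]; exact one_ne_zero)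
        hbody hE', hτ'⟩
      simp only [Expr.cost]
      nlinarith
  have h0f : Frame (.for i x p) σ (σ.setVar i 0) :=
    ⟨fun y hy => setVar_var_ne _ _ fun h => hy (by simp [h]), fun _ _ => rfl⟩
  refine (Runs.seq_assign (Expr.Ev.lit (Nat.zero_le W))
    (main N 0 _ (by omega) h0f (setVar_var_self _ _ _) h0)).le ?_
  simp only [Expr.cost]
  omega

/-- A loop over at most `n ^ f` values whose body takes at most `a * n ^ g` steps. -/
theorem for_cost_le {n N B a f g : ℕ} (hn : 1 ≤ n) (hN : N ≤ n ^ f) (hB : B ≤ a * n ^ g) :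
    6 + N * (B + 8) ≤ (a + 14) * n ^ (f + g) := by
  have h1 : 1 ≤ n ^ g := Nat.one_le_pow _ _ hn
  have h2 : 1 ≤ n ^ f := Nat.one_le_pow _ _ hn
  calc 6 + N * (B + 8) ≤ 6 * n ^ f * n ^ g + n ^ f * (a * n ^ g + 8 * n ^ g) := by
        gcongr
        · nlinarith
        · omega
    _ = (a + 14) * n ^ (f + g) := by rw [pow_add]; ring

end WordRAM

/-! ### Paths as sequences of numbers -/

/-- The sequence `x` runs from `s` to `t` along `d` edges of the relation `A`. -/
def PathSeq (A : ℕ → ℕ → Prop) (s t d : ℕ) (x : ℕ → ℕ) : Prop :=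
  x 0 = s ∧ x d = t ∧ ∀ i < d, A (x i) (x (i + 1))

/-- The numbers of occurrences of any two of the colours `0, …, c - 1` on `x 0, …, x d` differ by
at most one. -/
def FairSeq (c : ℕ) (col : ℕ → ℕ) (d : ℕ) (x : ℕ → ℕ) : Prop :=
  ∀ i < c, ∀ j < c, ((Finset.range (d + 1)).filter (fun a => col (x a) = i)).card ≤
    ((Finset.range (d + 1)).filter (fun a => col (x a) = j)).card + 1

/-- The vertices `x 0, …, x (h - 1)` form an induced path in this order. -/
def IndPath (A : ℕ → ℕ → Prop) (h : ℕ) (x : ℕ → ℕ) : Prop :=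
  ∀ j < h, ∀ i < j, x i ≠ x j ∧ (A (x i) (x j) ↔ j = i + 1)

/-- With more colours than positions, some colour is absent from the path, and comparison with it
caps every multiplicity at one. -/
theorem fairSeq_iff_injOn {c d : ℕ} {col x : ℕ → ℕ} (hc : d + 1 < c)
    (hcol : ∀ i ≤ d, col (x i) < c) :
    FairSeq c col d x ↔ Set.InjOn (fun i => col (x i)) (Finset.range (d + 1) : Set ℕ) := by
  constructor
  · intro hf
    have hlt : ((Finset.range (d + 1)).image fun a => col (x a)).card < (Finset.range c).card := by
      refine Finset.card_image_le.trans_lt ?_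
      simpa using hc
    obtain ⟨j, hj, hj'⟩ := Finset.exists_mem_notMem_of_card_lt_card hlt
    have h0 : ((Finset.range (d + 1)).filter (fun a => col (x a) = j)).card = 0 := by
      rw [Finset.card_eq_zero, Finset.filter_eq_empty_iff]
      intro a ha hja
      exact hj' (Finset.mem_image.2 ⟨a, ha, hja⟩)
    intro a ha b hb hab
    have := hf (col (x a)) (hcol a (by simpa [Nat.lt_succ_iff] using ha)) j (Finset.mem_range.1 hj)
    rw [h0, zero_add, Finset.card_le_one] at this
    exact this a (Finset.mem_filter.2 ⟨by simpa using ha, rfl⟩) b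
      (Finset.mem_filter.2 ⟨by simpa using hb, hab.symm⟩)
  · intro hinj i _ j _
    refine le_trans (Finset.card_le_one.2 ?_) (Nat.le_add_left 1 _)
    intro a ha b hb
    rw [Finset.mem_filter] at ha hb
    exact hinj (by simpa using ha.1) (by simpa using hb.1) (ha.2.trans hb.2.symm)

theorem fairSeq_congr {c d : ℕ} {col col' x y : ℕ → ℕ} (h : ∀ i ≤ d, col (x i) = col' (y i)) :
    FairSeq c col d x ↔ FairSeq c col' d y := by
  have : ∀ j, (Finset.range (d + 1)).filter (fun a => col (x a) = j) =
      (Finset.range (d + 1)).filter (fun a => col' (y a) = j) := fun j => by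
    refine Finset.filter_congr fun a ha => ?_
    rw [h a (by simpa [Nat.lt_succ_iff] using ha)]
  simp only [FairSeq, this]

/-- The path is swept from `s` to `t`. Up to a position `a` in `S` everything lies in `K` already;
the segment up to the next member of `S` is short by `hwin` and is exchanged by `hrep`. The exchange
keeps the length and the ends of the segment, so the sweep can continue from its far end. -/
theorem exists_pathSeq_in {A : ℕ → ℕ → Prop} {s t d h : ℕ} {S K : Set ℕ}
    {Fair : (ℕ → ℕ) → Prop} (hs : s ∈ S) (ht : t ∈ S) (hSK : S ⊆ K)
    (hwin : ∀ x, PathSeq A s t d x → ∀ a, a + h ≤ d + 1 → ∃ i < h, x (a + i) ∈ S)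
    (hrep : ∀ x, PathSeq A s t d x → Fair x → ∀ a q, 1 ≤ q → q < h → a + q + 1 ≤ d → x a ∈ S →
      x (a + q + 1) ∈ S → ∃ y, PathSeq A s t d y ∧ Fair y ∧
        (∀ i, i ≤ a ∨ a + q + 1 ≤ i → y i = x i) ∧ ∀ i, a < i → i < a + q + 1 → y i ∈ K)
    {x : ℕ → ℕ} (hx : PathSeq A s t d x) (hf : Fair x) :
    ∃ y, PathSeq A s t d y ∧ Fair y ∧ ∀ i ≤ d, y i ∈ K := by
  have main : ∀ r a x, a + r = d → PathSeq A s t d x → Fair x → x a ∈ S → (∀ i ≤ a, x i ∈ K) →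
      ∃ y, PathSeq A s t d y ∧ Fair y ∧ ∀ i ≤ d, y i ∈ K := by
    intro r
    induction r using Nat.strong_induction_on with
    | _ r ih =>
      intro a x hr hx hf ha hK
      rcases Nat.eq_zero_or_pos r with rfl | hpos
      · exact ⟨x, hx, hf, by simpa [← hr] using hK⟩
      have hex : ∃ q, x (a + q + 1) ∈ S := ⟨r - 1, by
        rw [show a + (r - 1) + 1 = d by omega, hx.2.1]; exact ht⟩
      classical
      obtain ⟨hq, hmin⟩ := (Nat.find_eq_iff hex).1 rfl
      set q := Nat.find hex
      have hqr : q ≤ r - 1 := Nat.find_min' hex (by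
        rw [show a + (r - 1) + 1 = d by omega, hx.2.1]; exact ht)
      -- Otherwise the `h` positions after `a` would form a window that misses `S`.
      have hqh : q < h := by
        by_contra hge
        obtain ⟨i, hi, hiS⟩ := hwin x hx (a + 1) (by omega)
        exact hmin i (by omega) (by rwa [show a + i + 1 = a + 1 + i by omega])
      rcases Nat.eq_zero_or_pos q with hq0 | hq1
      · rw [hq0] at hq
        refine ih (r - 1) (by omega) (a + 1) x (by omega) hx hf hq fun i hi => ?_
        rcases Nat.lt_or_ge i (a + 1) with h' | h'
        · exact hK i (by omega)
        · obtain rfl : i = a + 1 := by omega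
          exact hSK hq
      · obtain ⟨y, hy, hyf, hyx, hyK⟩ := hrep x hx hf a q hq1 hqh (by omega) ha hq
        have hyq : y (a + q + 1) ∈ S := by rwa [hyx _ (Or.inr le_rfl)]
        refine ih (r - q - 1) (by omega) (a + q + 1) y (by omega) hy hyf hyq fun i hi => ?_
        by_cases h1 : i ≤ a
        · rw [hyx i (Or.inl h1)]; exact hK i h1
        · by_cases h2 : i < a + q + 1
          · exact hyK i (by omega) h2
          · obtain rfl : i = a + q + 1 := by omega
            exact hSK hyq
  refine main d 0 x (zero_add d) hx hf (hx.1 ▸ hs) fun i hi => ?_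
  obtain rfl : i = 0 := by omega
  exact hSK (hx.1 ▸ hs)

/-! ### Words and their codes -/

/-- The word with the code `e`: the digits of `e` in base `n`. -/
def word (n e i : ℕ) : ℕ := e / n ^ i % n

theorem word_lt {n : ℕ} (hn : 0 < n) (e i : ℕ) : word n e i < n := Nat.mod_lt _ hn

/-- A loop over the numbers below `n ^ q` therefore runs through all words of length `q`. -/
theorem exists_word_eq {n q : ℕ} {w : ℕ → ℕ} (hw : ∀ i < q, w i < n) :
    ∃ e < n ^ q, ∀ i < q, word n e i = w i := by
  let f : Fin q → Fin n := fun i => ⟨w i, hw i i.2⟩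
  refine ⟨finFunctionFinEquiv f, (finFunctionFinEquiv f).2, fun i hi => ?_⟩
  have := congrArg Fin.val (congrFun (finFunctionFinEquiv.symm_apply_apply f) ⟨i, hi⟩)
  simpa [word, finFunctionFinEquiv] using this

/-- The subset of `{0, …, q - 1}` with the binary code `F`. -/
def maskSet (q F : ℕ) : Finset ℕ := (Finset.range q).filter fun i => word 2 F i = 1

theorem exists_maskSet_eq {q : ℕ} {B : Finset ℕ} (hB : B ⊆ Finset.range q) :
    ∃ F < 2 ^ q, maskSet q F = B := by
  obtain ⟨F, hF, h⟩ := exists_word_eq (n := 2) (q := q) (w := fun i => if i ∈ B then 1 else 0)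
    (fun i _ => by split <;> omega)
  refine ⟨F, hF, Finset.ext fun i => ?_⟩
  simp only [maskSet, Finset.mem_filter, Finset.mem_range]
  constructor
  · rintro ⟨hi, h1⟩
    rw [h i hi] at h1
    by_contra hiB
    simp [hiB] at h1
  · intro hi
    have hq := Finset.mem_range.1 (hB hi)
    exact ⟨hq, by simp [h i hq, hi]⟩

/-! ### Representative families of coloured words -/

/-- Every colour that the word `w` has at a position in `B` occurs on the word `w'` (at the same
position, if `few` holds). -/
def Matches (few : Prop) (col : ℕ → ℕ) (q : ℕ) (B : Finset ℕ) (w w' : ℕ → ℕ) : Prop :=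
  ∀ i ∈ B, ∃ j < q, col (w' j) = col (w i) ∧ (few → i = j)

open Classical in
/-- The number of those among the words `w 0, …, w (k - 1)` that match `v` on `B`. -/
noncomputable def matchCount (few : Prop) (col : ℕ → ℕ) (q : ℕ) (w : ℕ → ℕ → ℕ) (k : ℕ)
    (B : Finset ℕ) (v : ℕ → ℕ) : ℕ :=
  ((Finset.range k).filter fun i => Matches few col q B v (w i)).card

/-- The words `w 0, …, w (k - 1)` form a sparse family: when a word is added to the family, few
of the earlier words match it. -/
def Sparse (few : Prop) (col : ℕ → ℕ) (m q : ℕ) (w : ℕ → ℕ → ℕ) (k : ℕ) : Prop :=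
  ∀ j < k, ∀ B ⊆ Finset.range q, matchCount few col q w j B (w j) < m ^ (q - B.card)

/-- The word `v` may be dropped: many words of the family match it on some set of positions. -/
def Covered (few : Prop) (col : ℕ → ℕ) (m q : ℕ) (w : ℕ → ℕ → ℕ) (k : ℕ) (v : ℕ → ℕ) : Prop :=
  ∃ B ⊆ Finset.range q, m ^ (q - B.card) ≤ matchCount few col q w k B v

section Representatives

variable {few : Prop} {col : ℕ → ℕ} {m q k : ℕ} {w : ℕ → ℕ → ℕ} {v : ℕ → ℕ}

theorem matchCount_mono {l : ℕ} (hkl : k ≤ l) (B : Finset ℕ) (v : ℕ → ℕ) :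
    matchCount few col q w k B v ≤ matchCount few col q w l B v := by
  classical
  exact Finset.card_le_card (Finset.filter_subset_filter _ (Finset.range_mono hkl))

/-- On `B = ∅` all earlier words match, so fewer than `m ^ q` words were present when the last one
was added. -/
theorem Sparse.le (h : Sparse few col m q w k) : k ≤ m ^ q := by
  classical
  rcases k with _ | k
  · exact Nat.zero_le _
  have := h k (Nat.lt_succ_self k) ∅ (Finset.empty_subset _)
  simpa [matchCount, Matches] using this

/-- The colours of a word. -/
def colors (col : ℕ → ℕ) (q : ℕ) (v : ℕ → ℕ) : Finset ℕ := (Finset.range q).image fun i => col (v i)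

theorem matches_iff_subset {B : Finset ℕ} {v w' : ℕ → ℕ} (hfew : ¬few) :
    Matches few col q B v w' ↔ B.image (fun i => col (v i)) ⊆ colors col q w' := by
  simp only [Matches, colors, Finset.subset_iff, Finset.mem_image, Finset.mem_range, hfew,
    false_imp_iff, and_true, forall_exists_index, and_imp, forall_apply_eq_imp_iff₂]

/-- Consider the last word whose colours include `C`, and let `B` be its positions with colours in
`C`. Its colours are distinct, so `|B| = |C|`, and sparsity says that fewer than `m ^ (q - |C|)`
earlier words contain `C`. -/
theorem Sparse.card_superset_le (hfew : ¬few) (h : Sparse few col m q w k)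
    (hinj : ∀ i < k, Set.InjOn (fun j => col (w i j)) (Finset.range q : Set ℕ)) (C : Finset ℕ) :
    ∀ j ≤ k, ((Finset.range j).filter fun i => C ⊆ colors col q (w i)).card ≤
      m ^ (q - C.card) := by
  intro j
  induction j with
  | zero => simp
  | succ j ih =>
    intro hj
    by_cases hC : C ⊆ colors col q (w j)
    · let B := (Finset.range q).filter fun i => col (w j i) ∈ C
      have hBq : B ⊆ Finset.range q := Finset.filter_subset _ _
      have himg : B.image (fun i => col (w j i)) = C := by
        ext y
        simp only [B, Finset.mem_image, Finset.mem_filter]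
        constructor
        · rintro ⟨i, ⟨_, hi⟩, rfl⟩; exact hi
        · intro hy
          obtain ⟨i, hi, rfl⟩ := Finset.mem_image.1 (hC hy)
          exact ⟨i, ⟨hi, hy⟩, rfl⟩
      have hcard : B.card = C.card := by
        rw [← himg, Finset.card_image_of_injOn]
        exact (hinj j (by omega)).mono (by exact_mod_cast hBq)
      have hlt := h j (by omega) B hBq
      rw [hcard] at hlt
      have heq : matchCount few col q w j B (w j) =
          ((Finset.range j).filter fun i => C ⊆ colors col q (w i)).card := by
        classical
        unfold matchCount
        congr 1
        refine Finset.filter_congr fun i _ => ?_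
        rw [matches_iff_subset hfew, himg]
      rw [heq] at hlt
      rw [Finset.range_add_one, Finset.filter_insert, if_pos hC]
      exact (Finset.card_insert_le _ _).trans hlt
    · rw [Finset.range_add_one, Finset.filter_insert, if_neg hC]
      exact ih (by omega)

/-- Let `C` be the set of colours of `v` on the covering set `B`. At least `m ^ (q - |B|)` words
contain `C`, but for each `y ∈ Y` at most `m ^ (q - |B| - 1)` of them contain `y` as well. As `|Y| <
m`, these words cannot all meet `Y`. -/
theorem Sparse.exists_disjoint (hfew : ¬few) (h : Sparse few col m q w k)
    (hinj : ∀ i < k, Set.InjOn (fun j => col (w i j)) (Finset.range q : Set ℕ))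
    (hv : Set.InjOn (fun j => col (v j)) (Finset.range q : Set ℕ))
    (hcov : Covered few col m q w k v) {Y : Finset ℕ} (hY : Y.card < m)
    (hdisj : Disjoint (colors col q v) Y) : ∃ i < k, Disjoint (colors col q (w i)) Y := by
  classical
  obtain ⟨B, hB, hcount⟩ := hcov
  set C := B.image fun i => col (v i) with hC
  have hcard : C.card = B.card :=
    Finset.card_image_of_injOn (hv.mono (by exact_mod_cast hB))
  have hBq : B.card ≤ q := by simpa using Finset.card_le_card hB
  have hcount' : m ^ (q - B.card) ≤
      ((Finset.range k).filter fun i => C ⊆ colors col q (w i)).card := by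
    refine hcount.trans (le_of_eq ?_)
    unfold matchCount
    congr 1
    exact Finset.filter_congr fun i _ => matches_iff_subset hfew
  have hCv : C ⊆ colors col q v := Finset.image_subset_image hB
  have hm : 0 < m := by omega
  by_contra hno
  push Not at hno
  -- If `B` consists of all positions, a single match has exactly the colours of `v`; the count with
  -- exponent `q - |B| - 1` is not available then.
  rcases hBq.eq_or_lt with hBq | hBq
  · rw [hBq, Nat.sub_self, pow_zero, Finset.one_le_card] at hcount'
    obtain ⟨i, hi⟩ := hcount'
    obtain ⟨hik, hi⟩ := Finset.mem_filter.1 hi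
    have hle : (colors col q (w i)).card ≤ C.card := by
      rw [hcard, hBq]
      exact Finset.card_image_le.trans (by simp)
    refine hno i (Finset.mem_range.1 hik) ?_
    rw [← Finset.eq_of_subset_of_card_le hi hle]
    exact hdisj.mono_left hCv
  · have hsub : ((Finset.range k).filter fun i => C ⊆ colors col q (w i)) ⊆
        Y.biUnion fun y => (Finset.range k).filter fun i => insert y C ⊆ colors col q (w i) := by
      intro i hi
      obtain ⟨hik, hi⟩ := Finset.mem_filter.1 hi
      obtain ⟨y, hy1, hy2⟩ := Finset.not_disjoint_iff.1 (hno i (Finset.mem_range.1 hik))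
      exact Finset.mem_biUnion.2 ⟨y, hy2, Finset.mem_filter.2 ⟨hik,
        Finset.insert_subset hy1 hi⟩⟩
    have hle : ((Finset.range k).filter fun i => C ⊆ colors col q (w i)).card ≤
        Y.card * m ^ (q - (B.card + 1)) := by
      refine (Finset.card_le_card hsub).trans (Finset.card_biUnion_le_card_mul _ _ _ fun y hy => ?_)
      have hyC : y ∉ C := fun hyC => Finset.disjoint_left.1 hdisj (hCv hyC) hy
      have := h.card_superset_le hfew hinj (insert y C) k le_rfl
      rwa [Finset.card_insert_of_notMem hyC, hcard] at this
    have hlt : Y.card * m ^ (q - (B.card + 1)) < m * m ^ (q - (B.card + 1)) :=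
      Nat.mul_lt_mul_of_pos_right hY (Nat.pow_pos hm)
    rw [← pow_succ', show q - (B.card + 1) + 1 = q - B.card by omega] at hlt
    omega

/-- The words that match `v` on `B` can differ in colour only outside `B`, where there are `c ^ (q -
|B|)` colour patterns. Since there are at least that many such words, with distinct patterns, every
pattern occurs, in particular that of `v`. -/
theorem Sparse.exists_same_colors (hfew : few) (h : Sparse few col m q w k) {c : ℕ} (hcm : c ≤ m)
    (hw : ∀ i < k, ∀ j < q, col (w i j) < c) (hv : ∀ j < q, col (v j) < c)
    (hcov : Covered few col m q w k v) : ∃ i < k, ∀ j < q, col (w i j) = col (v j) := by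
  classical
  obtain ⟨B, hB, hcount⟩ := hcov
  have hmatch : ∀ (C : Finset ℕ) (u u' : ℕ → ℕ), C ⊆ Finset.range q →
      (Matches few col q C u u' ↔ ∀ i ∈ C, col (u' i) = col (u i)) := by
    intro C u u' hC
    refine forall₂_congr fun i hi => ⟨?_, fun h => ⟨i, Finset.mem_range.1 (hC hi), h, fun _ => rfl⟩⟩
    rintro ⟨j, _, hj, hij⟩
    rw [hij hfew, hj]
    exact congrArg (fun i => col (u i)) (hij hfew)
  set R := (Finset.range k).filter fun i => Matches few col q B v (w i) with hR
  let D := Finset.range q \ B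
  let φ : (ℕ → ℕ) → ({j // j ∈ D} → ℕ) := fun u j => col (u j)
  let P : Finset ({j // j ∈ D} → ℕ) := Fintype.piFinset fun _ => Finset.range c
  have hP : ∀ u : ℕ → ℕ, (∀ j < q, col (u j) < c) → φ u ∈ P := fun u hu =>
    Fintype.mem_piFinset.2 fun j => Finset.mem_range.2
      (hu j (Finset.mem_range.1 (Finset.mem_sdiff.1 j.2).1))
  -- Sparsity for the full set of positions has threshold `m ^ 0 = 1`, so no two members of the
  -- family have the same colours throughout.
  have hinj : Set.InjOn (fun i => φ (w i)) (R : Set ℕ) := by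
    have key : ∀ i ∈ R, ∀ i' ∈ R, i < i' → φ (w i) ≠ φ (w i') := by
      intro i hi i' hi' hlt heq
      obtain ⟨hik, hi⟩ := Finset.mem_filter.1 hi
      obtain ⟨hik', hi'⟩ := Finset.mem_filter.1 hi'
      have hs := h i' (Finset.mem_range.1 hik') (Finset.range q) subset_rfl
      rw [Finset.card_range, Nat.sub_self, pow_zero, Nat.lt_one_iff, matchCount,
        Finset.card_eq_zero, Finset.filter_eq_empty_iff] at hs
      refine hs (Finset.mem_range.2 hlt) ((hmatch _ _ _ subset_rfl).2 fun j hj => ?_)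
      by_cases hjB : j ∈ B
      · rw [(hmatch _ _ _ hB).1 hi j hjB, (hmatch _ _ _ hB).1 hi' j hjB]
      · exact congrFun heq ⟨j, Finset.mem_sdiff.2 ⟨hj, hjB⟩⟩
    intro i hi i' hi' heq
    by_contra hne
    rcases lt_or_gt_of_ne hne with hlt | hlt
    · exact key i hi i' hi' hlt heq
    · exact key i' hi' i hi hlt heq.symm
  have hsub : R.image (fun i => φ (w i)) ⊆ P := by
    intro f hf
    obtain ⟨i, hi, rfl⟩ := Finset.mem_image.1 hf
    exact hP _ (hw i (Finset.mem_range.1 (Finset.mem_filter.1 hi).1))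
  have hcardP : P.card = c ^ (q - B.card) := by
    simp [P, D, Finset.card_sdiff_of_subset hB]
  have hle : P.card ≤ (R.image fun i => φ (w i)).card := by
    rw [hcardP, Finset.card_image_of_injOn hinj]
    exact (Nat.pow_le_pow_left hcm _).trans hcount
  have hmem := hP v hv
  rw [← Finset.eq_of_subset_of_card_le hsub hle] at hmem
  obtain ⟨i, hi, hiv⟩ := Finset.mem_image.1 hmem
  obtain ⟨hik, hi⟩ := Finset.mem_filter.1 hi
  refine ⟨i, Finset.mem_range.1 hik, fun j hj => ?_⟩
  by_cases hjB : j ∈ B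
  · exact (hmatch _ _ _ hB).1 hi j hjB
  · exact congrFun hiv ⟨j, Finset.mem_sdiff.2 ⟨Finset.mem_range.2 hj, hjB⟩⟩

end Representatives

/-! ### Replacing segments of a path -/

/-- The word `w` is the interior of a path from `u` to `v` with `q` inner vertices, which have
distinct colours unless `few` holds. -/
def IsSegment (A : ℕ → ℕ → Prop) (few : Prop) (col : ℕ → ℕ) (q u v : ℕ) (w : ℕ → ℕ) : Prop :=
  A u (w 0) ∧ A (w (q - 1)) v ∧ (∀ i < q - 1, A (w i) (w (i + 1))) ∧
    (¬few → ∀ j < q, ∀ i < j, col (w i) ≠ col (w j))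

/-- The set `K` contains the members of a sparse family of segments from `u` to `v` with `q` inner
vertices that represents all these segments. -/
def RepresentsSegments (A : ℕ → ℕ → Prop) (few : Prop) (col : ℕ → ℕ) (n m q u v : ℕ)
    (K : Set ℕ) : Prop :=
  ∃ (w : ℕ → ℕ → ℕ) (k : ℕ), Sparse few col m q w k ∧
    (∀ i < k, IsSegment A few col q u v (w i) ∧ ∀ j < q, w i j ∈ K) ∧
    ∀ e < n ^ q, IsSegment A few col q u v (word n e) →
      (∃ i < k, ∀ j < q, w i j = word n e j) ∨ Covered few col m q w k (word n e)

theorem IsSegment.injOn {A : ℕ → ℕ → Prop} {few : Prop} {col : ℕ → ℕ} {q u v : ℕ} {w : ℕ → ℕ}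
    (h : IsSegment A few col q u v w) (hfew : ¬few) :
    Set.InjOn (fun j => col (w j)) (Finset.range q : Set ℕ) := by
  intro i hi j hj hij
  simp only [Finset.coe_range, Set.mem_Iio] at hi hj
  by_contra hne
  rcases lt_or_gt_of_ne hne with hlt | hlt
  · exact h.2.2.2 hfew j hj i hlt hij
  · exact h.2.2.2 hfew i hi j hlt hij.symm

/-- The path that results from `x` if the vertices between `x a` and `x (a + q + 1)` are replaced
by the word `w`. -/
def replaceSegment (x : ℕ → ℕ) (a q : ℕ) (w : ℕ → ℕ) (i : ℕ) : ℕ :=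
  if a < i ∧ i < a + q + 1 then w (i - a - 1) else x i

theorem PathSeq.replaceSegment {A : ℕ → ℕ → Prop} {few : Prop} {col : ℕ → ℕ} {s t d a q : ℕ}
    {x w : ℕ → ℕ} (hx : PathSeq A s t d x) (hq : 1 ≤ q) (haq : a + q + 1 ≤ d)
    (hw : IsSegment A few col q (x a) (x (a + q + 1)) w) :
    PathSeq A s t d (replaceSegment x a q w) := by
  refine ⟨?_, ?_, fun i hi => ?_⟩
  · simp [_root_.replaceSegment, hx.1]
  · rw [_root_.replaceSegment, if_neg (by omega), hx.2.1]
  · unfold _root_.replaceSegment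
    by_cases h1 : a < i ∧ i < a + q + 1
    · by_cases h2 : i + 1 < a + q + 1
      · rw [if_pos h1, if_pos (by omega), show i + 1 - a - 1 = i - a - 1 + 1 by omega]
        exact hw.2.2.1 _ (by omega)
      · rw [if_pos h1, if_neg (by omega), show i + 1 = a + q + 1 by omega,
          show i - a - 1 = q - 1 by omega]
        exact hw.2.1
    · by_cases h2 : a < i + 1 ∧ i + 1 < a + q + 1
      · obtain rfl : i = a := by omega
        rw [if_neg h1, if_pos h2, show i + 1 - i - 1 = 0 by omega]
        exact hw.1
      · rw [if_neg h1, if_neg h2]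
        exact hx.2.2 i hi

/-- The inner vertices of the segment are either kept or covered. A covered segment is exchanged for
one with the same colour at each position if `few` holds, and otherwise for one that avoids the
colours on the rest of the path. -/
theorem RepresentsSegments.exists_replacement {A : ℕ → ℕ → Prop} {few : Prop} {col : ℕ → ℕ}
    {n c s t d a q : ℕ} {K : Set ℕ} {x : ℕ → ℕ} (hA : ∀ u v, A u v → u < n ∧ v < n)
    (hfew : few ↔ c ≤ d + 1) (hcol : ∀ v < n, col v < c) (hx : PathSeq A s t d x)
    (hxn : ∀ i ≤ d, x i < n)
    (hf : FairSeq c col d x) (hq : 1 ≤ q) (haq : a + q + 1 ≤ d)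
    (hK : RepresentsSegments A few col n (d + 1) q (x a) (x (a + q + 1)) K) :
    ∃ y, PathSeq A s t d y ∧ FairSeq c col d y ∧
      (∀ i, i ≤ a ∨ a + q + 1 ≤ i → y i = x i) ∧ ∀ i, a < i → i < a + q + 1 → y i ∈ K := by
  obtain ⟨w, k, hsparse, hseg, hrep⟩ := hK
  obtain ⟨e, he, hex⟩ := exists_word_eq (n := n) (q := q) (w := fun i => x (a + 1 + i))
    fun i hi => hxn _ (by omega)
  have hinj : ¬few → Set.InjOn (fun i => col (x i)) (Finset.range (d + 1) : Set ℕ) := fun hfew' =>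
    (fairSeq_iff_injOn (by rw [hfew] at hfew'; omega) fun i hi => hcol _ (hxn i hi)).1 hf
  have hsege : IsSegment A few col q (x a) (x (a + q + 1)) (word n e) := by
    refine ⟨?_, ?_, fun i hi => ?_, fun hfew' j hj i hij heq => ?_⟩
    · rw [hex 0 (by omega)]; exact hx.2.2 a (by omega)
    · rw [hex (q - 1) (by omega)]
      have := hx.2.2 (a + q) (by omega)
      rwa [show a + q = a + 1 + (q - 1) by omega] at this ⊢
    · rw [hex i (by omega), hex (i + 1) (by omega)]
      exact hx.2.2 (a + 1 + i) (by omega)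
    · rw [hex i (by omega), hex j (by omega)] at heq
      have := hinj hfew' (x₁ := a + 1 + i) (x₂ := a + 1 + j) (by simp; omega) (by simp; omega) heq
      omega
  suffices h : ∃ i < k, FairSeq c col d (replaceSegment x a q (w i)) by
    obtain ⟨i, hi, hfair⟩ := h
    refine ⟨_, hx.replaceSegment hq haq (hseg i hi).1, hfair, fun j hj => ?_, fun j h1 h2 => ?_⟩
    · rw [replaceSegment, if_neg (by omega)]
    · rw [replaceSegment, if_pos ⟨h1, h2⟩]
      exact (hseg i hi).2 _ (by omega)
  have hwn : ∀ i < k, ∀ j < q, w i j < n := fun i hi j hj => by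
    obtain ⟨h1, h2, h3, -⟩ := (hseg i hi).1
    rcases Nat.lt_or_ge j (q - 1) with h | h
    · exact (hA _ _ (h3 j h)).1
    · obtain rfl : j = q - 1 := by omega
      exact (hA _ _ h2).1
  have hsame : ∀ i, (∀ j < q, col (w i j) = col (word n e j)) →
      FairSeq c col d (replaceSegment x a q (w i)) := fun i hi => by
    refine (fairSeq_congr fun j hj => ?_).2 hf
    unfold replaceSegment
    split_ifs with h
    · rw [hi _ (by omega), hex _ (by omega)]
      congr 2
      omega
    · rfl
  rcases hrep e he hsege with ⟨i, hi, hie⟩ | hcov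
  · exact ⟨i, hi, hsame i fun j hj => by rw [hie j hj]⟩
  by_cases hfew' : few
  · obtain ⟨i, hi, h⟩ := hsparse.exists_same_colors hfew' (hfew.1 hfew')
      (fun i hi j hj => hcol _ (hwn i hi j hj))
      (fun j hj => by rw [hex j hj]; exact hcol _ (hxn _ (by omega))) hcov
    exact ⟨i, hi, hsame i h⟩
  -- `O` is the set of positions outside the segment. It misses position `a + 1`, so fewer than `m =
  -- d + 1` colours are to be avoided.
  · let O := (Finset.range (d + 1)).filter fun i => ¬(a < i ∧ i < a + q + 1)
    have hO : O.card < d + 1 := by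
      have : O ⊂ Finset.range (d + 1) := Finset.filter_ssubset.2
        ⟨a + 1, Finset.mem_range.2 (by omega), by simp; omega⟩
      simpa using Finset.card_lt_card this
    have hinjx := hinj hfew'
    obtain ⟨i, hi, hdisj⟩ := hsparse.exists_disjoint hfew'
      (fun i hi => (hseg i hi).1.injOn hfew') (hsege.injOn hfew') hcov
      (Y := O.image fun i => col (x i)) (Finset.card_image_le.trans_lt hO) (by
        rw [Finset.disjoint_left]
        intro y hy hy'
        obtain ⟨j, hj, rfl⟩ := Finset.mem_image.1 hy
        obtain ⟨i, hi, hij⟩ := Finset.mem_image.1 hy'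
        obtain ⟨hi, hia⟩ := Finset.mem_filter.1 hi
        have hj := Finset.mem_range.1 hj
        rw [hex j hj] at hij
        have := hinjx (x₁ := i) (x₂ := a + 1 + j) (by simpa using hi) (by simp; omega) hij
        omega)
    refine ⟨i, hi, ?_⟩
    have hy := hx.replaceSegment hq haq (hseg i hi).1
    rw [fairSeq_iff_injOn (by rw [hfew] at hfew'; omega) fun j hj => ?_]
    · have key : ∀ j ≤ d, ∀ l ≤ d, (a < j ∧ j < a + q + 1) → ¬(a < l ∧ l < a + q + 1) →
          col (w i (j - a - 1)) ≠ col (x l) := by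
        intro j hj l hl hja hla heq
        refine Finset.disjoint_left.1 hdisj (Finset.mem_image.2 ⟨j - a - 1,
          Finset.mem_range.2 (by omega), rfl⟩) (Finset.mem_image.2 ⟨l, Finset.mem_filter.2
            ⟨Finset.mem_range.2 (by omega), hla⟩, heq.symm⟩)
      intro j hj l hl hjl
      simp only [Finset.coe_range, Set.mem_Iio] at hj hl
      simp only [replaceSegment] at hjl
      split_ifs at hjl with h1 h2 h2
      · have := (hseg i hi).1.injOn hfew' (x₁ := j - a - 1) (x₂ := l - a - 1) (by simp; omega)
          (by simp; omega) hjl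
        omega
      · exact absurd hjl (key j (by omega) l (by omega) h1 h2)
      · exact absurd hjl.symm (key l (by omega) j (by omega) h2 h1)
      · exact hinjx (by simpa using hj) (by simpa using hl) hjl
    · unfold replaceSegment
      split_ifs with h
      · exact hcol _ (hwn i hi _ (by omega))
      · exact hcol _ (hxn j hj)

namespace BFSPInstance

/-! ### Instances on the natural numbers -/

/-- Adjacency of the vertices with the given numbers. -/
def Adj (I : BFSPInstance) (u v : ℕ) : Prop :=
  ∃ (hu : u < I.n) (hv : v < I.n), I.G.Adj ⟨u, hu⟩ ⟨v, hv⟩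

/-- The colour of the vertex with the given number. -/
def col (I : BFSPInstance) (v : ℕ) : ℕ := if h : v < I.n then I.χ ⟨v, h⟩ else 0

/-- There is a walk of length `r` between the vertices with the given numbers. -/
def WalkLen (I : BFSPInstance) (r u v : ℕ) : Prop :=
  ∃ (hu : u < I.n) (hv : v < I.n) (p : I.G.Walk ⟨u, hu⟩ ⟨v, hv⟩), p.length = r

variable {I : BFSPInstance}

theorem n_pos (I : BFSPInstance) : 0 < I.n := (Nat.zero_le _).trans_lt I.s.2

theorem c_pos (I : BFSPInstance) : 0 < I.c := (Nat.zero_le _).trans_lt (I.χ I.s).2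

theorem Adj.lt {u v : ℕ} (h : I.Adj u v) : u < I.n ∧ v < I.n := ⟨h.1, h.2.1⟩

theorem adj_fin (u v : Fin I.n) : I.Adj u v ↔ I.G.Adj u v :=
  ⟨fun ⟨_, _, h⟩ => h, fun h => ⟨u.2, v.2, h⟩⟩

theorem col_fin (v : Fin I.n) : I.col v = I.χ v := dif_pos v.2

theorem col_lt {v : ℕ} (h : v < I.n) : I.col v < I.c := by
  rw [col, dif_pos h]; exact (I.χ _).2

theorem WalkLen.refl {u : ℕ} (h : u < I.n) : I.WalkLen 0 u u := ⟨h, h, .nil, rfl⟩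

theorem WalkLen.trans {r r' u v w : ℕ} (h : I.WalkLen r u v) (h' : I.WalkLen r' v w) :
    I.WalkLen (r + r') u w := by
  obtain ⟨hu, hv, p, rfl⟩ := h
  obtain ⟨_, hw, p', rfl⟩ := h'
  exact ⟨hu, hw, p.append p', by simp⟩

theorem Adj.walkLen {u v : ℕ} (h : I.Adj u v) : I.WalkLen 1 u v := by
  obtain ⟨hu, hv, h⟩ := h
  exact ⟨hu, hv, h.toWalk, by simp⟩

theorem WalkLen.exists_last {r u v : ℕ} (h : I.WalkLen (r + 1) u v) :
    ∃ w, I.WalkLen r u w ∧ I.Adj w v := by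
  obtain ⟨hu, hv, p, hp⟩ := h
  refine ⟨p.getVert r, ⟨hu, Fin.is_lt _, p.take r, ?_⟩, ?_⟩
  · simp [hp]
  · have := p.adj_getVert_succ (i := r) (by omega)
    rw [← hp, p.getVert_length] at this
    exact ⟨_, hv, this⟩

theorem WalkLen.dist_le {r : ℕ} (h : I.WalkLen r I.s I.t) : I.G.dist I.s I.t ≤ r := by
  obtain ⟨_, _, p, rfl⟩ := h
  exact SimpleGraph.dist_le p

theorem WalkLen.of_seq {x : ℕ → ℕ} {a b : ℕ} (hab : a ≤ b) (ha : x a < I.n)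
    (h : ∀ i, a ≤ i → i < b → I.Adj (x i) (x (i + 1))) : I.WalkLen (b - a) (x a) (x b) := by
  induction b, hab using Nat.le_induction with
  | base => simpa using WalkLen.refl ha
  | succ b hab ih =>
    rw [show b + 1 - a = b - a + 1 by omega]
    exact (ih fun i h1 h2 => h i h1 (by omega)).trans (h b hab (by omega)).walkLen

theorem exists_walk (d : ℕ) (x : ℕ → ℕ) (h0 : x 0 < I.n)
    (h : ∀ i < d, I.Adj (x i) (x (i + 1))) :
    ∃ (hd : x d < I.n) (p : I.G.Walk ⟨x 0, h0⟩ ⟨x d, hd⟩), p.length = d ∧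
      ∀ i ≤ d, (p.getVert i : ℕ) = x i := by
  induction d generalizing x with
  | zero => exact ⟨h0, .nil, rfl, fun i hi => by simp [Nat.le_zero.1 hi]⟩
  | succ d ih =>
    obtain ⟨_, h1, hadj⟩ := h 0 (by omega)
    obtain ⟨hd, p, hp, hpx⟩ := ih (fun i => x (i + 1)) h1 fun i hi => h (i + 1) (by omega)
    refine ⟨hd, .cons hadj p, by simp [hp], fun i hi => ?_⟩
    rcases i with _ | i
    · simp
    · simpa using hpx i (by omega)

theorem colorCount_eq {u v : Fin I.n} (p : I.G.Walk u v) (hp : p.IsPath) (i : Fin I.c) :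
    I.colorCount p i =
      ((Finset.range (p.length + 1)).filter fun a => I.col (p.getVert a) = i).card := by
  classical
  unfold colorCount
  refine (Finset.card_bij (fun a _ => p.getVert a) ?_ ?_ ?_).symm
  · intro a ha
    simp only [Finset.mem_filter, col_fin] at ha
    simp only [Finset.mem_filter, List.mem_toFinset]
    exact ⟨p.getVert_mem_support a, Fin.ext ha.2⟩
  · intro a ha b hb hab
    simp only [Finset.mem_filter, Finset.mem_range, Nat.lt_succ_iff] at ha hb
    exact hp.getVert_injOn ha.1 hb.1 hab
  · intro w hw
    simp only [Finset.mem_filter, List.mem_toFinset] at hw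
    obtain ⟨a, rfl, ha⟩ := SimpleGraph.Walk.mem_support_iff_exists_getVert.1 hw.1
    exact ⟨a, by simp [col_fin, hw.2]; omega, rfl⟩

/-- The length of a shortest path between the two terminals. -/
noncomputable def terminalDist (I : BFSPInstance) : ℕ := I.G.dist I.s I.t

/-- A walk of length equal to the distance is a path, so counting vertices and counting positions
agree. If `t` is unreachable, the distance has the value `0`, and no sequence exists because `s ≠
t`. -/
theorem isYes_iff : I.IsYes ↔ ∃ x, PathSeq I.Adj I.s I.t I.terminalDist x ∧
    FairSeq I.c I.col I.terminalDist x := by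
  constructor
  · rintro ⟨p, hp, hlen, hfair⟩
    refine ⟨fun i => p.getVert i, ⟨by simp, by simp [terminalDist, ← hlen], fun i hi => ?_⟩,
      fun i hi j hj => ?_⟩
    · exact (adj_fin _ _).2 (p.adj_getVert_succ (by rwa [hlen]))
    · have := hfair ⟨i, hi⟩ ⟨j, hj⟩
      rwa [colorCount_eq p hp, colorCount_eq p hp, hlen] at this
  · rintro ⟨x, ⟨h0, hd, hadj⟩, hfair⟩
    obtain ⟨hd', p, hp, hpx⟩ := exists_walk I.terminalDist x (h0 ▸ I.s.2) hadj
    let p' : I.G.Walk I.s I.t := p.copy (Fin.ext h0) (Fin.ext hd)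
    have hlen : p'.length = I.G.dist I.s I.t := by
      rw [← terminalDist, ← hp]; exact SimpleGraph.Walk.length_copy _ _ _
    have hpath := p'.isPath_of_length_eq_dist hlen
    refine ⟨p', hpath, hlen, fun i j => ?_⟩
    rw [colorCount_eq p' hpath, colorCount_eq p' hpath, hlen]
    refine (fairSeq_congr fun a ha => ?_).1 hfair i i.2 j j.2
    simp only [p', SimpleGraph.Walk.getVert_copy]
    rw [hpx a ha]

theorem pathSeq_lt {d : ℕ} {x : ℕ → ℕ} (hx : PathSeq I.Adj I.s I.t d x) {i : ℕ} (hi : i ≤ d) :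
    x i < I.n := by
  rcases hi.eq_or_lt with rfl | hi
  · rw [hx.2.1]; exact I.t.2
  · exact (hx.2.2 i hi).lt.1

/-- A repeated vertex or a chord would be a shortcut, giving a walk between the terminals that is
shorter than their distance. -/
theorem pathSeq_geodesic {x : ℕ → ℕ} (hx : PathSeq I.Adj I.s I.t I.terminalDist x) {i j : ℕ}
    (hij : i < j) (hj : j ≤ I.terminalDist) :
    x i ≠ x j ∧ (I.Adj (x i) (x j) ↔ j = i + 1) := by
  have h1 : I.WalkLen i I.s (x i) := by
    have := WalkLen.of_seq (I := I) (x := x) (Nat.zero_le i) (hx.1 ▸ I.s.2)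
      fun l _ hl => hx.2.2 l (by omega)
    rwa [hx.1] at this
  have h2 : I.WalkLen (I.terminalDist - j) (x j) I.t := by
    have := WalkLen.of_seq (I := I) (x := x) hj (pathSeq_lt hx hj)
      fun l _ hl => hx.2.2 l (by omega)
    rwa [hx.2.1] at this
  refine ⟨fun heq => ?_, fun hadj => ?_, ?_⟩
  · have := (h1.trans (heq ▸ h2)).dist_le
    rw [← terminalDist] at this
    omega
  · have := ((h1.trans hadj.walkLen).trans h2).dist_le
    rw [← terminalDist] at this
    omega
  · rintro rfl
    exact hx.2.2 i (by omega)

theorem pathSeq_indPath {x : ℕ → ℕ} (hx : PathSeq I.Adj I.s I.t I.terminalDist x) {a h : ℕ}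
    (ha : a + h ≤ I.terminalDist + 1) : IndPath I.Adj h fun i => x (a + i) := by
  intro j hj i hij
  have := pathSeq_geodesic hx (i := a + i) (j := a + j) (by omega) (by omega)
  exact ⟨this.1, this.2.trans (by omega)⟩

/-- The set `X` hits all induced paths on `h` vertices. -/
def Hits (I : BFSPInstance) (h : ℕ) (X : Finset ℕ) : Prop :=
  ∀ x : ℕ → ℕ, (∀ i < h, x i < I.n) → IndPath I.Adj h x → ∃ i < h, x i ∈ X

/-- An induced path that avoids `X` would survive the deletion of `X`. -/
theorem hits_of_pathFree {h : ℕ} {X : Finset (Fin I.n)}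
    (hX : PathFree h (I.G.induce {v : Fin I.n | v ∉ X})) : I.Hits h (X.map Fin.valEmbedding) := by
  intro x hxn hx
  by_contra hno
  push Not at hno
  have hmem : ∀ i : Fin h, (⟨x i, hxn i i.2⟩ : Fin I.n) ∉ X := fun i hi =>
    hno i i.2 (Finset.mem_map.2 ⟨_, hi, rfl⟩)
  refine hX ⟨⟨⟨fun i => ⟨⟨x i, hxn i i.2⟩, hmem i⟩, fun i j hij => ?_⟩, fun {i j} => ?_⟩⟩
  · have hij' : x i = x j := by simpa using hij
    by_contra hne
    rcases lt_or_gt_of_ne hne with hlt | hlt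
    · exact (hx j j.2 i hlt).1 hij'
    · exact (hx i i.2 j hlt).1 hij'.symm
  · have hadj : ∀ i j : Fin h, I.G.Adj ⟨x i, hxn i i.2⟩ ⟨x j, hxn j j.2⟩ ↔ I.Adj (x i) (x j) :=
      fun i j => (adj_fin ⟨x i, hxn i i.2⟩ ⟨x j, hxn j j.2⟩).symm
    change I.G.Adj ⟨x i, hxn i i.2⟩ ⟨x j, hxn j j.2⟩ ↔ _
    rw [SimpleGraph.pathGraph_adj]
    rcases lt_trichotomy i j with hlt | rfl | hlt
    · rw [hadj, (hx j j.2 i hlt).2]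
      have : (i : ℕ) < j := hlt
      omega
    · simp
    · rw [SimpleGraph.adj_comm, hadj, (hx i i.2 j hlt).2]
      have : (j : ℕ) < i := hlt
      omega

theorem exists_hits {h : ℕ} (hh : 1 ≤ h) (I : BFSPInstance) :
    ∃ X : Finset ℕ, X.card = distToPathFree h I.G ∧ I.Hits h X := by
  have hne : {k : ℕ | ∃ S : Finset (Fin I.n), S.card = k ∧
      PathFree h (I.G.induce {v : Fin I.n | v ∉ S})}.Nonempty := by
    refine ⟨_, Finset.univ, rfl, ?_⟩
    rintro ⟨f⟩
    exact (f ⟨0, hh⟩).2 (Finset.mem_univ _)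
  obtain ⟨S, hS, hfree⟩ := Nat.sInf_mem hne
  exact ⟨S.map Fin.valEmbedding, by rw [Finset.card_map]; exact hS, hits_of_pathFree hfree⟩

theorem distToPathFree_le {h : ℕ} (hh : 1 ≤ h) (I : BFSPInstance) :
    distToPathFree h I.G ≤ I.n := by
  refine Nat.sInf_le ⟨Finset.univ, by simp, ?_⟩
  rintro ⟨f⟩
  exact (f ⟨0, hh⟩).2 (Finset.mem_univ _)

/-- A path with `h (k + 1)` vertices contains `k + 1` disjoint blocks of `h` vertices. Each block is
an induced path, so a deletion set with only `k` members cannot meet them all. -/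
theorem terminalDist_lt {h : ℕ} (hh : 1 ≤ h) {x : ℕ → ℕ}
    (hx : PathSeq I.Adj I.s I.t I.terminalDist x) :
    I.terminalDist + 1 < h * (distToPathFree h I.G + 1) := by
  obtain ⟨X, hX, hhits⟩ := exists_hits hh I
  rw [← hX]
  by_contra hge
  push Not at hge
  have hblock : ∀ b < X.card + 1, h * b + h ≤ I.terminalDist + 1 := fun b hb => by
    refine le_trans ?_ hge
    rw [← Nat.mul_succ]
    exact Nat.mul_le_mul_left h hb
  have hhit : ∀ b : Fin (X.card + 1), ∃ i < h, x (h * b + i) ∈ X := fun b =>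
    hhits _ (fun i hi => pathSeq_lt hx (by have := hblock b b.2; omega))
      (pathSeq_indPath hx (hblock b b.2))
  choose g hg hgX using hhit
  have hcard : X.card < (Finset.univ : Finset (Fin (X.card + 1))).card := by simp
  obtain ⟨b, -, b', -, hne, heq⟩ := Finset.exists_ne_map_eq_of_card_lt_of_maps_to hcard
    (fun b _ => hgX b)
  have hidx : h * b + g b = h * b' + g b' := by
    by_contra hne'
    have h1 := hblock b b.2
    have h2 := hblock b' b'.2
    have h3 := hg b
    have h4 := hg b'
    rcases lt_or_gt_of_ne hne' with hlt | hlt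
    · exact (pathSeq_geodesic hx hlt (by omega)).1 heq
    · exact (pathSeq_geodesic hx hlt (by omega)).1 heq.symm
  refine hne (Fin.ext ?_)
  have e1 : (h * b + g b) / h = b := by
    rw [Nat.mul_add_div (by omega), Nat.div_eq_of_lt (hg b), add_zero]
  have e2 : (h * b' + g b') / h = b' := by
    rw [Nat.mul_add_div (by omega), Nat.div_eq_of_lt (hg b'), add_zero]
  rw [← e1, ← e2, hidx]

end BFSPInstance

namespace BFSPInstance

variable {I : BFSPInstance}

/-! ### Restricting an instance to a kernel -/

theorem WalkLen.exists_pathSeq {r : ℕ} (h : I.WalkLen r I.s I.t) :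
    ∃ x, PathSeq I.Adj I.s I.t I.terminalDist x := by
  obtain ⟨_, _, p, -⟩ := h
  obtain ⟨p, hp⟩ := p.reachable.exists_walk_length_eq_dist
  exact ⟨fun i => p.getVert i, by simp, by simp [terminalDist, ← hp],
    fun i hi => (adj_fin _ _).2 (p.adj_getVert_succ (by rwa [hp]))⟩

theorem PathSeq.walkLen {d : ℕ} {x : ℕ → ℕ} (hx : PathSeq I.Adj I.s I.t d x) :
    I.WalkLen d I.s I.t := by
  have := WalkLen.of_seq (I := I) (x := x) (Nat.zero_le d) (hx.1 ▸ I.s.2)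
    fun l _ hl => hx.2.2 l (by omega)
  rwa [hx.1, hx.2.1] at this

theorem terminalDist_lt_n {x : ℕ → ℕ} (hx : PathSeq I.Adj I.s I.t I.terminalDist x) :
    I.terminalDist < I.n := by
  have : ((Finset.range (I.terminalDist + 1)).image x).card ≤ (Finset.range I.n).card := by
    refine Finset.card_le_card fun v hv => ?_
    obtain ⟨i, hi, rfl⟩ := Finset.mem_image.1 hv
    exact Finset.mem_range.2 (pathSeq_lt hx (by simpa [Nat.lt_succ_iff] using hi))
  rwa [Finset.card_image_of_injOn, Finset.card_range, Finset.card_range] at this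
  intro i hi j hj hij
  simp only [Finset.coe_range, Set.mem_Iio] at hi hj
  by_contra hne
  rcases lt_or_gt_of_ne hne with hlt | hlt
  · exact (pathSeq_geodesic hx hlt (by omega)).1 hij
  · exact (pathSeq_geodesic hx hlt (by omega)).1 hij.symm

/-- The set `K` contains the terminals, hits all induced paths on `h` vertices, and represents the
short segments between the vertices of such a hitting set. -/
structure IsKernelSet (I : BFSPInstance) (h : ℕ) (S K : Set ℕ) : Prop where
  s_mem : (I.s : ℕ) ∈ S
  t_mem : (I.t : ℕ) ∈ S
  subset : S ⊆ K
  hits : ∀ x : ℕ → ℕ, (∀ i < h, x i < I.n) → IndPath I.Adj h x → ∃ i < h, x i ∈ S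
  represents : I.WalkLen I.terminalDist I.s I.t → ∀ q, 1 ≤ q → q < h → ∀ u ∈ S, ∀ v ∈ S,
    RepresentsSegments I.Adj (I.c ≤ I.terminalDist + 1) I.col I.n (I.terminalDist + 1) q u v K

theorem IsKernelSet.exists_pathSeq {h : ℕ} {S K : Set ℕ} (hK : I.IsKernelSet h S K) {x : ℕ → ℕ}
    (hx : PathSeq I.Adj I.s I.t I.terminalDist x) (hf : FairSeq I.c I.col I.terminalDist x) :
    ∃ y, PathSeq I.Adj I.s I.t I.terminalDist y ∧ FairSeq I.c I.col I.terminalDist y ∧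
      ∀ i ≤ I.terminalDist, y i ∈ K := by
  refine exists_pathSeq_in (h := h) hK.s_mem hK.t_mem hK.subset (fun x hx a ha => ?_)
    (fun x hx hf a q hq hqh haq hau hav => ?_) hx hf
  · exact hK.hits _ (fun i hi => pathSeq_lt hx (by omega)) (pathSeq_indPath hx ha)
  · exact (hK.represents (PathSeq.walkLen hx) q hq hqh _ hau _ hav).exists_replacement
      (fun u v h => h.lt) Iff.rfl (fun v hv => col_lt hv) hx (fun i hi => pathSeq_lt hx hi) hf hq haq

/-- The instance in which all vertices have the same colour. -/
def monochrome (I : BFSPInstance) : BFSPInstance := { I with c := 1, χ := fun _ => 0 }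

theorem monochrome_col (I : BFSPInstance) (v : ℕ) : I.monochrome.col v = 0 := by
  unfold col
  split <;> rfl

/-- The vertices of `I'` correspond to vertices of `I` with numbers given by `old`, among them all
vertices in `K`, and `I'` has the induced adjacencies and the induced colouring, up to a renaming of
the colours if the colours outnumber the vertices. -/
structure IsRestriction (I I' : BFSPInstance) (K : Set ℕ) (old : ℕ → ℕ) : Prop where
  adj_iff : ∀ i < I'.n, ∀ j < I'.n, (I'.Adj i j ↔ I.Adj (old i) (old j))
  s_eq : old I'.s = I.s
  t_eq : old I'.t = I.t
  inj : ∀ i < I'.n, ∀ j < I'.n, old i = old j → i = j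
  lt : ∀ i < I'.n, old i < I.n
  surj : ∀ v ∈ K, ∃ i < I'.n, old i = v
  col : (I'.c = I.c ∧ ∀ i < I'.n, I'.col i = I.col (old i)) ∨
    (I'.n < I'.c ∧ I'.n < I.c ∧
      ∀ i < I'.n, ∀ j < I'.n, (I'.col i = I'.col j ↔ I.col (old i) = I.col (old j)))

/-- Paths of `I'` are paths of `I` by `hpush`, and paths of `I` inside `K` come from `I'` by
`hpull`. A fair shortest path of `I` can be moved into `K`, so it remains to see that the
restriction preserves the distance and fairness. -/
theorem IsRestriction.isYes_iff {I I' : BFSPInstance} {h : ℕ} {S K : Set ℕ} {old : ℕ → ℕ}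
    (hr : IsRestriction I I' K old) (hK : I.IsKernelSet h S K)
    (hK₁ : I.monochrome.IsKernelSet h S K) : I'.IsYes ↔ I.IsYes := by
  obtain ⟨hadj, hs, ht, hinj, hlt, hsurj, hcol⟩ := hr
  have hpush : ∀ r x, PathSeq I'.Adj I'.s I'.t r x →
      PathSeq I.Adj I.s I.t r fun i => old (x i) := fun r x hx =>
    ⟨by simp only [hx.1, hs], by simp only [hx.2.1, ht], fun i hi =>
      (hadj _ (hx.2.2 i hi).lt.1 _ (hx.2.2 i hi).lt.2).1 (hx.2.2 i hi)⟩
  have hpull : ∀ y, PathSeq I.Adj I.s I.t I.terminalDist y → (∀ i ≤ I.terminalDist, y i ∈ K) →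
      ∃ x, PathSeq I'.Adj I'.s I'.t I.terminalDist x ∧ ∀ i ≤ I.terminalDist, old (x i) = y i := by
    intro y hy hyK
    have : ∀ i, ∃ j, i ≤ I.terminalDist → j < I'.n ∧ old j = y i := fun i => by
      by_cases hi : i ≤ I.terminalDist
      · obtain ⟨j, hj⟩ := hsurj _ (hyK i hi)
        exact ⟨j, fun _ => hj⟩
      · exact ⟨0, fun h => absurd h hi⟩
    choose x hx using this
    refine ⟨x, ⟨?_, ?_, fun i hi => ?_⟩, fun i hi => (hx i hi).2⟩
    · exact hinj _ (hx 0 (Nat.zero_le _)).1 _ I'.s.2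
        (((hx 0 (Nat.zero_le _)).2.trans hy.1).trans hs.symm)
    · exact hinj _ (hx _ le_rfl).1 _ I'.t.2 (((hx _ le_rfl).2.trans hy.2.1).trans ht.symm)
    · rw [hadj _ (hx i hi.le).1 _ (hx (i + 1) hi).1, (hx i hi.le).2, (hx (i + 1) hi).2]
      exact hy.2.2 i hi
  have hdist : ∀ r, I.WalkLen r I.s I.t → I'.terminalDist = I.terminalDist := by
    intro r hr
    obtain ⟨x, hx⟩ := hr.exists_pathSeq
    -- In the monochromatic instance every path is fair, so an arbitrary shortest path can be moved
    -- into `K`. Hence the distance does not grow.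
    obtain ⟨y, hy, -, hyK⟩ := hK₁.exists_pathSeq (x := x) hx
      fun i hi j hj => by
        change i < 1 at hi
        change j < 1 at hj
        obtain rfl : i = 0 := by omega
        obtain rfl : j = 0 := by omega
        exact Nat.le_succ _
    obtain ⟨x', hx', -⟩ := hpull y hy hyK
    have hw := PathSeq.walkLen hx'
    obtain ⟨x'', hx''⟩ := hw.exists_pathSeq
    exact le_antisymm hw.dist_le (PathSeq.walkLen (hpush _ _ hx'')).dist_le
  have hfair : ∀ x, I'.terminalDist = I.terminalDist →
      PathSeq I'.Adj I'.s I'.t I'.terminalDist x →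
      (FairSeq I'.c I'.col I'.terminalDist x ↔
        FairSeq I.c I.col I'.terminalDist fun i => old (x i)) := by
    intro x hd hx
    rcases hcol with ⟨hc, hcol⟩ | ⟨hc', hc, hcol⟩
    · rw [hc]
      exact fairSeq_congr fun i hi => hcol _ (pathSeq_lt hx hi)
    -- A shortest path of `I'` has at most `I'.n` vertices, fewer than the colours of either
    -- instance, so fairness means distinct colours on both sides.
    · have hdn := terminalDist_lt_n hx
      rw [fairSeq_iff_injOn (by omega) fun i hi => col_lt (pathSeq_lt hx hi),
        fairSeq_iff_injOn (by omega) fun i hi => col_lt (hlt _ (pathSeq_lt hx hi))]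
      refine forall₂_congr fun i hi => forall₂_congr fun j hj => imp_congr_left ?_
      simp only [Finset.coe_range, Set.mem_Iio] at hi hj
      exact hcol _ (pathSeq_lt hx (by omega)) _ (pathSeq_lt hx (by omega))
  rw [BFSPInstance.isYes_iff, BFSPInstance.isYes_iff]
  constructor
  · rintro ⟨x, hx, hf⟩
    have hd := hdist _ (PathSeq.walkLen (hpush _ _ hx))
    have hf' := (hfair x hd hx).1 hf
    have hx' := hpush _ _ hx
    rw [hd] at hf' hx'
    exact ⟨_, hx', hf'⟩
  · rintro ⟨y, hy, hf⟩
    have hd := hdist _ (PathSeq.walkLen hy)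
    obtain ⟨y, hy, hf, hyK⟩ := hK.exists_pathSeq hy hf
    obtain ⟨x, hx, hxy⟩ := hpull y hy hyK
    rw [← hd] at hx
    refine ⟨x, hx, (hfair x hd hx).2 ((fairSeq_congr fun i hi => ?_).1 (hd ▸ hf))⟩
    rw [hxy i (by omega)]

end BFSPInstance

open WordRAM

/-! ### Digits of codes and the marking of words. -/

namespace WordRAM

/-- The digit number `i` of the value of `e`, in the base that is stored in the variable `0`. -/
def Expr.digit (e : Expr) (i : ℕ) : Expr := e / Expr.pow (.var 0) i % .var 0

/-- The entry of the adjacency matrix for the values of `a` and `b`. -/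
def Expr.adj (a b : Expr) : Expr := .get 1 (a * .var 0 + b)

/-- Store `1` in the cells of the array `a` whose numbers are the first `q` digits of `e`. -/
def Program.mark (a : ℕ) (e : Expr) : ℕ → Program
  | 0 => .skip
  | q + 1 => .seq (Program.mark a e q) (.store a (e.digit q) (.lit 1))

@[simp] theorem Program.writesVar_mark (a x : ℕ) (e : Expr) (q : ℕ) :
    (Program.mark a e q).WritesVar x ↔ False := by
  induction q with
  | zero => rfl
  | succ q ih => simp [Program.mark, Program.WritesVar, ih]

@[simp] theorem Program.writesArr_mark (a b : ℕ) (e : Expr) (q : ℕ) :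
    (Program.mark a e q).WritesArr b ↔ b = a ∧ 0 < q := by
  induction q with
  | zero => simp [Program.mark, Program.WritesArr]
  | succ q ih => simp [Program.mark, Program.WritesArr, ih]; tauto

/-- The number of steps of a program without loops, all tests being taken. -/
def Program.straightCost : Program → ℕ
  | .skip => 1
  | .assign _ e => e.cost + 1
  | .store _ i e => i.cost + e.cost + 1
  | .seq p q => p.straightCost + q.straightCost
  | .ite e p q => e.cost + 1 + max p.straightCost q.straightCost
  | .loop _ _ => 0

variable {W n : ℕ} {σ : State}

theorem Expr.Ev.digit {e : Expr} {k i : ℕ} (h0 : σ.var 0 = n) (hn : 0 < n) (hi : n ^ i ≤ W)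
    (hnW : n ≤ W) (he : e.Ev W σ k) : (e.digit i).Ev W σ (word n k i) :=
  Ev.mod (Ev.div he (Ev.pow hn (Ev.var h0 hnW) i hi)) (Ev.var h0 hnW)

theorem Runs.mark {a x k : ℕ} (h0 : σ.var 0 = n) (hn : 0 < n) (hx : σ.var x = k) (hk : k ≤ W)
    (q : ℕ) (hq : n ^ q ≤ W) (hnW : n ≤ W) {S : Finset ℕ} (hS : ∀ v, σ.arr a v = ind (v ∈ S)) :
    Runs W (.mark a (.var x) q) σ (Program.mark a (.var x) q).straightCost fun τ =>
      ∀ v, τ.arr a v = ind (v ∈ S ∪ (Finset.range q).image (word n k)) := by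
  induction q with
  | zero => exact Runs.skip (by simpa using hS)
  | succ q ih =>
    have hq' : n ^ q ≤ W := (Nat.pow_le_pow_right hn (Nat.le_succ q)).trans hq
    refine Runs.seq (ih hq') fun τ hf hτ => ?_
    have h0' : τ.var 0 = n := (hf.1 0 (by simp)).trans h0
    have hx' : τ.var x = k := (hf.1 x (by simp)).trans hx
    refine Runs.store (Expr.Ev.digit h0' hn hq' hnW (Expr.Ev.var hx' hk))
      (Expr.Ev.lit (by omega)) fun v => ?_
    rw [setArr_arr_self, Function.update_apply, Finset.range_add_one, Finset.image_insert]
    split_ifs with h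
    · exact (ind_pos (by simp [h])).symm
    · rw [hτ v]
      exact ind_congr (by simp [h])

end WordRAM

namespace BFSPInstance

variable {I : BFSPInstance} {W : ℕ} {σ : State}

/-- The state holds the numbers of the instance and its adjacency matrix, and words are large
enough for codes of words of length `h`. -/
structure Loaded (I : BFSPInstance) (h W : ℕ) (σ : State) : Prop where
  n_eq : σ.var 0 = I.n
  c_eq : σ.var 1 = I.c
  s_eq : σ.var 2 = I.s
  t_eq : σ.var 3 = I.t
  adj_eq : ∀ u < I.n, ∀ v < I.n, σ.arr 1 (u * I.n + v) = ind (I.Adj u v)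
  pow_le : (I.n + 2) ^ (h + 5) ≤ W
  c_le : I.c + 2 ≤ W

theorem Loaded.frame {h : ℕ} {p : Program} {τ : State} (hσ : I.Loaded h W σ) (hf : Frame p σ τ)
    (hv : ∀ x < 4, ¬p.WritesVar x) (ha : ¬p.WritesArr 1) : I.Loaded h W τ where
  n_eq := (hf.1 0 (hv 0 (by omega))).trans hσ.n_eq
  c_eq := (hf.1 1 (hv 1 (by omega))).trans hσ.c_eq
  s_eq := (hf.1 2 (hv 2 (by omega))).trans hσ.s_eq
  t_eq := (hf.1 3 (hv 3 (by omega))).trans hσ.t_eq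
  adj_eq := by rw [hf.2 1 ha]; exact hσ.adj_eq
  pow_le := hσ.pow_le
  c_le := hσ.c_le

theorem Loaded.setVar {h x v : ℕ} (hσ : I.Loaded h W σ) (hx : 4 ≤ x) :
    I.Loaded h W (σ.setVar x v) :=
  hσ.frame (p := .assign x (.lit 0)) ⟨fun _ h => setVar_var_ne _ _ h, fun _ _ => rfl⟩
    (fun y hy => by simp [Program.WritesVar]; omega) (by simp [Program.WritesArr])

theorem Loaded.setArr {h a i v : ℕ} (hσ : I.Loaded h W σ) (ha : a ≠ 1) :
    I.Loaded h W (σ.setArr a i v) :=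
  hσ.frame (p := .store a (.lit 0) (.lit 0)) ⟨fun _ _ => rfl, fun _ h => setArr_arr_ne _ _ _ h⟩
    (fun y hy => by simp [Program.WritesVar]) (by simpa [Program.WritesArr] using ha.symm)

theorem Loaded.le {h : ℕ} (hσ : I.Loaded h W σ) {a i : ℕ} (ha : a ≤ (I.n + 2) ^ i)
    (hi : i ≤ h + 5) : a ≤ W :=
  (ha.trans (Nat.pow_le_pow_right (by omega) hi)).trans hσ.pow_le

theorem Loaded.n_pow_le {h : ℕ} (hσ : I.Loaded h W σ) {i : ℕ} (hi : i ≤ h + 4) :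
    I.n ^ i + 2 ≤ W := by
  refine hσ.le (i := i + 1) ?_ (by omega)
  have h1 : I.n ^ i ≤ (I.n + 2) ^ i := Nat.pow_le_pow_left (by omega) i
  have h2 : 1 ≤ (I.n + 2) ^ i := Nat.one_le_pow _ _ (by omega)
  have h3 := I.n_pos
  rw [pow_succ]
  nlinarith

theorem Loaded.n_le {h : ℕ} (hσ : I.Loaded h W σ) : I.n + 2 ≤ W := by
  simpa using hσ.n_pow_le (i := 1) (by omega)

theorem Loaded.ev_n {h : ℕ} (hσ : I.Loaded h W σ) : (Expr.var 0).Ev W σ I.n :=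
  Expr.Ev.var hσ.n_eq (by have := hσ.n_le; omega)

theorem mul_add_lt {n u v : ℕ} (hu : u < n) (hv : v < n) : u * n + v < n ^ 2 := by
  nlinarith

theorem Loaded.ev_adj {h u v : ℕ} (hσ : I.Loaded h W σ) {a b : Expr} (ha : a.Ev W σ u)
    (hb : b.Ev W σ v) (hu : u < I.n) (hv : v < I.n) :
    (Expr.adj a b).Ev W σ (ind (I.Adj u v)) := by
  have h2 := hσ.n_pow_le (i := 2) (by omega)
  have h3 := mul_add_lt hu hv
  exact Expr.Ev.get (Expr.Ev.add (Expr.Ev.mul ha hσ.ev_n (by omega)) hb (by omega))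
    (hσ.adj_eq u hu v hv) ((ind_le_one _).trans (by omega))

theorem Loaded.ev_digit {h k i : ℕ} (hσ : I.Loaded h W σ) (hi : i ≤ h) {e : Expr}
    (hx : e.Ev W σ k) : (e.digit i).Ev W σ (word I.n k i) := by
  have := hσ.n_pow_le (i := i) (by omega)
  exact Expr.Ev.digit hσ.n_eq I.n_pos (by omega) (by have := hσ.n_le; omega) hx

/-! ### Computing the distance of the terminals -/

/-- The number of vertices of a shortest path between the terminals, and zero if there is none. -/
noncomputable def level (I : BFSPInstance) : ℕ :=
  ind (∃ r, I.WalkLen r I.s I.t) * (I.terminalDist + 1)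

theorem level_le (I : BFSPInstance) : I.level ≤ I.n := by
  unfold level
  by_cases hr : ∃ r, I.WalkLen r I.s I.t
  · obtain ⟨x, hx⟩ := hr.choose_spec.exists_pathSeq
    rw [ind_pos hr, one_mul]
    exact terminalDist_lt_n hx
  · rw [ind_neg hr, zero_mul]
    exact Nat.zero_le _

/-- One relaxation step for the edge whose code is in the variable `4`. -/
def relax : Program :=
  .when (.adj (.digit (.var 4) 1) (.digit (.var 4) 0) *
      .op .lt (.get 2 (.digit (.var 4) 0) + .lit 1) (.get 2 (.digit (.var 4) 1)))
    (.store 2 (.digit (.var 4) 0) (.get 2 (.digit (.var 4) 1) - .lit 1))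

/-- After this program, the variable `6` holds the number of vertices of a shortest path. -/
def bfs : Program :=
  .seq (.store 2 (.var 2) (.var 0)) (.seq (.assign 5 (.pow (.var 0) 3)) (.seq (.for 4 5 relax)
    (.assign 6 (.op .lt (.lit 0) (.get 2 (.var 3)) * (.var 0 + .lit 1 - .get 2 (.var 3))))))

theorem WalkLen.eq_of_zero {u v : ℕ} (h : I.WalkLen 0 u v) : u = v := by
  obtain ⟨_, _, p, hp⟩ := h
  simpa using p.eq_of_length_eq_zero hp

/-- The invariant of the relaxation: `M v` is zero or `n` minus the length of a walk from `s` to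
`v`, and the edges with codes below `k` have been relaxed. -/
structure BfsInv (I : BFSPInstance) (k : ℕ) (M : ℕ → ℕ) : Prop where
  start : I.n ≤ M I.s
  sound : ∀ v < I.n, M v = 0 ∨ M v ≤ I.n ∧ I.WalkLen (I.n - M v) I.s v
  done : ∀ r u v, I.WalkLen r I.s u → I.Adj u v → (r * I.n + u) * I.n + v < k →
    I.n ≤ M v + r + 1

/-- The last edge of a walk with `r + 1` edges has been relaxed in round `r`, and all of its codes
in that round lie below `(r + 1) n²`. -/
theorem BfsInv.le_add {k : ℕ} {M : ℕ → ℕ} (hM : I.BfsInv k M) {r v : ℕ}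
    (hr : I.WalkLen r I.s v) (hk : r * I.n * I.n ≤ k) : I.n ≤ M v + r := by
  rcases r with _ | r
  · have := hM.start
    rwa [hr.eq_of_zero] at this
  · obtain ⟨w, hw, hwv⟩ := hr.exists_last
    refine (hM.done r w v hw hwv (lt_of_lt_of_le ?_ hk)).trans (by omega)
    have h1 := hwv.lt.1
    have h2 := hwv.lt.2
    calc (r * I.n + w) * I.n + v < (r * I.n + w + 1) * I.n := by rw [add_mul _ 1]; omega
      _ ≤ (r + 1) * I.n * I.n := Nat.mul_le_mul_right _ (by rw [add_mul]; omega)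

/-- The code of a step has the digits round, tail and head. The round is never read; it only makes
the edges be processed once per round. Storing `n` minus a length turns the initial zeros into the
label of unreached vertices. -/
theorem Runs.relax {h k : ℕ} (hσ : I.Loaded h W σ) (hk : σ.var 4 = k) (hkn : k < I.n ^ 3)
    (hM : I.BfsInv k (σ.arr 2)) :
    Runs W relax σ (relax.straightCost) fun τ => I.BfsInv (k + 1) (τ.arr 2) := by
  have hnW := hσ.n_le
  have h3 := hσ.n_pow_le (i := 3) (by omega)
  have hu : word I.n k 1 < I.n := word_lt I.n_pos _ _
  have hv : word I.n k 0 < I.n := word_lt I.n_pos _ _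
  set u := word I.n k 1 with hu'
  set v := word I.n k 0 with hv'
  have eu : (Expr.digit (.var 4) 1).Ev W σ u := by
    have h1 := hσ.n_pow_le (i := 1) (by omega)
    exact Expr.Ev.digit hσ.n_eq I.n_pos (by omega) (by omega) (Expr.Ev.var hk (by omega))
  have ev : (Expr.digit (.var 4) 0).Ev W σ v := by
    exact Expr.Ev.digit hσ.n_eq I.n_pos (by simp; omega) (by omega) (Expr.Ev.var hk (by omega))
  have hMn : ∀ v < I.n, σ.arr 2 v ≤ I.n := fun v hv => by
    rcases hM.sound v hv with h | h <;> omega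
  have hMu := hMn u hu
  have hMv := hMn v hv
  have eMu : (Expr.get 2 (.digit (.var 4) 1)).Ev W σ (σ.arr 2 u) := Expr.Ev.get eu rfl (by omega)
  have eMv : (Expr.get 2 (.digit (.var 4) 0)).Ev W σ (σ.arr 2 v) := Expr.Ev.get ev rfl (by omega)
  -- If the current code belongs to round `r`, all edges of the earlier rounds have been treated,
  -- which is what `BfsInv.le_add` needs.
  have hdec : ∀ r u' v', u' < I.n → v' < I.n → (r * I.n + u') * I.n + v' = k →
      u' = u ∧ v' = v ∧ r * I.n * I.n ≤ k := by
    rintro r u' v' hu1 hv1 rfl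
    refine ⟨?_, ?_, ?_⟩
    · rw [hu', word, pow_one, add_comm, Nat.add_mul_div_right _ _ I.n_pos,
        Nat.div_eq_of_lt hv1, zero_add, add_comm, Nat.add_mul_mod_self_right, Nat.mod_eq_of_lt hu1]
    · rw [hv', word, pow_zero, Nat.div_one, add_comm, Nat.add_mul_mod_self_right,
        Nat.mod_eq_of_lt hv1]
    · rw [add_mul]; omega
  have hcost : Program.straightCost BFSPInstance.relax = _ := rfl
  refine (Runs.when (B := (Program.store 2 (.digit (.var 4) 0)
      (.get 2 (.digit (.var 4) 1) - .lit 1)).straightCost) (c := I.Adj u v ∧ σ.arr 2 v + 1 < σ.arr 2 u)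
    (by simp [Program.straightCost]) (Expr.Ev.and (hσ.ev_adj eu ev hu hv)
      (Expr.Ev.lt (by omega) (Expr.Ev.add eMv (Expr.Ev.lit (by omega)) (by omega)) eMu)) ?_ ?_).le ?_
  · rintro ⟨hadj, hlt⟩
    refine Runs.store ev (Expr.Ev.sub eMu (Expr.Ev.lit (by omega))) ?_
    rw [setArr_arr_self]
    have hge : ∀ w, σ.arr 2 w ≤ Function.update (σ.arr 2) v (σ.arr 2 u - 1) w := fun w => by
      rw [Function.update_apply]
      split_ifs with h
      · subst h; omega
      · exact le_rfl
    refine ⟨hM.start.trans (hge _), fun w hw => ?_, fun r u' v' hr hadj' hlt' => ?_⟩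
    · rw [Function.update_apply]
      split_ifs with h
      · subst h
        right
        rcases hM.sound u hu with h0 | ⟨hle, hwalk⟩
        · omega
        · refine ⟨by omega, ?_⟩
          rw [show I.n - (σ.arr 2 u - 1) = I.n - σ.arr 2 u + 1 by omega]
          exact hwalk.trans hadj.walkLen
      · exact hM.sound w hw
    · rcases Nat.lt_succ_iff_lt_or_eq.1 hlt' with hlt' | heq
      · exact (hM.done r u' v' hr hadj' hlt').trans (by have := hge v'; omega)
      · obtain ⟨rfl, rfl, hrk⟩ := hdec r u' v' hadj'.lt.1 hadj'.lt.2 heq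
        have := hM.le_add hr hrk
        rw [Function.update_self]
        omega
  · intro hno
    refine ⟨hM.start, hM.sound, fun r u' v' hr hadj' hlt' => ?_⟩
    rcases Nat.lt_succ_iff_lt_or_eq.1 hlt' with hlt' | heq
    · exact hM.done r u' v' hr hadj' hlt'
    · obtain ⟨rfl, rfl, hrk⟩ := hdec r u' v' hadj'.lt.1 hadj'.lt.2 heq
      have := hM.le_add hr hrk
      have : ¬σ.arr 2 v + 1 < σ.arr 2 u := fun h => hno ⟨hadj', h⟩
      omega
  · rw [hcost]
    exact Nat.add_le_add_left (le_max_left _ _) _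

theorem exists_runs_bfs : ∃ D, ∀ (I : BFSPInstance) (h W : ℕ) (σ : State), I.Loaded h W σ →
    (∀ v, σ.arr 2 v = 0) → Runs W bfs σ (D * I.n ^ 4) fun τ => τ.var 6 = I.level := by
  refine ⟨2 * bfs.straightCost + 2 * relax.straightCost + 100, fun I h W σ hσ h0 => ?_⟩
  have hnW := hσ.n_le
  have h3 := hσ.n_pow_le (i := 3) (by omega)
  have hs := I.s.2
  have ht := I.t.2
  have hpos : 1 ≤ I.n ^ 4 := Nat.one_le_pow _ _ I.n_pos
  have hσ₁ := hσ.setArr (a := 2) (i := I.s) (v := I.n) (by omega)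
  refine (Runs.seq_store (Expr.Ev.var hσ.s_eq (by omega)) hσ.ev_n (Runs.seq_assign
    (Expr.Ev.pow I.n_pos hσ₁.ev_n 3 (by omega)) (Runs.seq (R := fun τ => I.BfsInv (I.n ^ 3) (τ.arr 2))
      (B := 6 + I.n ^ 3 * (relax.straightCost + 8)) (B' := bfs.straightCost) ?_ ?_))).le ?_
  · refine Runs.for (N := I.n ^ 3) (fun k τ => I.BfsInv k (τ.arr 2)) ?_ (by omega) (by omega)
      (by simp [relax, Program.WritesVar]) (by simp [relax, Program.WritesVar]) ?_ ?_
      (fun _ _ h => h)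
    · simp [setVar_var]
    · simp only [setVar_arr, setArr_arr_self]
      have : σ.arr 2 = fun _ => 0 := funext h0
      rw [this]
      refine ⟨by simp, fun v hv => ?_, fun r u v _ _ h => absurd h (Nat.not_lt_zero _)⟩
      rw [Function.update_apply]
      split_ifs with h
      · subst h
        exact Or.inr ⟨le_rfl, by simpa using WalkLen.refl hs⟩
      · exact Or.inl rfl
    · intro k hk τ hf hkτ hinv
      have hτ : I.Loaded h W τ := (hσ₁.setVar (x := 5) (by omega)).frame hf
        (by intro x hx; simp [relax, Program.WritesVar]; omega) (by simp [relax, Program.WritesArr])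
      exact Runs.relax hτ hkτ hk hinv
  · intro τ hf hM
    have hτ : I.Loaded h W τ := (hσ₁.setVar (x := 5) (by omega)).frame hf
        (by intro x hx; simp [relax, Program.WritesVar]; omega) (by simp [relax, Program.WritesArr])
    have hMt : τ.arr 2 I.t ≤ I.n := by
      rcases hM.sound I.t ht with h | h <;> omega
    -- After `n` rounds the label of a reachable `t` is exactly `n - d`, which is positive because
    -- `d < n`. The label is zero exactly if `t` is unreachable.
    have hval : ind (0 < τ.arr 2 I.t) * (I.n + 1 - τ.arr 2 I.t) = I.level := by
      unfold level
      by_cases hr : ∃ r, I.WalkLen r I.s I.t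
      · obtain ⟨x, hx⟩ := hr.choose_spec.exists_pathSeq
        have hlt := terminalDist_lt_n hx
        have := hM.le_add (PathSeq.walkLen hx)
          (by rw [pow_succ, pow_two]; gcongr)
        rcases hM.sound I.t ht with h0 | ⟨hle, hwalk⟩
        · omega
        · have := hwalk.dist_le
          rw [← terminalDist] at this
          rw [ind_pos hr, ind_pos (by omega)]
          omega
      · rw [ind_neg hr, ind_neg, zero_mul, zero_mul]
        intro hpos
        rcases hM.sound I.t ht with h0 | ⟨hle, hwalk⟩
        · omega
        · exact hr ⟨_, hwalk⟩
    have et : (Expr.get 2 (.var 3)).Ev W τ (τ.arr 2 I.t) :=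
      Expr.Ev.get (Expr.Ev.var hτ.t_eq (by omega)) rfl (by omega)
    have hlev := I.level_le
    have e1 := Expr.Ev.mul
      (Expr.Ev.lt (W := W) (by omega) (Expr.Ev.lit (k := 0) (by omega)) et)
      (Expr.Ev.sub (Expr.Ev.add hτ.ev_n (Expr.Ev.lit (k := 1) (by omega)) (by omega)) et)
      (by rw [hval]; omega)
    refine (Runs.assign e1 ?_).le ?_
    · rw [setVar_var_self, hval]
    · simp only [bfs, Program.straightCost]
      omega
  · have h34 : I.n ^ 3 ≤ I.n ^ 4 := Nat.pow_le_pow_right I.n_pos (by omega)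
    have e1 : (Expr.var 2).cost + (Expr.var 0).cost + 1 + ((Expr.pow (.var 0) 3).cost + 1) ≤
        bfs.straightCost := by
      simp only [bfs, Program.straightCost]; omega
    nlinarith

end BFSPInstance

namespace BFSPInstance

/-! ### A hitting set for the induced paths -/

/-- The test whether the digits of the variable `4` form an induced path on `h` vertices. -/
def indPathExpr (h : ℕ) : Expr :=
  Expr.all (fun j => Expr.all (fun i =>
    (Expr.op .eq (.digit (.var 4) i) (.digit (.var 4) j)).not *
      Expr.op .eq (.adj (.digit (.var 4) i) (.digit (.var 4) j)) (.lit (if j = i + 1 then 1 else 0)))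
        j) h

/-- The test whether the first `h` digits of the variable `4` are not marked in the array `3`. -/
def unmarkedExpr (h : ℕ) : Expr := Expr.all (fun i => (Expr.get 3 (.digit (.var 4) i)).not) h

/-- Mark in the array `3` the vertices of a maximal family of disjoint induced paths on `h`
vertices, and the terminals. -/
def modulator (h : ℕ) : Program :=
  .seq (.assign 5 (.pow (.var 0) h)) (.seq (.for 4 5 (.when (indPathExpr h * unmarkedExpr h)
    (.mark 3 (.var 4) h))) (.seq (.store 3 (.var 2) (.lit 1)) (.store 3 (.var 3) (.lit 1))))

variable {I : BFSPInstance} {h W : ℕ} {σ : State}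

theorem ev_indPathExpr {k : ℕ} (hσ : I.Loaded h W σ) (hk : σ.var 4 = k) (hkW : k ≤ W) :
    (indPathExpr h).Ev W σ (ind (IndPath I.Adj h (word I.n k))) := by
  have hW := hσ.n_le
  have ek : (Expr.var 4).Ev W σ k := Expr.Ev.var hk hkW
  refine Expr.Ev.all (by omega) h fun j hj => Expr.Ev.all (by omega) j fun i hij => ?_
  have ei := hσ.ev_digit (i := i) (by omega) ek
  have ej := hσ.ev_digit (i := j) (by omega) ek
  refine Expr.Ev.and (Expr.Ev.not (by omega) (Expr.Ev.eq (by omega) ei ej)) ?_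
  have := Expr.Ev.eq (σ := σ) (by omega) (hσ.ev_adj ei ej (word_lt I.n_pos _ _) (word_lt I.n_pos _ _))
    (Expr.Ev.lit (W := W) (k := if j = i + 1 then 1 else 0) (by split_ifs <;> omega))
  refine this.cast (ind_congr ?_)
  by_cases hA : I.Adj (word I.n k i) (word I.n k j) <;> by_cases hji : j = i + 1 <;>
    simp [ind, hA, hji]

theorem ev_unmarkedExpr {k : ℕ} {S : Finset ℕ} (hσ : I.Loaded h W σ) (hk : σ.var 4 = k)
    (hkW : k ≤ W) (hS : ∀ v, σ.arr 3 v = ind (v ∈ S)) :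
    (unmarkedExpr h).Ev W σ (ind (∀ i < h, word I.n k i ∉ S)) := by
  have hW := hσ.n_le
  refine Expr.Ev.all (by omega) h fun i hi => Expr.Ev.not (by omega) ?_
  exact Expr.Ev.get (hσ.ev_digit (by omega) (Expr.Ev.var hk hkW)) (hS _)
    ((ind_le_one _).trans (by omega))

/-- The invariant of the greedy algorithm: `S` is a union of disjoint induced paths on `h`
vertices and hits all such paths with codes below `k`. -/
structure GreedyInv (I : BFSPInstance) (h k : ℕ) (S : Finset ℕ) : Prop where
  lt : ∀ v ∈ S, v < I.n
  card_le : ∀ X : Finset ℕ, I.Hits h X → S.card ≤ h * (S ∩ X).card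
  hits : ∀ e < k, IndPath I.Adj h (word I.n e) → ∃ i < h, word I.n e i ∈ S

/-- For the cardinality: the new path is disjoint from `S`, adds at most `h` vertices to `S` and at
least one to `S ∩ X`, as `X` hits it. -/
theorem GreedyInv.union {k : ℕ} {S : Finset ℕ} (hS : I.GreedyInv h k S) (hh : 1 ≤ h)
    (hp : IndPath I.Adj h (word I.n k)) (hdisj : ∀ i < h, word I.n k i ∉ S) :
    I.GreedyInv h (k + 1) (S ∪ (Finset.range h).image (word I.n k)) where
  lt v hv := by
    rcases Finset.mem_union.1 hv with hv | hv
    · exact hS.lt v hv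
    · obtain ⟨i, -, rfl⟩ := Finset.mem_image.1 hv
      exact word_lt I.n_pos _ _
  card_le X hX := by
    set P := (Finset.range h).image (word I.n k)
    have hP : P.card ≤ h := by simpa using Finset.card_image_le (s := Finset.range h)
    have hSP : Disjoint S P := by
      rw [Finset.disjoint_right]
      intro v hv
      obtain ⟨i, hi, rfl⟩ := Finset.mem_image.1 hv
      exact hdisj i (Finset.mem_range.1 hi)
    have hPX : 1 ≤ (P ∩ X).card := by
      obtain ⟨i, hi, hiX⟩ := hX _ (fun i _ => word_lt I.n_pos _ _) hp
      exact Finset.one_le_card.2 ⟨_, Finset.mem_inter.2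
        ⟨Finset.mem_image_of_mem _ (Finset.mem_range.2 hi), hiX⟩⟩
    have hcard : ((S ∪ P) ∩ X).card = (S ∩ X).card + (P ∩ X).card := by
      rw [Finset.union_inter_distrib_right, Finset.card_union_of_disjoint]
      exact hSP.mono Finset.inter_subset_left Finset.inter_subset_left
    rw [hcard, mul_add]
    have := Finset.card_union_le S P
    have := hS.card_le X hX
    nlinarith
  hits e he hpe := by
    rcases Nat.lt_succ_iff_lt_or_eq.1 he with he | rfl
    · obtain ⟨i, hi, hiS⟩ := hS.hits e he hpe
      exact ⟨i, hi, Finset.mem_union_left _ hiS⟩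
    · exact ⟨0, hh, Finset.mem_union_right _
        (Finset.mem_image_of_mem _ (Finset.mem_range.2 hh))⟩

theorem exists_runs_modulator (hh : 1 ≤ h) : ∃ D, ∀ (I : BFSPInstance) (W : ℕ) (σ : State),
    I.Loaded h W σ → (∀ v, σ.arr 3 v = 0) → Runs W (modulator h) σ (D * I.n ^ h) fun τ =>
      ∃ S : Finset ℕ, (∀ v, τ.arr 3 v = ind (v ∈ S)) ∧ (∀ v ∈ S, v < I.n) ∧
        (I.s : ℕ) ∈ S ∧ (I.t : ℕ) ∈ S ∧ S.card ≤ h * distToPathFree h I.G + 2 ∧ I.Hits h S := by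
  refine ⟨(Expr.pow (.var 0) h).cost + 1 + 6 +
    ((indPathExpr h * unmarkedExpr h).cost + 1 + (Program.mark 3 (.var 4) h).straightCost + 8) +
      100, fun I W σ hσ h0 => ?_⟩
  have hnW := hσ.n_le
  have hh' := hσ.n_pow_le (i := h) (by omega)
  have hs := I.s.2
  have ht := I.t.2
  have hpos : 1 ≤ I.n ^ h := Nat.one_le_pow _ _ I.n_pos
  set B := (indPathExpr h * unmarkedExpr h).cost + 1 + (Program.mark 3 (.var 4) h).straightCost
  refine (Runs.seq_assign (Expr.Ev.pow I.n_pos hσ.ev_n h (by omega)) (Runs.seq (R := fun τ =>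
    ∃ S, I.GreedyInv h (I.n ^ h) S ∧ ∀ v, τ.arr 3 v = ind (v ∈ S)) (B := 6 + I.n ^ h * (B + 8))
      (B' := 100) ?_ ?_)).le ?_
  · refine Runs.for (N := I.n ^ h) (fun k τ => ∃ S, I.GreedyInv h k S ∧
      ∀ v, τ.arr 3 v = ind (v ∈ S)) (setVar_var_self _ _ _) (by omega) (by omega)
      (by simp) (by simp) ?_ ?_ (fun _ _ h => h)
    · exact ⟨∅, ⟨by simp, by simp, by simp⟩, fun v => by simp [setVar_arr, h0, ind]⟩
    · rintro k hk τ hf hkτ ⟨S, hS, hSτ⟩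
      have hτ : I.Loaded h W τ := (hσ.setVar (x := 5) (by omega)).frame hf
        (by intro x hx; simp; omega) (by simp)
      refine Runs.when ?_ (Expr.Ev.and (ev_indPathExpr hτ hkτ (by omega))
        (ev_unmarkedExpr hτ hkτ (by omega) hSτ)) ?_ ?_
      · cases h <;> simp [Program.mark, Program.straightCost]; omega
      · rintro ⟨hp, hdisj⟩
        refine (Runs.mark hτ.n_eq I.n_pos hkτ (by omega) h (by omega) (by omega) hSτ).mono le_rfl
          fun ρ _ hρ => ⟨_, hS.union hh hp hdisj, hρ⟩
      · intro hno
        refine ⟨S, ⟨hS.lt, hS.card_le, fun e he hpe => ?_⟩, hSτ⟩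
        rcases Nat.lt_succ_iff_lt_or_eq.1 he with he | rfl
        · exact hS.hits e he hpe
        · by_contra hno'
          push Not at hno'
          exact hno ⟨hpe, hno'⟩
  · rintro τ hf ⟨S, hS, hSτ⟩
    have hτ : I.Loaded h W τ := (hσ.setVar (x := 5) (by omega)).frame hf
        (by intro x hx; simp; omega) (by simp)
    have hτ' := hτ.setArr (a := 3) (i := I.s) (v := 1) (by omega)
    refine (Runs.seq_store (Expr.Ev.var hτ.s_eq (by omega)) (Expr.Ev.lit (k := 1) (by omega))
      (Runs.store (Expr.Ev.var hτ'.t_eq (by omega)) (Expr.Ev.lit (k := 1) (by omega)) ?_)).le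
        (by simp [Expr.cost])
    refine ⟨insert (I.t : ℕ) (insert (I.s : ℕ) S), fun v => ?_, ?_, by simp, by simp, ?_, ?_⟩
    · rw [setArr_arr_self, setArr_arr_self, Function.update_apply, Function.update_apply]
      split_ifs with h1 h2
      · exact (ind_pos (by simp [h1])).symm
      · exact (ind_pos (by simp [h2])).symm
      · rw [hSτ]
        exact ind_congr (by simp [h1, h2])
    · intro v hv
      simp only [Finset.mem_insert] at hv
      rcases hv with rfl | rfl | hv
      · exact ht
      · exact hs
      · exact hS.lt v hv
    -- The greedy bound is applied to a minimum deletion set; the summand 2 pays for the terminals.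
    · obtain ⟨X, hX, hhits⟩ := exists_hits hh I
      have h1 := hS.card_le X hhits
      have h2 : (S ∩ X).card ≤ X.card := Finset.card_le_card Finset.inter_subset_right
      have h3 := Finset.card_insert_le (I.t : ℕ) (insert (I.s : ℕ) S)
      have h4 := Finset.card_insert_le (I.s : ℕ) S
      have h5 := Nat.mul_le_mul_left h h2
      rw [hX] at h5
      omega
    · intro x hxn hx
      obtain ⟨e, he, hex⟩ := exists_word_eq hxn
      obtain ⟨i, hi, hiS⟩ := hS.hits e he fun j hj i hij => by
        rw [hex j hj, hex i (by omega)]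
        exact hx j hj i hij
      rw [hex i hi] at hiS
      exact ⟨i, hi, by simp [hiS]⟩
  · nlinarith

end BFSPInstance

namespace WordRAM

/-- A loop over at most `N` values whose body takes at most `a * n ^ g` steps. -/
theorem for_cost_le_const {n N B a g : ℕ} (hn : 1 ≤ n) (hB : B ≤ a * n ^ g) :
    6 + N * (B + 8) ≤ (6 + N * (a + 8)) * n ^ g := by
  have h1 : 1 ≤ n ^ g := Nat.one_le_pow _ _ hn
  calc 6 + N * (B + 8) ≤ 6 * n ^ g + N * (a * n ^ g + 8 * n ^ g) := by gcongr <;> omega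
    _ = (6 + N * (a + 8)) * n ^ g := by ring

/-! ### The selection of representative segments -/

/-- The binary digit number `i` of the variable `14`. -/
def bitExpr (i : ℕ) : Expr := .op .eq (.var 14 / .lit (2 ^ i) % .lit 2) (.lit 1)

/-- The test whether the digits of the code with the given number match those of the variable
`12` on the set with the code in the variable `14`. -/
def matchExpr (a q : ℕ) : Expr :=
  Expr.all (fun i => (bitExpr i * (Expr.any (fun j =>
    Expr.op .eq (.get a (.digit (.get 5 (.var 17)) j)) (.get a (.digit (.var 12) i)) *
      (.var 7 * (Expr.lit (if i = j then 1 else 0)).not).not) q).not).not) q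

/-- The threshold for the set with the code in the variable `14`. -/
def thresholdExpr (q : ℕ) : Expr :=
  Expr.prod (fun i => bitExpr i + (bitExpr i).not * .var 6) q

/-- The test whether the digits of the variable `12` form a segment between the vertices whose
numbers are the digits of the variable `10`. -/
def segmentExpr (a q : ℕ) : Expr :=
  .adj (.digit (.var 10) 1) (.digit (.var 12) 0) *
    (.adj (.digit (.var 12) (q - 1)) (.digit (.var 10) 0) *
      (Expr.all (fun i => .adj (.digit (.var 12) i) (.digit (.var 12) (i + 1))) (q - 1) *
        ((Expr.var 7).not * (Expr.all (fun j => Expr.all (fun i =>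
          (Expr.op .eq (.get a (.digit (.var 12) i)) (.get a (.digit (.var 12) j))).not) j) q).not).not))

/-- Count the selected words that match the word with the code in the variable `12`. -/
def countMatches (a q : ℕ) : Program :=
  .seq (.assign 16 (.lit 0)) (.for 17 11 (.assign 16 (.var 16 + matchExpr a q)))

/-- Count the sets of positions on which the word with the code in the variable `12` is matched by
too many selected words. -/
def countCovers (a q : ℕ) : Program :=
  .seq (.assign 13 (.lit 0)) (.for 14 15 (.seq (countMatches a q)
    (.assign 13 (.var 13 + (Expr.op .lt (.var 16) (thresholdExpr q)).not))))

/-- Add the word with the code in the variable `12` to the selected words and mark its vertices. -/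
def addWord (q : ℕ) : Program :=
  .seq (.store 5 (.var 11) (.var 12)) (.seq (.assign 11 (.var 11 + .lit 1)) (.mark 4 (.var 12) q))

/-- Select the word with the code in the variable `12`, if it is needed. -/
def selectWord (a q : ℕ) : Program :=
  .when (segmentExpr a q) (.seq (countCovers a q)
    (.when (.op .eq (.var 13) (.lit 0)) (addWord q)))

/-- Select representative segments for the pair of vertices with the code in the variable `10`. -/
def selectPair (a q : ℕ) : Program :=
  .when (.get 3 (.digit (.var 10) 1) * .get 3 (.digit (.var 10) 0))
    (.seq (.assign 11 (.lit 0)) (.for 12 9 (selectWord a q)))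

/-- Select representative segments with `q` inner vertices. -/
def select (a q : ℕ) : Program :=
  .seq (.assign 8 (.pow (.var 0) 2)) (.seq (.assign 9 (.pow (.var 0) q))
    (.seq (.assign 15 (.lit (2 ^ q))) (.for 10 8 (selectPair a q))))

section Writes

variable (a q x : ℕ)

@[simp] theorem writesVar_countMatches :
    (countMatches a q).WritesVar x ↔ x = 16 ∨ x = 17 := by
  simp [countMatches, Program.WritesVar]; omega

@[simp] theorem writesArr_countMatches : (countMatches a q).WritesArr x ↔ False := by
  simp [countMatches, Program.WritesArr]

@[simp] theorem writesVar_countCovers :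
    (countCovers a q).WritesVar x ↔ x = 13 ∨ x = 14 ∨ x = 16 ∨ x = 17 := by
  simp [countCovers, Program.WritesVar]; omega

@[simp] theorem writesArr_countCovers : (countCovers a q).WritesArr x ↔ False := by
  simp [countCovers, Program.WritesArr]

@[simp] theorem writesVar_selectWord : (selectWord a q).WritesVar x ↔
    x = 11 ∨ x = 13 ∨ x = 14 ∨ x = 16 ∨ x = 17 := by
  simp [selectWord, addWord, Program.WritesVar]; omega

@[simp] theorem writesArr_selectWord : (selectWord a q).WritesArr x ↔
    x = 5 ∨ (x = 4 ∧ 0 < q) := by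
  simp [selectWord, addWord, Program.WritesArr]

@[simp] theorem writesVar_selectPair : (selectPair a q).WritesVar x ↔
    x = 11 ∨ x = 12 ∨ x = 13 ∨ x = 14 ∨ x = 16 ∨ x = 17 := by
  simp [selectPair, Program.WritesVar]; omega

@[simp] theorem writesArr_selectPair : (selectPair a q).WritesArr x ↔
    x = 5 ∨ (x = 4 ∧ 0 < q) := by
  simp [selectPair, Program.WritesArr]

@[simp] theorem writesVar_select : (select a q).WritesVar x ↔
    x = 8 ∨ x = 9 ∨ x = 10 ∨ x = 11 ∨ x = 12 ∨ x = 13 ∨ x = 14 ∨ x = 15 ∨ x = 16 ∨ x = 17 := by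
  simp [select, Program.WritesVar]; omega

@[simp] theorem writesArr_select : (select a q).WritesArr x ↔
    x = 5 ∨ (x = 4 ∧ 0 < q) := by
  simp [select, Program.WritesArr]

end Writes

end WordRAM

/-! ### Growing a sparse family word by word. -/

section Families

variable {few : Prop} {col : ℕ → ℕ} {m q : ℕ}

theorem matchCount_succ (w : ℕ → ℕ → ℕ) (k : ℕ) (B : Finset ℕ) (v : ℕ → ℕ) :
    matchCount few col q w (k + 1) B v =
      matchCount few col q w k B v + ind (Matches few col q B v (w k)) := by
  classical
  unfold matchCount
  rw [Finset.range_add_one, Finset.filter_insert]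
  split_ifs with h
  · rw [Finset.card_insert_of_notMem (by simp), ind_pos h]
  · rw [ind_neg h, add_zero]

theorem matchCount_le (w : ℕ → ℕ → ℕ) (k : ℕ) (B : Finset ℕ) (v : ℕ → ℕ) :
    matchCount few col q w k B v ≤ k := by
  classical
  exact (Finset.card_filter_le _ _).trans (by simp)

theorem matchCount_congr {w w' : ℕ → ℕ → ℕ} {k : ℕ} (h : ∀ i < k, w i = w' i) (B : Finset ℕ)
    (v : ℕ → ℕ) : matchCount few col q w k B v = matchCount few col q w' k B v := by
  classical
  unfold matchCount
  congr 1
  exact Finset.filter_congr fun i hi => by rw [h i (Finset.mem_range.1 hi)]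

theorem Covered.mono {w w' : ℕ → ℕ → ℕ} {k l : ℕ} {v : ℕ → ℕ} (h : ∀ i < k, w i = w' i)
    (hkl : k ≤ l) (hc : Covered few col m q w k v) : Covered few col m q w' l v := by
  obtain ⟨B, hB, hle⟩ := hc
  rw [matchCount_congr h] at hle
  exact ⟨B, hB, hle.trans (matchCount_mono hkl B v)⟩

/-- This turns the search for a covering set of positions into a loop over `2 ^ q` binary codes. -/
theorem covered_iff_maskSet {w : ℕ → ℕ → ℕ} {k : ℕ} {v : ℕ → ℕ} :
    Covered few col m q w k v ↔ ∃ F < 2 ^ q,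
      ¬matchCount few col q w k (maskSet q F) v < m ^ (q - (maskSet q F).card) := by
  constructor
  · rintro ⟨B, hB, hle⟩
    obtain ⟨F, hF, rfl⟩ := exists_maskSet_eq hB
    exact ⟨F, hF, not_lt.2 hle⟩
  · rintro ⟨F, hF, hle⟩
    exact ⟨_, Finset.filter_subset _ _, not_lt.1 hle⟩

/-- Sparsity constrains each word only with respect to earlier ones, and for a new word the
constraint says precisely that it is not covered. -/
theorem Sparse.add {w w' : ℕ → ℕ → ℕ} {k : ℕ} (h : ∀ i < k, w i = w' i)
    (hs : Sparse few col m q w k) (hc : ¬Covered few col m q w k (w' k)) :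
    Sparse few col m q w' (k + 1) := by
  intro j hj B hB
  rcases Nat.lt_succ_iff_lt_or_eq.1 hj with hj | rfl
  · rw [← matchCount_congr fun i hi => h i (hi.trans hj), ← h j hj]
    exact hs j hj B hB
  · rw [← matchCount_congr h]
    by_contra hge
    exact hc ⟨B, hB, not_lt.1 hge⟩

theorem prod_maskSet_eq_pow (q F : ℕ) :
    ∏ i ∈ Finset.range q, (if word 2 F i = 1 then 1 else m) = m ^ (q - (maskSet q F).card) := by
  rw [Finset.prod_ite, Finset.prod_const_one, one_mul, Finset.prod_const]
  congr 1
  have := Finset.card_filter_add_card_filter_not (s := Finset.range q) (fun i => word 2 F i = 1)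
  rw [Finset.card_range] at this
  unfold maskSet
  omega

end Families

/-! ### Correctness of the tests and counters of the selection. -/

namespace BFSPInstance

/-- The state is ready for the selection of segments: the array `a` holds the colours `col`, the
array `3` marks the vertices in `S`, and the variables `6` and `7` hold `m` and `few`. -/
structure Ready (I : BFSPInstance) (h W : ℕ) (col : ℕ → ℕ) (a : ℕ) (few : Prop) (m : ℕ)
    (S : Finset ℕ) (σ : State) : Prop where
  loaded : I.Loaded h W σ
  m_eq : σ.var 6 = m
  m_le : m ≤ I.n
  few_eq : σ.var 7 = ind few
  col_eq : ∀ v < I.n, σ.arr a v = col v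
  col_le : ∀ v < I.n, col v ≤ W
  mem_eq : ∀ v, σ.arr 3 v = ind (v ∈ S)
  a_ne : a ≠ 4 ∧ a ≠ 5

variable {I : BFSPInstance} {h W : ℕ} {col : ℕ → ℕ} {a : ℕ} {few : Prop} {m : ℕ} {S : Finset ℕ}
  {σ : State} {q : ℕ}

theorem Ready.frame {p : Program} {τ : State} (hσ : I.Ready h W col a few m S σ)
    (hf : Frame p σ τ) (hv : ∀ x < 8, ¬p.WritesVar x)
    (ha : ∀ x, x ≠ 4 → x ≠ 5 → ¬p.WritesArr x) : I.Ready h W col a few m S τ where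
  loaded := hσ.loaded.frame hf (fun x hx => hv x (by omega)) (ha 1 (by omega) (by omega))
  m_eq := (hf.1 6 (hv 6 (by omega))).trans hσ.m_eq
  m_le := hσ.m_le
  few_eq := (hf.1 7 (hv 7 (by omega))).trans hσ.few_eq
  col_eq := by rw [hf.2 a (ha a hσ.a_ne.1 hσ.a_ne.2)]; exact hσ.col_eq
  col_le := hσ.col_le
  mem_eq := by rw [hf.2 3 (ha 3 (by omega) (by omega))]; exact hσ.mem_eq
  a_ne := hσ.a_ne

theorem Ready.setVar {x v : ℕ} (hσ : I.Ready h W col a few m S σ) (hx : 8 ≤ x) :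
    I.Ready h W col a few m S (σ.setVar x v) :=
  hσ.frame (p := .assign x (.lit 0)) ⟨fun _ h => setVar_var_ne _ _ h, fun _ _ => rfl⟩
    (fun y hy => by simp [Program.WritesVar]; omega) (by simp [Program.WritesArr])

theorem Ready.setArr {b i v : ℕ} (hσ : I.Ready h W col a few m S σ) (hb : b = 4 ∨ b = 5) :
    I.Ready h W col a few m S (σ.setArr b i v) :=
  hσ.frame (p := .store b (.lit 0) (.lit 0)) ⟨fun _ _ => rfl, fun _ h => setArr_arr_ne _ _ _ h⟩
    (fun y hy => by simp [Program.WritesVar]) (fun x h4 h5 => by simp [Program.WritesArr]; omega)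

theorem Ready.ev_col {e : Expr} {k i : ℕ} (hσ : I.Ready h W col a few m S σ) (hi : i ≤ h)
    (he : e.Ev W σ k) : (Expr.get a (e.digit i)).Ev W σ (col (word I.n k i)) :=
  Expr.Ev.get (hσ.loaded.ev_digit hi he) (hσ.col_eq _ (word_lt I.n_pos _ _))
    (hσ.col_le _ (word_lt I.n_pos _ _))

theorem Ready.one_le (hσ : I.Ready h W col a few m S σ) : 1 ≤ W := by
  have := hσ.loaded.n_le
  omega

theorem Ready.ev_few (hσ : I.Ready h W col a few m S σ) : (Expr.var 7).Ev W σ (ind few) :=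
  Expr.Ev.var hσ.few_eq ((ind_le_one _).trans hσ.one_le)

theorem Ready.two_pow_le (hσ : I.Ready h W col a few m S σ) {i : ℕ} (hi : i ≤ h) :
    2 ^ i + 1 ≤ W := by
  refine hσ.loaded.le (i := i + 1) ?_ (by omega)
  have h1 : 2 ^ i ≤ (I.n + 2) ^ i := Nat.pow_le_pow_left (by omega) i
  have h2 : 1 ≤ (I.n + 2) ^ i := Nat.one_le_pow _ _ (by omega)
  rw [pow_succ]
  nlinarith

theorem Ready.ev_bit {F i : ℕ} (hσ : I.Ready h W col a few m S σ) (hi : i ≤ h)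
    (hF : σ.var 14 = F) (hFW : F ≤ W) : (bitExpr i).Ev W σ (ind (word 2 F i = 1)) := by
  have h1 := hσ.two_pow_le hi
  have h2 := hσ.loaded.n_le
  exact Expr.Ev.eq hσ.one_le (Expr.Ev.mod (Expr.Ev.div (Expr.Ev.var hF hFW)
    (Expr.Ev.lit (by omega))) (Expr.Ev.lit (by omega))) (Expr.Ev.lit (by omega))

theorem Ready.ev_match {e F i k : ℕ} (hσ : I.Ready h W col a few m S σ) (hq : q ≤ h)
    (hF : σ.var 14 = F) (hFW : F ≤ W) (he : σ.var 12 = e) (heW : e ≤ W) (hi : σ.var 17 = i)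
    (hiW : i ≤ W) (hk : σ.arr 5 i = k) (hkW : k ≤ W) :
    (matchExpr a q).Ev W σ (ind (Matches few col q (maskSet q F) (word I.n e) (word I.n k))) := by
  have ek : (Expr.get 5 (.var 17)).Ev W σ k := Expr.Ev.get (Expr.Ev.var hi hiW) hk hkW
  have ee : (Expr.var 12).Ev W σ e := Expr.Ev.var he heW
  have hW := hσ.one_le
  refine (Expr.Ev.all hW q (p := fun i => word 2 F i = 1 → ∃ j < q,
    col (word I.n k j) = col (word I.n e i) ∧ (few → i = j)) fun i hi => ?_).cast (ind_congr ?_)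
  · refine Expr.Ev.imp hW (hσ.ev_bit (by omega) hF hFW) (Expr.Ev.any hW q fun j hj => ?_)
    refine Expr.Ev.and (Expr.Ev.eq hW (hσ.ev_col (by omega) ek) (hσ.ev_col (by omega) ee))
      (Expr.Ev.imp hW hσ.ev_few ((Expr.Ev.lit ?_).cast ?_))
    · split_ifs <;> omega
    · split_ifs with hij
      · exact (ind_pos hij).symm
      · exact (ind_neg hij).symm
  · simp only [Matches, maskSet, Finset.mem_filter, Finset.mem_range, and_imp]

/-- The power is a product with the factor `1` at the positions in the set and `m` elsewhere. Since
`m ≤ n`, all partial products stay below `n ^ q`. -/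
theorem Ready.ev_threshold {F : ℕ} (hσ : I.Ready h W col a few m S σ) (hq : q ≤ h)
    (hF : σ.var 14 = F) (hFW : F ≤ W) :
    (thresholdExpr q).Ev W σ (m ^ (q - (maskSet q F).card)) := by
  have hnq := hσ.loaded.n_pow_le (i := q) (by omega)
  have hn := hσ.loaded.n_le
  have hm := hσ.m_le
  have hn0 := I.n_pos
  refine (Expr.Ev.prod (v := fun i => if word 2 F i = 1 then 1 else m) I.n_pos q (fun i hi => ?_)
    (fun i _ => ?_) (by omega)).cast (prod_maskSet_eq_pow q F)
  · have eb := hσ.ev_bit (i := i) (by omega) hF hFW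
    have em : (Expr.var 6).Ev W σ m := Expr.Ev.var hσ.m_eq (by omega)
    by_cases hw : word 2 F i = 1
    · have h0 : ind (¬word 2 F i = 1) = 0 := ind_neg (by simpa using hw)
      have h1 : ind (word 2 F i = 1) = 1 := ind_pos hw
      refine (Expr.Ev.add eb (Expr.Ev.mul (Expr.Ev.not hσ.one_le eb) em (by rw [h0]; omega))
        (by rw [h0, h1]; omega)).cast ?_
      rw [h0, h1, if_pos hw, zero_mul, add_zero]
    · have h0 : ind (¬word 2 F i = 1) = 1 := ind_pos hw
      have h1 : ind (word 2 F i = 1) = 0 := ind_neg hw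
      refine (Expr.Ev.add eb (Expr.Ev.mul (Expr.Ev.not hσ.one_le eb) em (by rw [h0]; omega))
        (by rw [h0, h1]; omega)).cast ?_
      rw [h0, h1, if_neg hw, zero_add, one_mul]
  · split_ifs <;> omega

theorem Ready.ev_segment {p e : ℕ} (hσ : I.Ready h W col a few m S σ) (hq : q ≤ h) (hq1 : 1 ≤ q)
    (hp : σ.var 10 = p) (hpW : p ≤ W) (he : σ.var 12 = e) (heW : e ≤ W) :
    (segmentExpr a q).Ev W σ
      (ind (IsSegment I.Adj few col q (word I.n p 1) (word I.n p 0) (word I.n e))) := by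
  have ep : (Expr.var 10).Ev W σ p := Expr.Ev.var hp hpW
  have ee : (Expr.var 12).Ev W σ e := Expr.Ev.var he heW
  have hW := hσ.one_le
  have hl := hσ.loaded
  have hlt : ∀ k i, word I.n k i < I.n := word_lt I.n_pos
  refine Expr.Ev.and (hl.ev_adj (hl.ev_digit (by omega) ep) (hl.ev_digit (by omega) ee)
      (hlt _ _) (hlt _ _)) (Expr.Ev.and (hl.ev_adj (hl.ev_digit (by omega) ee)
      (hl.ev_digit (by omega) ep) (hlt _ _) (hlt _ _)) (Expr.Ev.and
      (Expr.Ev.all hW _ fun i hi => hl.ev_adj (hl.ev_digit (by omega) ee)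
        (hl.ev_digit (by omega) ee) (hlt _ _) (hlt _ _))
      (Expr.Ev.imp hW (Expr.Ev.not hW hσ.ev_few) (Expr.Ev.all hW _ fun j hj =>
        Expr.Ev.all hW _ fun i hi => Expr.Ev.not hW (Expr.Ev.eq hW (hσ.ev_col (by omega) ee)
          (hσ.ev_col (by omega) ee))))))

/-- The words with the given codes. -/
def words (I : BFSPInstance) (κ : ℕ → ℕ) (i : ℕ) : ℕ → ℕ := word I.n (κ i)

theorem Ready.runs_countMatches {e F k : ℕ} (hσ : I.Ready h W col a few m S σ) (hq : q ≤ h)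
    (hF : σ.var 14 = F) (hFW : F ≤ W) (he : σ.var 12 = e) (heW : e ≤ W) (hk : σ.var 11 = k)
    (hkn : k ≤ I.n ^ q) (hκ : ∀ i < k, σ.arr 5 i ≤ W) :
    Runs W (countMatches a q) σ (((matchExpr a q).cost + 19) * I.n ^ q) fun τ =>
      τ.var 16 = matchCount few col q (I.words (σ.arr 5)) k (maskSet q F) (word I.n e) := by
  have hnq := hσ.loaded.n_pow_le (i := q) (by omega)
  have hpos : 1 ≤ I.n ^ q := Nat.one_le_pow _ _ I.n_pos
  refine (Runs.seq_assign (v := 0) (Expr.Ev.lit (by omega)) (Runs.for (N := k) (fun l τ =>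
    τ.var 16 = matchCount few col q (I.words (σ.arr 5)) l (maskSet q F) (word I.n e))
    (B := (matchExpr a q).cost + 3)
    (by simpa [setVar_var] using hk) (by omega) (by omega) (by simp [Program.WritesVar])
    (by simp [Program.WritesVar]) (by simp [setVar_var, matchCount]) ?_ (fun _ _ h => h))).le ?_
  · intro l hl τ hf hlτ hinv
    have hτ : I.Ready h W col a few m S τ := (hσ.setVar (x := 16) (by omega)).frame hf
      (by intro x hx; simp [Program.WritesVar]; omega) (by simp [Program.WritesArr])
    have h14 : τ.var 14 = F := by
      rw [hf.1 14 (by simp [Program.WritesVar]), setVar_var_ne _ _ (by omega), hF]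
    have h12 : τ.var 12 = e := by
      rw [hf.1 12 (by simp [Program.WritesVar]), setVar_var_ne _ _ (by omega), he]
    have h5 : τ.arr 5 = σ.arr 5 := hf.2 5 (by simp [Program.WritesArr])
    have em := hτ.ev_match hq h14 hFW h12 heW hlτ (by omega) (k := σ.arr 5 l) (by rw [h5])
      (hκ l hl)
    have hle := matchCount_le (few := few) (col := col) (q := q) (I.words (σ.arr 5)) (l + 1)
      (maskSet q F) (word I.n e)
    have hle' := matchCount_le (few := few) (col := col) (q := q) (I.words (σ.arr 5)) l
      (maskSet q F) (word I.n e)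
    rw [matchCount_succ] at hle
    refine (Runs.assign (Expr.Ev.add (Expr.Ev.var hinv (by omega)) em
      (hle.trans (by omega))) ?_).le ?_
    · rw [setVar_var_ne _ _ (by omega), setVar_var_self, matchCount_succ]
      rfl
    · change 1 + _ + 1 + 1 ≤ _
      omega
  · have : k * ((matchExpr a q).cost + 3 + 8) ≤ I.n ^ q * ((matchExpr a q).cost + 3 + 8) :=
      Nat.mul_le_mul_right _ hkn
    simp only [Expr.cost]
    nlinarith

/-- A constant for the number of steps of `countCovers`. -/
def countCoversCost (a q : ℕ) : ℕ :=
  8 + 2 ^ q * ((matchExpr a q).cost + (thresholdExpr q).cost + 100)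

/-- Variable `13` counts the sets of positions that cover the word, so it vanishes exactly if the
word has to be selected. -/
theorem Ready.runs_countCovers {e k : ℕ} (hσ : I.Ready h W col a few m S σ) (hq : q ≤ h)
    (h15 : σ.var 15 = 2 ^ q) (he : σ.var 12 = e) (heW : e ≤ W) (hk : σ.var 11 = k)
    (hkn : k ≤ I.n ^ q) (hκ : ∀ i < k, σ.arr 5 i ≤ W) :
    Runs W (countCovers a q) σ (countCoversCost a q * I.n ^ q) fun τ =>
      τ.var 13 ≤ W ∧ (τ.var 13 = 0 ↔
        ¬Covered few col m q (I.words (σ.arr 5)) k (word I.n e)) := by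
  have hnq := hσ.loaded.n_pow_le (i := q) (by omega)
  have hpos : 1 ≤ I.n ^ q := Nat.one_le_pow _ _ I.n_pos
  have h2q := hσ.two_pow_le hq
  refine (Runs.seq_assign (v := 0) (Expr.Ev.lit (by omega)) (Runs.for (N := 2 ^ q) (fun l τ =>
    τ.var 13 ≤ l ∧ (τ.var 13 = 0 ↔ ∀ F < l, matchCount few col q (I.words (σ.arr 5)) k
      (maskSet q F) (word I.n e) < m ^ (q - (maskSet q F).card)))
    (B := ((matchExpr a q).cost + (thresholdExpr q).cost + 50) * I.n ^ q)
    (by simpa [setVar_var] using h15) (by omega) (by omega) (by simp [Program.WritesVar])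
    (by simp [Program.WritesVar]) (by simp [setVar_var]) ?_ ?_)).le ?_
  · intro F hl τ hf hlτ ⟨hle, hinv⟩
    have hτ : I.Ready h W col a few m S τ := (hσ.setVar (x := 13) (by omega)).frame hf
      (by intro x hx; simp [Program.WritesVar]; omega) (by simp [Program.WritesArr])
    have h11 : τ.var 11 = k := by
      rw [hf.1 11 (by simp [Program.WritesVar]), setVar_var_ne _ _ (by omega), hk]
    have h12 : τ.var 12 = e := by
      rw [hf.1 12 (by simp [Program.WritesVar]), setVar_var_ne _ _ (by omega), he]
    have h5 : τ.arr 5 = σ.arr 5 := hf.2 5 (by simp [Program.WritesArr])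
    refine (Runs.seq (hτ.runs_countMatches hq hlτ (by omega) h12 heW h11 hkn
      (by rw [h5]; exact hκ)) (B' := (thresholdExpr q).cost + 20) fun ρ hfρ hρ => ?_).le ?_
    · have hρ' : I.Ready h W col a few m S ρ := hτ.frame hfρ
        (by intro x hx; simp; omega) (by simp)
      have h14 : ρ.var 14 = F := by rw [hfρ.1 14 (by simp), hlτ]
      have h13 : ρ.var 13 = τ.var 13 := hfρ.1 13 (by simp)
      rw [h5] at hρ
      have hmc := matchCount_le (few := few) (col := col) (q := q) (I.words (σ.arr 5)) k
        (maskSet q F) (word I.n e)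
      have ecmp := Expr.Ev.not hτ.one_le (Expr.Ev.lt hτ.one_le (Expr.Ev.var hρ (by omega))
        (hρ'.ev_threshold hq h14 (by omega)))
      have hind := ind_le_one (¬matchCount few col q (I.words (σ.arr 5)) k (maskSet q F)
        (word I.n e) < m ^ (q - (maskSet q F).card))
      refine (Runs.assign (Expr.Ev.add (Expr.Ev.var h13 (by omega)) ecmp (by omega)) ?_).le ?_
      · rw [setVar_var_ne _ _ (by omega), setVar_var_self]
        refine ⟨by omega, ?_⟩
        rw [Nat.add_eq_zero_iff, hinv, ind_eq_zero, not_not]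
        simp only [Nat.lt_succ_iff_lt_or_eq]
        aesop
      · change 1 + (1 + (thresholdExpr q).cost + 1 + 1 + 1) + 1 + 1 ≤ _
        omega
    · nlinarith
  · rintro τ - ⟨hle, hinv⟩
    refine ⟨by omega, ?_⟩
    rw [hinv, covered_iff_maskSet]
    push Not
    rfl
  · have := for_cost_le_const (N := 2 ^ q) (g := q) I.n_pos
      (le_refl (((matchExpr a q).cost + (thresholdExpr q).cost + 50) * I.n ^ q))
    refine (Nat.add_le_add_left this _).trans ?_
    unfold countCoversCost
    simp only [Expr.cost]
    have h1 : 2 ^ q * ((matchExpr a q).cost + (thresholdExpr q).cost + 50 + 8) ≤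
        2 ^ q * ((matchExpr a q).cost + (thresholdExpr q).cost + 100) :=
      Nat.mul_le_mul_left _ (by omega)
    nlinarith

end BFSPInstance

/-! ### Selection for one pair, for all pairs and for all segment lengths. -/

namespace BFSPInstance

variable {I : BFSPInstance} {h W : ℕ} {col : ℕ → ℕ} {a : ℕ} {few : Prop} {m : ℕ} {S : Finset ℕ}
  {σ : State} {q : ℕ}

/-- The invariant of the selection for the pair of `u` and `v`: the words with the codes below `k`
have been considered, the `l` words with the codes `κ 0, …, κ (l - 1)` have been selected, and `K`
is the set of the marked vertices, which was `K₀` before. -/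
structure PairInv (I : BFSPInstance) (few : Prop) (col : ℕ → ℕ) (m q u v : ℕ) (K₀ : Finset ℕ)
    (k : ℕ) (κ : ℕ → ℕ) (l : ℕ) (K : Finset ℕ) : Prop where
  le : l ≤ k
  code_lt : ∀ i < l, κ i < I.n ^ q
  sparse : Sparse few col m q (I.words κ) l
  segment : ∀ i < l, IsSegment I.Adj few col q u v (I.words κ i)
  marked : ∀ i < l, ∀ j < q, I.words κ i j ∈ K
  covered : ∀ e < k, IsSegment I.Adj few col q u v (word I.n e) →
    (∃ i < l, κ i = e) ∨ Covered few col m q (I.words κ) l (word I.n e)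
  subset : K₀ ⊆ K
  card_le : K.card ≤ K₀.card + q * l
  lt : ∀ w ∈ K, w < I.n

theorem PairInv.skip {u v k l : ℕ} {K₀ K : Finset ℕ} {κ : ℕ → ℕ}
    (hi : I.PairInv few col m q u v K₀ k κ l K)
    (hk : IsSegment I.Adj few col q u v (word I.n k) →
      Covered few col m q (I.words κ) l (word I.n k)) :
    I.PairInv few col m q u v K₀ (k + 1) κ l K :=
  { hi with
    le := hi.le.trans (Nat.le_succ k)
    covered := fun e he hseg => by
      rcases Nat.lt_succ_iff_lt_or_eq.1 he with he | rfl
      · exact hi.covered e he hseg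
      · exact Or.inr (hk hseg) }

/-- Words that were dropped earlier remain covered, because match counts only grow with the family.
-/
theorem PairInv.add {u v k l : ℕ} {K₀ K : Finset ℕ} {κ : ℕ → ℕ}
    (hi : I.PairInv few col m q u v K₀ k κ l K) (hkn : k < I.n ^ q)
    (hseg : IsSegment I.Adj few col q u v (word I.n k))
    (hcov : ¬Covered few col m q (I.words κ) l (word I.n k)) :
    I.PairInv few col m q u v K₀ (k + 1) (Function.update κ l k) (l + 1)
      (K ∪ (Finset.range q).image (word I.n k)) := by
  have hold : ∀ i < l, Function.update κ l k i = κ i := fun i hil =>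
    Function.update_of_ne hil.ne _ _
  have hw : ∀ i < l, I.words κ i = I.words (Function.update κ l k) i := fun i hil => by
    rw [words, words, hold i hil]
  have hnew : I.words (Function.update κ l k) l = word I.n k := by
    rw [words, Function.update_self]
  refine ⟨Nat.succ_le_succ hi.le, fun i hil => ?_, hi.sparse.add hw (by rwa [hnew]),
    fun i hil => ?_, fun i hil j hj => ?_, fun e he hsege => ?_,
    hi.subset.trans Finset.subset_union_left, ?_, fun w hwK => ?_⟩
  · rcases Nat.lt_succ_iff_lt_or_eq.1 hil with hil | rfl
    · rw [hold i hil]; exact hi.code_lt i hil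
    · rwa [Function.update_self]
  · rcases Nat.lt_succ_iff_lt_or_eq.1 hil with hil | rfl
    · rw [← hw i hil]; exact hi.segment i hil
    · rwa [hnew]
  · rcases Nat.lt_succ_iff_lt_or_eq.1 hil with hil | rfl
    · rw [← hw i hil]; exact Finset.mem_union_left _ (hi.marked i hil j hj)
    · rw [hnew]
      exact Finset.mem_union_right _ (Finset.mem_image_of_mem _ (Finset.mem_range.2 hj))
  · rcases Nat.lt_succ_iff_lt_or_eq.1 he with he | rfl
    · rcases hi.covered e he hsege with ⟨i, hil, hie⟩ | hc
      · exact Or.inl ⟨i, by omega, by rw [hold i hil, hie]⟩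
      · exact Or.inr (hc.mono hw (Nat.le_succ l))
    · exact Or.inl ⟨l, Nat.lt_succ_self l, Function.update_self _ _ _⟩
  · have h1 := Finset.card_union_le K ((Finset.range q).image (word I.n k))
    have h2 : ((Finset.range q).image (word I.n k)).card ≤ q := by
      simpa using Finset.card_image_le (s := Finset.range q) (f := word I.n k)
    have h3 := hi.card_le
    rw [mul_add]
    omega
  · rcases Finset.mem_union.1 hwK with hwK | hwK
    · exact hi.lt w hwK
    · obtain ⟨i, -, rfl⟩ := Finset.mem_image.1 hwK
      exact word_lt I.n_pos _ _

/-- A constant for the number of steps of `selectWord`. -/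
def selectWordCost (a q : ℕ) : ℕ :=
  (segmentExpr a q).cost + countCoversCost a q + (Program.mark 4 (.var 12) q).straightCost + 100

theorem Ready.runs_selectWord {p e l : ℕ} {K₀ K : Finset ℕ}
    (hσ : I.Ready h W col a few m S σ) (hq : q ≤ h) (hq1 : 1 ≤ q)
    (h15 : σ.var 15 = 2 ^ q) (hp : σ.var 10 = p) (hpW : p ≤ W) (he : σ.var 12 = e)
    (hen : e < I.n ^ q) (hl : σ.var 11 = l) (hK : ∀ v, σ.arr 4 v = ind (v ∈ K))
    (hi : I.PairInv few col m q (word I.n p 1) (word I.n p 0) K₀ e (σ.arr 5) l K) :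
    Runs W (selectWord a q) σ (selectWordCost a q * I.n ^ q) fun τ =>
      ∃ K' : Finset ℕ, (∀ v, τ.arr 4 v = ind (v ∈ K')) ∧
        I.PairInv few col m q (word I.n p 1) (word I.n p 0) K₀ (e + 1) (τ.arr 5) (τ.var 11) K' := by
  have hnq := hσ.loaded.n_pow_le (i := q) (by omega)
  have hn := hσ.loaded.n_le
  have hpos : 1 ≤ I.n ^ q := Nat.one_le_pow _ _ I.n_pos
  have hle := hi.le
  refine (Runs.when (B := countCoversCost a q * I.n ^ q +
    ((Program.mark 4 (.var 12) q).straightCost + 50)) (by omega)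
    (hσ.ev_segment hq hq1 hp hpW he (by omega)) (fun hseg => ?_) (fun hseg => ?_)).le ?_
  · refine Runs.seq (hσ.runs_countCovers hq h15 he (by omega) hl (by omega)
      fun i hil => by have := hi.code_lt i hil; omega) fun τ hf ⟨hτW, hτ⟩ => ?_
    have hτR : I.Ready h W col a few m S τ := hσ.frame hf
      (by intro x hx; simp; omega) (by simp)
    have h11 : τ.var 11 = l := by rw [hf.1 11 (by simp), hl]
    have h12 : τ.var 12 = e := by rw [hf.1 12 (by simp), he]
    have h5 : τ.arr 5 = σ.arr 5 := hf.2 5 (by simp)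
    have h4 : τ.arr 4 = σ.arr 4 := hf.2 4 (by simp)
    refine (Runs.when (B := (Program.mark 4 (.var 12) q).straightCost + 7) (by omega)
      (Expr.Ev.eq hσ.one_le (Expr.Ev.var rfl hτW) (Expr.Ev.lit (Nat.zero_le W)))
      (fun hcov => ?_) (fun hcov => ?_)).le (by simp only [Expr.cost]; omega)
    · have hcov := hτ.1 hcov
      have h11' : (τ.setArr 5 l e).var 11 = l := h11
      refine (Runs.seq_store (Expr.Ev.var h11 (by omega)) (Expr.Ev.var h12 (by omega))
        (Runs.seq_assign (Expr.Ev.add (Expr.Ev.var h11' (by omega))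
          (Expr.Ev.lit (k := 1) (by omega)) (by omega)) ((Runs.mark (n := I.n) (k := e) (S := K)
          ?_ I.n_pos ?_ (by omega) q (by omega) (by omega) ?_).mono le_rfl ?_))).le ?_
      · exact ((hτR.setArr (b := 5) (by omega)).setVar (by omega)).loaded.n_eq
      · rw [setVar_var_ne _ _ (by omega), setArr_var, h12]
      · intro v
        rw [setVar_arr, setArr_arr_ne _ _ _ (by omega), h4, hK]
      · intro ρ hfρ hρ
        have h5' : ρ.arr 5 = Function.update (σ.arr 5) l e := by
          rw [hfρ.2 5 (by simp), setVar_arr, setArr_arr_self, h5]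
        have h11'' : ρ.var 11 = l + 1 := by
          rw [hfρ.1 11 (by simp), setVar_var_self]
        refine ⟨_, hρ, ?_⟩
        rw [h5', h11'']
        exact hi.add hen hseg hcov
      · change 1 + 1 + 1 + (1 + 1 + 1 + 1 + _) ≤ _
        omega
    · refine ⟨K, by rw [h4]; exact hK, ?_⟩
      rw [h5, h11]
      refine hi.skip fun _ => ?_
      by_contra hno
      exact hcov (hτ.2 hno)
  · exact ⟨K, hK, by rw [hl]; exact hi.skip fun hseg' => absurd hseg' hseg⟩
  · unfold selectWordCost
    nlinarith

theorem PairInv.represents {u v l : ℕ} {K₀ K : Finset ℕ} {κ : ℕ → ℕ}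
    (hi : I.PairInv few col m q u v K₀ (I.n ^ q) κ l K) :
    RepresentsSegments I.Adj few col I.n m q u v K :=
  ⟨I.words κ, l, hi.sparse, fun i hil => ⟨hi.segment i hil, hi.marked i hil⟩, fun e he hseg =>
    (hi.covered e he hseg).imp_left fun ⟨i, hil, hie⟩ => ⟨i, hil, fun j _ => by rw [words, hie]⟩⟩

theorem _root_.RepresentsSegments.mono {A : ℕ → ℕ → Prop} {n u v : ℕ} {K K' : Set ℕ}
    (hK : RepresentsSegments A few col n m q u v K) (hKK' : K ⊆ K') :
    RepresentsSegments A few col n m q u v K' := by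
  obtain ⟨w, k, h1, h2, h3⟩ := hK
  exact ⟨w, k, h1, fun i hi => ⟨(h2 i hi).1, fun j hj => hKK' ((h2 i hi).2 j hj)⟩, h3⟩

/-- Each of the `n ^ q` candidates is compared with at most `n ^ q` selected words, whence the
exponent `q + q`. Only the counter of selected words is reset for a new pair; the marks of vertices
accumulate. -/
theorem Ready.runs_selectPair {p : ℕ} {K₀ : Finset ℕ}
    (hσ : I.Ready h W col a few m S σ) (hq : q ≤ h) (hq1 : 1 ≤ q) (h9 : σ.var 9 = I.n ^ q)
    (h15 : σ.var 15 = 2 ^ q) (hp : σ.var 10 = p) (hpW : p ≤ W)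
    (hK : ∀ v, σ.arr 4 v = ind (v ∈ K₀)) (hKn : ∀ v ∈ K₀, v < I.n) :
    Runs W (selectPair a q) σ ((selectWordCost a q + 200) * I.n ^ (q + q)) fun τ =>
      ∃ K : Finset ℕ, (∀ v, τ.arr 4 v = ind (v ∈ K)) ∧ K₀ ⊆ K ∧ (∀ v ∈ K, v < I.n) ∧
        K.card ≤ K₀.card + ind (word I.n p 1 ∈ S ∧ word I.n p 0 ∈ S) * (q * m ^ q) ∧
        (word I.n p 1 ∈ S → word I.n p 0 ∈ S →
          RepresentsSegments I.Adj few col I.n m q (word I.n p 1) (word I.n p 0) K) := by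
  have hnq := hσ.loaded.n_pow_le (i := q) (by omega)
  have hn := hσ.loaded.n_le
  have hpos : 1 ≤ I.n ^ (q + q) := Nat.one_le_pow _ _ I.n_pos
  have ep : (Expr.var 10).Ev W σ p := Expr.Ev.var hp hpW
  have emem : ∀ i ≤ h, (Expr.get 3 (.digit (.var 10) i)).Ev W σ (ind (word I.n p i ∈ S)) :=
    fun i hih => Expr.Ev.get (hσ.loaded.ev_digit hih ep) (hσ.mem_eq _)
      ((ind_le_one _).trans hσ.one_le)
  refine (Runs.when (B := 2 + (6 + I.n ^ q * (selectWordCost a q * I.n ^ q + 8))) (by omega)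
    (Expr.Ev.and (emem 1 (by omega)) (emem 0 (by omega))) (fun hS => ?_) (fun hS => ?_)).le ?_
  · refine Runs.seq_assign (v := 0) (Expr.Ev.lit (by omega)) (Runs.for (N := I.n ^ q) (fun k τ =>
      ∃ K : Finset ℕ, (∀ v, τ.arr 4 v = ind (v ∈ K)) ∧
        I.PairInv few col m q (word I.n p 1) (word I.n p 0) K₀ k (τ.arr 5) (τ.var 11) K)
      (by simpa [setVar_var] using h9) (by omega) (by omega) (by simp) (by simp) ?_ ?_ ?_)
    · refine ⟨K₀, hK, ?_⟩
      rw [setVar_var_ne _ _ (by omega), setVar_var_self]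
      exact ⟨le_rfl, by simp, fun j hj => absurd hj (Nat.not_lt_zero j), by simp, by simp,
        by simp, subset_rfl, by simp, hKn⟩
    · rintro e he τ hf heτ ⟨K, hKτ, hi⟩
      have hτ : I.Ready h W col a few m S τ := (hσ.setVar (x := 11) (by omega)).frame hf
        (by intro x hx; simp; omega) (by intro x; simp; omega)
      have h15' : τ.var 15 = 2 ^ q := by
        rw [hf.1 15 (by simp), setVar_var_ne _ _ (by omega), h15]
      have h10' : τ.var 10 = p := by
        rw [hf.1 10 (by simp), setVar_var_ne _ _ (by omega), hp]
      refine (hτ.runs_selectWord hq hq1 h15' h10' hpW heτ he rfl hKτ hi).mono le_rfl ?_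
      rintro ρ - ⟨K', hK', hi'⟩
      refine ⟨K', hK', ?_⟩
      rwa [setVar_var_ne _ _ (by omega)]
    · rintro τ - ⟨K, hKτ, hi⟩
      refine ⟨K, hKτ, hi.subset, hi.lt, hi.card_le.trans ?_, fun _ _ => hi.represents⟩
      rw [ind_pos hS, one_mul]
      -- The number of marked vertices is controlled by sparsity, whereas the running time uses the
      -- cruder bound by the number of candidates.
      exact Nat.add_le_add_left (Nat.mul_le_mul_left q hi.sparse.le) _
  · refine ⟨K₀, hK, subset_rfl, hKn, Nat.le_add_right _ _, fun h1 h0 => absurd ⟨h1, h0⟩ hS⟩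
  · have h1 := for_cost_le (f := q) (g := q) I.n_pos le_rfl (le_refl (selectWordCost a q * I.n ^ q))
    have h2 : (Expr.get 3 (.digit (.var 10) 1) * Expr.get 3 (.digit (.var 10) 0)).cost ≤ 100 := by
      decide
    nlinarith

/-- A constant for the number of steps of `select`. -/
def selectCost (a q : ℕ) : ℕ := selectWordCost a q + 250 + (Expr.pow (.var 0) q).cost

theorem Ready.runs_select {K₀ : Finset ℕ}
    (hσ : I.Ready h W col a few m S σ) (hq : q ≤ h) (hq1 : 1 ≤ q)
    (hK : ∀ v, σ.arr 4 v = ind (v ∈ K₀)) (hKn : ∀ v ∈ K₀, v < I.n) :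
    Runs W (select a q) σ (selectCost a q * I.n ^ (2 + (q + q))) fun τ =>
      ∃ K : Finset ℕ, (∀ v, τ.arr 4 v = ind (v ∈ K)) ∧ K₀ ⊆ K ∧ (∀ v ∈ K, v < I.n) ∧
        K.card ≤ K₀.card + S.card ^ 2 * (q * m ^ q) ∧
        (∀ u ∈ S, ∀ v ∈ S, u < I.n → v < I.n →
          RepresentsSegments I.Adj few col I.n m q u v K) := by
  have hnq := hσ.loaded.n_pow_le (i := q) (by omega)
  have hn2 := hσ.loaded.n_pow_le (i := 2) (by omega)
  have hn := hσ.loaded.n_le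
  have h2q := hσ.two_pow_le hq
  have hpos : 1 ≤ I.n ^ (2 + (q + q)) := Nat.one_le_pow _ _ I.n_pos
  have hσ₁ := hσ.setVar (x := 8) (v := I.n ^ 2) (by omega)
  have hσ₂ := hσ₁.setVar (x := 9) (v := I.n ^ q) (by omega)
  have hσ₃ := hσ₂.setVar (x := 15) (v := 2 ^ q) (by omega)
  classical
  refine (Runs.seq_assign (Expr.Ev.pow I.n_pos hσ.loaded.ev_n 2 (by omega))
    (Runs.seq_assign (Expr.Ev.pow I.n_pos hσ₁.loaded.ev_n q (by omega))
    (Runs.seq_assign (Expr.Ev.lit (by omega)) (Runs.for (N := I.n ^ 2)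
    (B := (selectWordCost a q + 200) * I.n ^ (q + q)) (fun k τ =>
      ∃ K : Finset ℕ, (∀ v, τ.arr 4 v = ind (v ∈ K)) ∧ K₀ ⊆ K ∧ (∀ v ∈ K, v < I.n) ∧
        K.card ≤ K₀.card + ((Finset.range k).filter fun p =>
          word I.n p 1 ∈ S ∧ word I.n p 0 ∈ S).card * (q * m ^ q) ∧
        ∀ p < k, word I.n p 1 ∈ S → word I.n p 0 ∈ S →
          RepresentsSegments I.Adj few col I.n m q (word I.n p 1) (word I.n p 0) K)
      (by simp [setVar_var]) (by omega) (by omega) (by simp) (by simp) ?_ ?_ ?_)))).le ?_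
  · exact ⟨K₀, hK, subset_rfl, hKn, by simp, fun p hp => absurd hp (Nat.not_lt_zero p)⟩
  · rintro p hp τ hf hpτ ⟨K, hKτ, hsub, hlt, hcard, hrep⟩
    have hτ : I.Ready h W col a few m S τ := hσ₃.frame hf
      (by intro x hx; simp; omega) (by intro x; simp; omega)
    have h15' : τ.var 15 = 2 ^ q := by rw [hf.1 15 (by simp), setVar_var_self]
    have h9' : τ.var 9 = I.n ^ q := by
      rw [hf.1 9 (by simp), setVar_var_ne _ _ (by omega), setVar_var_self]
    refine (hτ.runs_selectPair hq hq1 h9' h15' hpτ (by omega) hKτ hlt).mono le_rfl ?_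
    rintro ρ - ⟨K', hK', hsub', hlt', hcard', hrep'⟩
    refine ⟨K', hK', hsub.trans hsub', hlt', ?_, fun p' hp' h1 h0 => ?_⟩
    · rw [Finset.range_add_one, Finset.filter_insert]
      split_ifs with hS
      · rw [ind_pos hS] at hcard'
        rw [Finset.card_insert_of_notMem (by simp), add_mul]
        omega
      · rw [ind_neg hS] at hcard'
        omega
    · rcases Nat.lt_succ_iff_lt_or_eq.1 hp' with hp' | rfl
      · exact (hrep p' hp' h1 h0).mono (by exact_mod_cast hsub')
      · exact hrep' h1 h0
  · rintro τ - ⟨K, hKτ, hsub, hlt, hcard, hrep⟩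
    refine ⟨K, hKτ, hsub, hlt, hcard.trans ?_, fun u hu v hv hun hvn => ?_⟩
    -- A code below `n²` is determined by its two digits, so the codes of pairs in `S` number at
    -- most `|S|²`.
    · have : ((Finset.range (I.n ^ 2)).filter fun p =>
          word I.n p 1 ∈ S ∧ word I.n p 0 ∈ S).card ≤ (S ×ˢ S).card := by
        refine Finset.card_le_card_of_injOn (fun p => (word I.n p 1, word I.n p 0)) ?_ ?_
        · intro p hp
          exact Finset.mem_coe.2 (Finset.mem_product.2 (Finset.mem_filter.1 hp).2)
        · intro p hp p' hp' heq
          have hp := Finset.mem_range.1 (Finset.mem_filter.1 hp).1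
          have hp' := Finset.mem_range.1 (Finset.mem_filter.1 hp').1
          simp only [Prod.mk.injEq, word, pow_one, pow_zero, Nat.div_one] at heq
          rw [Nat.mod_eq_of_lt (Nat.div_lt_of_lt_mul (by rwa [← pow_two])),
            Nat.mod_eq_of_lt (Nat.div_lt_of_lt_mul (by rwa [← pow_two]))] at heq
          rw [← Nat.div_add_mod p I.n, ← Nat.div_add_mod p' I.n, heq.1, heq.2]
      rw [Finset.card_product, ← pow_two] at this
      gcongr
    · obtain ⟨p, hp, hpw⟩ := exists_word_eq (n := I.n) (q := 2) (w := fun i => if i = 0 then v else u)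
        (fun i _ => by split_ifs <;> assumption)
      have h1 : word I.n p 1 = u := hpw 1 (by omega)
      have h0 : word I.n p 0 = v := hpw 0 (by omega)
      have := hrep p hp
      rw [h1, h0] at this
      exact this hu hv
  · have h1 := for_cost_le (f := 2) (g := q + q) I.n_pos le_rfl
      (le_refl ((selectWordCost a q + 200) * I.n ^ (q + q)))
    have h2 : (Expr.pow (.var 0) 2).cost ≤ 10 := by decide
    have h3 : (Expr.lit (2 ^ q)).cost = 1 := rfl
    unfold selectCost
    nlinarith

/-- Select representative segments with at most `q` inner vertices. -/
def selectUpTo (a : ℕ) : ℕ → Program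
  | 0 => .skip
  | q + 1 => .seq (selectUpTo a q) (select a (q + 1))

theorem writesVar_selectUpTo (a q x : ℕ) :
    (selectUpTo a q).WritesVar x → 8 ≤ x := by
  induction q with
  | zero => exact fun h => h.elim
  | succ q ih =>
    simp only [selectUpTo, Program.WritesVar, writesVar_select]
    rintro (h | h)
    · exact ih h
    · omega

theorem writesArr_selectUpTo (a q x : ℕ) :
    (selectUpTo a q).WritesArr x → x = 4 ∨ x = 5 := by
  induction q with
  | zero => exact fun h => h.elim
  | succ q ih =>
    simp only [selectUpTo, Program.WritesArr, writesArr_select]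
    rintro (h | h)
    · exact ih h
    · omega

/-- A constant for the number of steps of `selectUpTo`. -/
def selectUpToCost (a q : ℕ) : ℕ := 1 + ∑ i ∈ Finset.range q, selectCost a (i + 1)

theorem Ready.runs_selectUpTo {K₀ : Finset ℕ} (hσ : I.Ready h W col a few m S σ) (hq : q ≤ h)
    (hK : ∀ v, σ.arr 4 v = ind (v ∈ K₀)) (hKn : ∀ v ∈ K₀, v < I.n) :
    Runs W (selectUpTo a q) σ (selectUpToCost a q * I.n ^ (2 + (q + q))) fun τ =>
      ∃ K : Finset ℕ, (∀ v, τ.arr 4 v = ind (v ∈ K)) ∧ K₀ ⊆ K ∧ (∀ v ∈ K, v < I.n) ∧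
        K.card ≤ K₀.card + S.card ^ 2 * ∑ i ∈ Finset.range q, (i + 1) * m ^ (i + 1) ∧
        (∀ i, 1 ≤ i → i ≤ q → ∀ u ∈ S, ∀ v ∈ S, u < I.n → v < I.n →
          RepresentsSegments I.Adj few col I.n m i u v K) := by
  induction q with
  | zero =>
    refine (Runs.skip ?_).le ?_
    · exact ⟨K₀, hK, subset_rfl, hKn, by simp, fun i h1 h2 => by omega⟩
    · simpa [selectUpToCost] using Nat.one_le_pow _ _ I.n_pos
  | succ q ih =>
    refine (Runs.seq (ih (by omega)) (B' := selectCost a (q + 1) * I.n ^ (2 + (q + 1 + (q + 1))))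
      ?_).le ?_
    · rintro τ hf ⟨K, hKτ, hsub, hlt, hcard, hrep⟩
      have hτ : I.Ready h W col a few m S τ := hσ.frame hf
        (fun x hx hw => by have := writesVar_selectUpTo a q x hw; omega)
        (fun x h4 h5 hw => by have := writesArr_selectUpTo a q x hw; omega)
      refine (hτ.runs_select hq (by omega) hKτ hlt).mono le_rfl ?_
      rintro ρ - ⟨K', hK', hsub', hlt', hcard', hrep'⟩
      refine ⟨K', hK', hsub.trans hsub', hlt', ?_, fun i hi1 hi2 u hu v hv hun hvn => ?_⟩
      · rw [Finset.sum_range_succ, mul_add]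
        omega
      · rcases Nat.lt_or_ge i (q + 1) with hi | hi
        · exact (hrep i hi1 (by omega) u hu v hv hun hvn).mono (by exact_mod_cast hsub')
        · obtain rfl : i = q + 1 := by omega
          exact hrep' u hu v hv hun hvn
    · have h1 : I.n ^ (2 + (q + q)) ≤ I.n ^ (2 + (q + 1 + (q + 1))) :=
        Nat.pow_le_pow_right I.n_pos (by omega)
      have h2 : selectUpToCost a (q + 1) = selectUpToCost a q + selectCost a (q + 1) := by
        rw [selectUpToCost, Finset.sum_range_succ, ← add_assoc]; rfl
      rw [h2, add_mul]
      gcongr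

end BFSPInstance

namespace WordRAM

/-! ### The output of the restricted instance -/

/-- List the vertices that are marked in the arrays `3` and `4` in the array `6` and their positions
in this list in the array `8`; the variable `8` counts them. -/
def gather : Program :=
  .seq (.assign 8 (.lit 0)) (.for 9 0 (.when ((Expr.get 3 (.var 9)).not * (Expr.get 4 (.var 9)).not).not
    (.seq (.store 6 (.var 8) (.var 9)) (.seq (.store 8 (.var 9) (.var 8))
      (.assign 8 (.var 8 + .lit 1))))))

/-- Restrict the adjacency matrix to the listed vertices. -/
def restrictAdj : Program :=
  .seq (.assign 9 (.var 8 * .var 8)) (.for 12 9 (.store 1 (.var 12)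
    (.get 1 (.get 6 (.var 12 / .var 8) * .var 0 + .get 6 (.var 12 % .var 8)))))

/-- Restrict the colouring to the listed vertices. -/
def restrictCol : Program := .for 12 8 (.store 0 (.var 12) (.get 0 (.get 6 (.var 12))))

/-- Find the first position at which the array `0` has the same entry as at the position in the
variable `13`. -/
def findFirst : Program :=
  .seq (.assign 14 (.var 13)) (.for 15 13 (.when
    (.op .eq (.var 14) (.var 13) * .op .eq (.get 0 (.var 15)) (.get 0 (.var 13)))
    (.assign 14 (.var 15))))

/-- Replace all colours by the first vertices of the same colour. -/
def recolor : Program :=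
  .seq (.assign 1 (.var 8 + .lit 1)) (.for 12 8 (.seq (.assign 13 (.var 8 - .lit 1 - .var 12))
    (.seq findFirst (.store 0 (.var 13) (.var 14)))))

/-- Set the numbers of the restricted instance. -/
def renumber : Program :=
  .seq (.assign 2 (.get 8 (.var 2))) (.seq (.assign 3 (.get 8 (.var 3))) (.assign 0 (.var 8)))

/-- Restrict the instance to the vertices that are marked in the arrays `3` and `4`. -/
def output : Program :=
  .seq gather (.seq restrictAdj (.seq restrictCol (.seq
    (.when (.op .lt (.var 8 + .lit 1) (.var 1)) recolor) renumber)))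

/-- The array `old` lists the members of `V` below `k` in increasing order, with positions given by
the array `pos`. -/
structure Lists (V : Finset ℕ) (k l : ℕ) (old pos : ℕ → ℕ) : Prop where
  le : l ≤ k
  mem : ∀ i < l, old i ∈ V
  lt : ∀ i < l, old i < k
  strictMono : ∀ j < l, ∀ i < j, old i < old j
  pos_lt : ∀ v < k, v ∈ V → pos v < l
  old_pos : ∀ v < k, v ∈ V → old (pos v) = v

theorem Lists.add {V : Finset ℕ} {k l : ℕ} {old pos : ℕ → ℕ} (hl : Lists V k l old pos)
    (hk : k ∈ V) :
    Lists V (k + 1) (l + 1) (Function.update old l k) (Function.update pos k l) := by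
  have hold : ∀ i < l, Function.update old l k i = old i := fun i hi =>
    Function.update_of_ne hi.ne _ _
  have hpos : ∀ v < k, Function.update pos k l v = pos v := fun v hv =>
    Function.update_of_ne hv.ne _ _
  refine ⟨Nat.succ_le_succ hl.le, fun i hi => ?_, fun i hi => ?_, fun j hj i hij => ?_,
    fun v hv hvV => ?_, fun v hv hvV => ?_⟩
  · rcases Nat.lt_succ_iff_lt_or_eq.1 hi with hi | rfl
    · rw [hold i hi]; exact hl.mem i hi
    · rwa [Function.update_self]
  · rcases Nat.lt_succ_iff_lt_or_eq.1 hi with hi | rfl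
    · rw [hold i hi]; exact (hl.lt i hi).trans (Nat.lt_succ_self k)
    · rw [Function.update_self]; exact Nat.lt_succ_self k
  · rcases Nat.lt_succ_iff_lt_or_eq.1 hj with hj | rfl
    · rw [hold i (hij.trans hj), hold j hj]; exact hl.strictMono j hj i hij
    · rw [hold i hij, Function.update_self]; exact hl.lt i hij
  · rcases Nat.lt_succ_iff_lt_or_eq.1 hv with hv | rfl
    · rw [hpos v hv]; exact (hl.pos_lt v hv hvV).trans (Nat.lt_succ_self l)
    · rw [Function.update_self]; exact Nat.lt_succ_self l
  · rcases Nat.lt_succ_iff_lt_or_eq.1 hv with hv | rfl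
    · rw [hpos v hv, hold _ (hl.pos_lt v hv hvV)]; exact hl.old_pos v hv hvV
    · rw [Function.update_self, Function.update_self]

theorem Lists.skip {V : Finset ℕ} {k l : ℕ} {old pos : ℕ → ℕ} (hl : Lists V k l old pos)
    (hk : k ∉ V) : Lists V (k + 1) l old pos := by
  have hlt : ∀ v < k + 1, v ∈ V → v < k := fun v hv hvV => by
    rcases Nat.lt_succ_iff_lt_or_eq.1 hv with hv | rfl
    · exact hv
    · exact absurd hvV hk
  exact ⟨hl.le.trans (Nat.le_succ k), hl.mem, fun i hi => (hl.lt i hi).trans (Nat.lt_succ_self k),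
    hl.strictMono, fun v hv hvV => hl.pos_lt v (hlt v hv hvV) hvV,
    fun v hv hvV => hl.old_pos v (hlt v hv hvV) hvV⟩

/-- This makes it safe to copy in place in increasing order: entries are read from positions that
are not yet overwritten. -/
theorem Lists.le_old {V : Finset ℕ} {k l : ℕ} {old pos : ℕ → ℕ} (hl : Lists V k l old pos) :
    ∀ i < l, i ≤ old i := by
  intro i
  induction i with
  | zero => exact fun _ => Nat.zero_le _
  | succ i ih =>
    intro hi
    have := ih (by omega)
    have := hl.strictMono (i + 1) hi i (Nat.lt_succ_self i)
    omega

theorem Lists.inj {V : Finset ℕ} {k l : ℕ} {old pos : ℕ → ℕ} (hl : Lists V k l old pos) :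
    ∀ i < l, ∀ j < l, old i = old j → i = j := by
  intro i hi j hj hij
  by_contra hne
  rcases lt_or_gt_of_ne hne with hlt | hlt
  · exact (hl.strictMono j hj i hlt).ne hij
  · exact (hl.strictMono i hi j hlt).ne hij.symm

theorem Lists.le_card {V : Finset ℕ} {k l : ℕ} {old pos : ℕ → ℕ} (hl : Lists V k l old pos) :
    l ≤ V.card := by
  have : ((Finset.range l).image old).card ≤ V.card := by
    refine Finset.card_le_card fun v hv => ?_
    obtain ⟨i, hi, rfl⟩ := Finset.mem_image.1 hv
    exact hl.mem i (Finset.mem_range.1 hi)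
  rwa [Finset.card_image_of_injOn, Finset.card_range] at this
  intro i hi j hj hij
  exact hl.inj i (by simpa using hi) j (by simpa using hj) hij

variable {W n : ℕ} {σ : State}

theorem Runs.gather {S K : Finset ℕ} (h0 : σ.var 0 = n) (hnW : n + 2 ≤ W)
    (h3 : ∀ v, σ.arr 3 v = ind (v ∈ S)) (h4 : ∀ v, σ.arr 4 v = ind (v ∈ K)) :
    Runs W gather σ (8 + n * 60) fun τ => Lists (S ∪ K) n (τ.var 8) (τ.arr 6) (τ.arr 8) := by
  refine (Runs.seq_assign (v := 0) (Expr.Ev.lit (by omega)) (Runs.for (N := n) (B := 50)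
    (fun k τ => Lists (S ∪ K) k (τ.var 8) (τ.arr 6) (τ.arr 8)) (by simpa [setVar_var] using h0)
    (by omega) (by omega) (by simp [Program.WritesVar]) (by simp [Program.WritesVar]) ?_ ?_
    fun _ _ h => h)).le (by simp only [Expr.cost]; omega)
  · rw [setVar_var_ne _ _ (by omega), setVar_var_self]
    constructor <;> simp
  · intro k hk τ hf hkτ hl
    have e9 : (Expr.var 9).Ev W τ k := Expr.Ev.var hkτ (by omega)
    have h3' : τ.arr 3 = σ.arr 3 := by rw [hf.2 3 (by simp [Program.WritesArr]), setVar_arr]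
    have h4' : τ.arr 4 = σ.arr 4 := by rw [hf.2 4 (by simp [Program.WritesArr]), setVar_arr]
    have e3 : (Expr.get 3 (.var 9)).Ev W τ (ind (k ∈ S)) :=
      Expr.Ev.get e9 (by rw [h3', h3]) ((ind_le_one _).trans (by omega))
    have e4 : (Expr.get 4 (.var 9)).Ev W τ (ind (k ∈ K)) :=
      Expr.Ev.get e9 (by rw [h4', h4]) ((ind_le_one _).trans (by omega))
    have hlk := hl.le
    have e8 : (Expr.var 8).Ev W τ (τ.var 8) := Expr.Ev.var rfl (by omega)
    refine (Runs.when (B := 10) (by omega) (Expr.Ev.not (by omega) (Expr.Ev.and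
      (Expr.Ev.not (by omega) e3) (Expr.Ev.not (by omega) e4))) (fun hmem => ?_)
      (fun hmem => ?_)).le (by decide)
    · have hkV : k ∈ S ∪ K := by
        rw [Finset.mem_union]; tauto
      refine Runs.seq_store e8 e9 (Runs.seq_store (j := k) (v := τ.var 8)
        (Expr.Ev.var hkτ (by omega)) (Expr.Ev.var rfl (by omega)) (Runs.assign
          (v := τ.var 8 + 1) (Expr.Ev.add (Expr.Ev.var rfl (by omega)) (Expr.Ev.lit (by omega))
            (by omega)) ?_))
      rw [setVar_var_ne _ _ (by omega), setVar_var_self, setVar_arr, setVar_arr, setArr_arr_self _ 8,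
        setArr_arr_ne (a := 8) (b := 6) _ _ _ (by omega), setArr_arr_self _ 6,
        setArr_arr_ne (a := 6) (b := 8) _ _ _ (by omega)]
      exact hl.add hkV
    · rw [setVar_var_ne _ _ (by omega)]
      refine hl.skip ?_
      rw [Finset.mem_union]
      tauto

/-- The matrix is compressed in place. The cell `k` is filled from the cell `old (k / l) * n + old
(k % l)`, which is at least `k` because `l ≤ n` and `i ≤ old i`, so it still has its original
content. -/
theorem Runs.restrictAdj {V : Finset ℕ} {l : ℕ} {old pos : ℕ → ℕ} (h0 : σ.var 0 = n)
    (hnW : n ^ 2 + 2 ≤ W) (h8 : σ.var 8 = l) (h6 : σ.arr 6 = old) (hl : Lists V n l old pos)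
    (h1 : ∀ u < n, ∀ v < n, σ.arr 1 (u * n + v) ≤ 1) :
    Runs W restrictAdj σ (10 + n ^ 2 * 30) fun τ => ∀ i < l, ∀ j < l,
      τ.arr 1 (i * l + j) = σ.arr 1 (old i * n + old j) := by
  have hln := hl.le
  have hll : l * l ≤ n ^ 2 := by nlinarith
  have hnn : n ≤ n ^ 2 := by
    rcases Nat.eq_zero_or_pos n with rfl | hn
    · simp
    · nlinarith
  refine (Runs.seq_assign (v := l * l) (Expr.Ev.mul (Expr.Ev.var h8 (by omega))
    (Expr.Ev.var h8 (by omega)) (by omega)) (Runs.for (N := l * l) (B := 20)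
    (fun k τ => (∀ y < k, τ.arr 1 y = σ.arr 1 (old (y / l) * n + old (y % l))) ∧
      ∀ y, k ≤ y → τ.arr 1 y = σ.arr 1 y) (setVar_var_self _ _ _) (by omega) (by omega)
      (by simp [Program.WritesVar]) (by simp [Program.WritesVar])
      ⟨fun y hy => absurd hy (Nat.not_lt_zero y), fun y _ => rfl⟩ ?_ ?_)).le ?_
  · rintro k hk τ hf hkτ ⟨hdone, hrest⟩
    have hlpos : 0 < l := Nat.pos_of_ne_zero fun h => by simp [h] at hk
    have hi : k / l < l := Nat.div_lt_of_lt_mul hk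
    have hj : k % l < l := Nat.mod_lt _ hlpos
    have h8' : τ.var 8 = l := by
      rw [hf.1 8 (by simp [Program.WritesVar]), setVar_var_ne _ _ (by omega), h8]
    have h0' : τ.var 0 = n := by
      rw [hf.1 0 (by simp [Program.WritesVar]), setVar_var_ne _ _ (by omega), h0]
    have h6' : τ.arr 6 = old := by rw [hf.2 6 (by simp [Program.WritesArr]), setVar_arr, h6]
    have e12 : (Expr.var 12).Ev W τ k := Expr.Ev.var hkτ (by omega)
    have e8 : (Expr.var 8).Ev W τ l := Expr.Ev.var h8' (by omega)
    have hoi := hl.lt _ hi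
    have hoj := hl.lt _ hj
    have hlt : old (k / l) * n + old (k % l) < n ^ 2 := by nlinarith
    have hge : k ≤ old (k / l) * n + old (k % l) := by
      calc k = k / l * l + k % l := (Nat.div_add_mod' k l).symm
        _ ≤ old (k / l) * n + old (k % l) := by
          gcongr
          · exact hl.le_old _ hi
          · exact hl.le_old _ hj
    have e6 : ∀ {e : Expr} {i : ℕ}, i < l → e.Ev W τ i → (Expr.get 6 e).Ev W τ (old i) :=
      fun {e i} hi he => Expr.Ev.get he (by rw [h6']) (by have := hl.lt i hi; omega)
    have hread := h1 _ hoi _ hoj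
    refine (Runs.store (v := σ.arr 1 (old (k / l) * n + old (k % l))) e12 (Expr.Ev.get
      (Expr.Ev.add (Expr.Ev.mul (e6 hi (Expr.Ev.div e12 e8)) (Expr.Ev.var h0' (by omega))
        (by omega)) (e6 hj (Expr.Ev.mod e12 e8)) (by omega)) (hrest _ hge) (by omega)) ?_).le
          (by decide)
    simp only [setVar_arr, setArr_arr_self]
    refine ⟨fun y hy => ?_, fun y hy => ?_⟩
    · rcases Nat.lt_succ_iff_lt_or_eq.1 hy with hy | rfl
      · rw [Function.update_of_ne hy.ne]; exact hdone y hy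
      · rw [Function.update_self]
    · rw [Function.update_of_ne (by omega)]; exact hrest y (by omega)
  · rintro τ - ⟨hdone, -⟩ i hi j hj
    have hlt : i * l + j < l * l := by nlinarith
    rw [hdone _ hlt]
    have e1 : (i * l + j) / l = i := by
      rw [add_comm, Nat.add_mul_div_right _ _ (by omega), Nat.div_eq_of_lt hj, zero_add]
    have e2 : (i * l + j) % l = j := by
      rw [add_comm, Nat.add_mul_mod_self_right, Nat.mod_eq_of_lt hj]
    rw [e1, e2]
  · have : (Expr.var 8 * Expr.var 8).cost = 3 := rfl
    nlinarith

theorem Runs.restrictCol {V : Finset ℕ} {l : ℕ} {old pos : ℕ → ℕ} (hnW : n + 2 ≤ W)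
    (h8 : σ.var 8 = l) (h6 : σ.arr 6 = old) (hl : Lists V n l old pos)
    (h0 : ∀ v < n, σ.arr 0 v ≤ W) :
    Runs W restrictCol σ (6 + n * 30) fun τ => ∀ i < l, τ.arr 0 i = σ.arr 0 (old i) := by
  have hln := hl.le
  refine (Runs.for (N := l) (B := 20)
    (fun k τ => (∀ y < k, τ.arr 0 y = σ.arr 0 (old y)) ∧ ∀ y, k ≤ y → τ.arr 0 y = σ.arr 0 y)
      h8 (by omega) (by omega) (by simp [Program.WritesVar]) (by simp [Program.WritesVar])
      ⟨fun y hy => absurd hy (Nat.not_lt_zero y), fun y _ => rfl⟩ ?_ ?_).le ?_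
  · rintro k hk τ hf hkτ ⟨hdone, hrest⟩
    have h6' : τ.arr 6 = old := by rw [hf.2 6 (by simp [Program.WritesArr]), h6]
    have e12 : (Expr.var 12).Ev W τ k := Expr.Ev.var hkτ (by omega)
    have hlt := hl.lt k hk
    refine (Runs.store (v := σ.arr 0 (old k)) e12 (Expr.Ev.get (Expr.Ev.get e12
      (by rw [h6']) (by omega)) (hrest _ (hl.le_old k hk)) (h0 _ hlt)) ?_).le (by decide)
    simp only [setVar_arr, setArr_arr_self]
    refine ⟨fun y hy => ?_, fun y hy => ?_⟩
    · rcases Nat.lt_succ_iff_lt_or_eq.1 hy with hy | rfl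
      · rw [Function.update_of_ne hy.ne]; exact hdone y hy
      · rw [Function.update_self]
    · rw [Function.update_of_ne (by omega)]; exact hrest y (by omega)
  · rintro τ - ⟨hdone, -⟩
    exact hdone
  · nlinarith

/-- `z` is the first position at which `g` has the same value as at the position `y`. -/
def IsFirst (g : ℕ → ℕ) (y z : ℕ) : Prop := z ≤ y ∧ g z = g y ∧ ∀ w < z, g w ≠ g y

/-- The first position of a colour is a canonical name of its colour class. -/
theorem IsFirst.eq_iff {g : ℕ → ℕ} {y z y' z' : ℕ} (h : IsFirst g y z) (h' : IsFirst g y' z') :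
    z = z' ↔ g y = g y' := by
  constructor
  · rintro rfl
    rw [← h.2.1, h'.2.1]
  · intro heq
    by_contra hne
    rcases lt_or_gt_of_ne hne with hlt | hlt
    · exact h'.2.2 z hlt (h.2.1.trans heq)
    · exact h.2.2 z' hlt (h'.2.1.trans heq.symm)

/-- As the search runs below `y`, the value `y` in variable `14` also signals that no earlier
position of this colour has been found. -/
theorem Runs.findFirst {g : ℕ → ℕ} {y : ℕ} (h13 : σ.var 13 = y) (hyW : y + 2 ≤ W)
    (h0 : ∀ z ≤ y, σ.arr 0 z = g z) (hg : ∀ z ≤ y, g z ≤ W) :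
    Runs W findFirst σ (8 + y * 30) fun τ => IsFirst g y (τ.var 14) := by
  refine (Runs.seq_assign (v := y) (Expr.Ev.var h13 (by omega)) (Runs.for (N := y) (B := 20)
    (fun k τ => (τ.var 14 = y ∧ ∀ w < k, g w ≠ g y) ∨ (τ.var 14 < k ∧ IsFirst g y (τ.var 14)))
    (by simpa [setVar_var] using h13) (by omega) (by omega) (by simp [Program.WritesVar])
    (by simp [Program.WritesVar]) (Or.inl ⟨by simp [setVar_var], by simp⟩) ?_ ?_)).le ?_
  · intro k hk τ hf hkτ hinv
    have h13' : τ.var 13 = y := by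
      rw [hf.1 13 (by simp [Program.WritesVar]), setVar_var_ne _ _ (by omega), h13]
    have h0' : τ.arr 0 = σ.arr 0 := by rw [hf.2 0 (by simp [Program.WritesArr]), setVar_arr]
    have h14 : τ.var 14 ≤ y := by rcases hinv with h | h <;> omega
    have e13 : (Expr.var 13).Ev W τ y := Expr.Ev.var h13' (by omega)
    have e15 : (Expr.var 15).Ev W τ k := Expr.Ev.var hkτ (by omega)
    refine (Runs.when (B := 5) (by omega) (Expr.Ev.and (Expr.Ev.eq (by omega)
      (Expr.Ev.var rfl (by omega)) e13) (Expr.Ev.eq (by omega)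
        (Expr.Ev.get e15 (by rw [h0', h0 k hk.le]) (hg k hk.le))
        (Expr.Ev.get e13 (by rw [h0', h0 y le_rfl]) (hg y le_rfl)))) ?_ ?_).le (by decide)
    · rintro ⟨heq, hgk⟩
      refine (Runs.assign e15 ?_).le (by decide)
      rw [setVar_var_ne _ _ (by omega), setVar_var_self]
      right
      refine ⟨Nat.lt_succ_self k, hk.le, hgk, ?_⟩
      rcases hinv with h | h
      · exact h.2
      · omega
    · intro hno
      rw [setVar_var_ne _ _ (by omega)]
      rcases hinv with h | h
      · left
        refine ⟨h.1, fun w hw => ?_⟩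
        rcases Nat.lt_succ_iff_lt_or_eq.1 hw with hw | rfl
        · exact h.2 w hw
        · exact fun hgw => hno ⟨h.1, hgw⟩
      · exact Or.inr ⟨by omega, h.2⟩
  · rintro τ - (h | h)
    · rw [h.1]
      exact ⟨le_rfl, rfl, h.2⟩
    · exact h.2
  · have : (Expr.var 13).cost = 1 := rfl
    omega

/-- The positions are treated from the last to the first, so that the search for `y` still sees the
original colours at all positions up to `y`. -/
theorem Runs.recolor {g : ℕ → ℕ} {l : ℕ} (hlW : l + 2 ≤ W) (h8 : σ.var 8 = l)
    (h0 : ∀ z < l, σ.arr 0 z = g z) (hg : ∀ z < l, g z ≤ W) :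
    Runs W recolor σ (12 + l * (l * 30 + 50)) fun τ =>
      τ.var 1 = l + 1 ∧ ∀ y < l, IsFirst g y (τ.arr 0 y) := by
  refine (Runs.seq_assign (v := l + 1) (Expr.Ev.add (Expr.Ev.var h8 (by omega))
    (Expr.Ev.lit (by omega)) (by omega)) (Runs.for (N := l) (B := l * 30 + 40)
    (fun k τ => (∀ y, y + k < l → τ.arr 0 y = g y) ∧
      ∀ y < l, l ≤ y + k → IsFirst g y (τ.arr 0 y))
    (by simpa [setVar_var] using h8) (by omega) (by omega)
    (by simp [WordRAM.findFirst, Program.WritesVar]) (by simp [WordRAM.findFirst, Program.WritesVar])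
    ⟨fun y hy => h0 y hy, fun y h1 h2 => by omega⟩ ?_ ?_)).le ?_
  · rintro k hk τ hf hkτ ⟨hrest, hdone⟩
    have h8' : τ.var 8 = l := by
      rw [hf.1 8 (by simp [WordRAM.findFirst, Program.WritesVar]), setVar_var_ne _ _ (by omega), h8]
    refine (Runs.seq_assign (v := l - 1 - k) (Expr.Ev.sub (Expr.Ev.sub
      (Expr.Ev.var h8' (by omega)) (Expr.Ev.lit (by omega))) (Expr.Ev.var hkτ (by omega)))
      (Runs.seq (Runs.findFirst (g := g) (y := l - 1 - k) (setVar_var_self _ _ _) (by omega)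
        (fun z hz => hrest z (by omega)) (fun z hz => hg z (by omega)))
      (B' := 3) fun ρ hfρ hρ => ?_)).le ?_
    · have h13 : ρ.var 13 = l - 1 - k := by
        rw [hfρ.1 13 (by simp [WordRAM.findFirst, Program.WritesVar]), setVar_var_self]
      have harr : ρ.arr 0 = τ.arr 0 := by
        rw [hfρ.2 0 (by simp [WordRAM.findFirst, Program.WritesArr]), setVar_arr]
      have hle := hρ.1
      refine Runs.store (Expr.Ev.var h13 (by omega)) (Expr.Ev.var rfl (by omega)) ?_
      simp only [setVar_arr, setArr_arr_self, harr]
      refine ⟨fun y hy => ?_, fun y hy hyk => ?_⟩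
      · rw [Function.update_of_ne (by omega)]
        exact hrest y (by omega)
      · by_cases hyl : y = l - 1 - k
        · rw [hyl, Function.update_self]
          exact hρ
        · rw [Function.update_of_ne hyl]
          exact hdone y hy (by omega)
    · have : (Expr.var 8 - Expr.lit 1 - Expr.var 12).cost = 5 := rfl
      omega
  · rintro τ hf ⟨-, hdone⟩
    exact ⟨by rw [hf.1 1 (by simp [WordRAM.findFirst, Program.WritesVar]), setVar_var_self],
      fun y hy => hdone y hy (by omega)⟩
  · have : (Expr.var 8 + Expr.lit 1).cost = 3 := rfl
    nlinarith

end WordRAM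

/-! ### Correctness of the restricted instance. -/

namespace BFSPInstance

/-- The restriction of an instance to the vertices `old 0, …, old (l - 1)`, with new colours. -/
def restrict (I : BFSPInstance) (l c s t : ℕ) (old g : ℕ → ℕ) (hs : s < l) (ht : t < l)
    (hg : ∀ i < l, g i < c) : BFSPInstance where
  n := l
  c := c
  G :=
    { Adj := fun i j => I.Adj (old i) (old j)
      symm := ⟨fun _ _ ⟨hu, hv, h⟩ => ⟨hv, hu, h.symm⟩⟩
      loopless := ⟨fun _ ⟨_, _, h⟩ => I.G.loopless.irrefl _ h⟩ }
  χ := fun i => ⟨g i, hg i i.2⟩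
  s := ⟨s, hs⟩
  t := ⟨t, ht⟩

theorem restrict_adj {I : BFSPInstance} {l c s t : ℕ} {old g : ℕ → ℕ} {hs : s < l} {ht : t < l}
    {hg : ∀ i < l, g i < c} {i j : ℕ} (hi : i < l) (hj : j < l) :
    (I.restrict l c s t old g hs ht hg).Adj i j ↔ I.Adj (old i) (old j) :=
  ⟨fun ⟨_, _, h⟩ => h, fun h => ⟨hi, hj, h⟩⟩

theorem restrict_col {I : BFSPInstance} {l c s t : ℕ} {old g : ℕ → ℕ} {hs : s < l} {ht : t < l}
    {hg : ∀ i < l, g i < c} {i : ℕ} (hi : i < l) :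
    (I.restrict l c s t old g hs ht hg).col i = g i :=
  dif_pos hi

theorem Loaded.runs_output {I : BFSPInstance} {h W : ℕ} {σ : State} {S K : Finset ℕ}
    (hσ : I.Loaded h W σ) (hcol : ∀ v < I.n, σ.arr 0 v = I.col v)
    (h3 : ∀ v, σ.arr 3 v = ind (v ∈ S)) (h4 : ∀ v, σ.arr 4 v = ind (v ∈ K))
    (hlt : ∀ v ∈ S ∪ K, v < I.n) (hs : (I.s : ℕ) ∈ S) (ht : (I.t : ℕ) ∈ S) :
    Runs W output σ (1000 * I.n ^ 2) fun τ => ∃ (I' : BFSPInstance) (old : ℕ → ℕ),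
      I'.StoredIn τ ∧ IsRestriction I I' (S ∪ K : Finset ℕ) old ∧ I'.n ≤ (S ∪ K).card ∧
        I'.c ≤ I'.n + 1 := by
  have hn := hσ.n_le
  have hc := hσ.c_le
  have hn2 := hσ.n_pow_le (i := 2) (by omega)
  have hn0 := I.n_pos
  have hnn : I.n ≤ I.n ^ 2 := Nat.le_self_pow (by omega) _
  have hpos : 1 ≤ I.n ^ 2 := Nat.one_le_pow _ _ I.n_pos
  have hcolW : ∀ v < I.n, I.col v ≤ W := fun v hv => by have := col_lt hv; omega
  refine (Runs.seq (Runs.gather hσ.n_eq hn h3 h4) fun τ₁ hf₁ hl => ?_).le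
    (show 8 + I.n * 60 + 900 * I.n ^ 2 ≤ _ by omega)
  have hτ₁ : I.Loaded h W τ₁ := hσ.frame hf₁ (by intro x hx; simp [gather, Program.WritesVar]; omega)
    (by simp [gather, Program.WritesArr])
  have h01 : τ₁.arr 0 = σ.arr 0 := hf₁.2 0 (by simp [gather, Program.WritesArr])
  generalize hl₁ : τ₁.var 8 = l at hl
  generalize hold : τ₁.arr 6 = old at hl
  generalize hposn : τ₁.arr 8 = pos at hl
  have hln := hl.le
  refine (Runs.seq (Runs.restrictAdj hτ₁.n_eq hn2 hl₁ hold hl fun u hu v hv => by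
    rw [hτ₁.adj_eq u hu v hv]; exact ind_le_one _) fun τ₂ hf₂ hadj => ?_).le
    (show 10 + I.n ^ 2 * 30 + 800 * I.n ^ 2 ≤ _ by omega)
  have f82 : τ₂.var 8 = l := (hf₂.1 8 (by simp [restrictAdj, Program.WritesVar])).trans hl₁
  have f62 : τ₂.arr 6 = old := (hf₂.2 6 (by simp [restrictAdj, Program.WritesArr])).trans hold
  have f02 : τ₂.arr 0 = σ.arr 0 := (hf₂.2 0 (by simp [restrictAdj, Program.WritesArr])).trans h01
  refine (Runs.seq (Runs.restrictCol hn f82 f62 hl fun v hv => by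
    rw [f02, hcol v hv]; exact hcolW v hv) fun τ₃ hf₃ hg => ?_).le
    (show 6 + I.n * 30 + 700 * I.n ^ 2 ≤ _ by omega)
  have hg' : ∀ i < l, τ₃.arr 0 i = I.col (old i) := fun i hi => by
    rw [hg i hi, f02, hcol _ (hl.lt i hi)]
  have f83 : τ₃.var 8 = l := (hf₃.1 8 (by simp [restrictCol, Program.WritesVar])).trans f82
  have f13 : τ₃.var 1 = I.c := by
    rw [hf₃.1 1 (by simp [restrictCol, Program.WritesVar]),
      hf₂.1 1 (by simp [restrictAdj, Program.WritesVar]), hτ₁.c_eq]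
  -- Renaming takes place only if `c > l + 1`. The new number `l + 1` of colours exceeds the number
  -- `l` of vertices, so fairness still means that the colours are distinct.
  refine (Runs.seq (R := fun τ => ∃ c' : ℕ, τ.var 1 = c' ∧ (∀ i < l, τ.arr 0 i < c') ∧ c' ≤ l + 1 ∧
      ((c' = I.c ∧ ∀ i < l, τ.arr 0 i = I.col (old i)) ∨ (l < c' ∧ l < I.c ∧
        ∀ i < l, ∀ j < l, (τ.arr 0 i = τ.arr 0 j ↔ I.col (old i) = I.col (old j)))))
    (Runs.when (B := 12 + l * (l * 30 + 50)) (by omega) (Expr.Ev.lt (by omega) (Expr.Ev.add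
      (Expr.Ev.var f83 (by omega)) (Expr.Ev.lit (k := 1) (by omega)) (by omega))
      (Expr.Ev.var f13 (by omega))) (fun hlc => ?_) (fun hlc => ?_)) (B' := 100)
    fun τ₄ hf₄ hτ₄ => ?_).le ?_
  · refine (Runs.recolor (g := fun i => I.col (old i)) (by omega) f83 hg'
      fun i hi => hcolW _ (hl.lt i hi)).mono le_rfl fun τ _ ⟨h1, hfirst⟩ => ?_
    refine ⟨l + 1, h1, fun i hi => ?_, le_rfl, Or.inr ⟨Nat.lt_succ_self l, by omega,
      fun i hi j hj => (hfirst i hi).eq_iff (hfirst j hj)⟩⟩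
    have := (hfirst i hi).1
    omega
  · exact ⟨I.c, f13, fun i hi => by rw [hg' i hi]; exact col_lt (hl.lt i hi), by omega,
      Or.inl ⟨rfl, hg'⟩⟩
  · obtain ⟨c', hc', hgc, hcl, hcases⟩ := hτ₄
    have hsV : (I.s : ℕ) ∈ S ∪ K := Finset.mem_union_left _ hs
    have htV : (I.t : ℕ) ∈ S ∪ K := Finset.mem_union_left _ ht
    have hsl := hl.pos_lt _ I.s.2 hsV
    have htl := hl.pos_lt _ I.t.2 htV
    have f84 : τ₄.var 8 = l :=
      (hf₄.1 8 (by simp [WordRAM.recolor, findFirst, Program.WritesVar])).trans f83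
    have fv : ∀ x, x = 2 ∨ x = 3 → τ₄.var x = τ₁.var x := fun x hx => by
      rw [hf₄.1 x (by simp [WordRAM.recolor, findFirst, Program.WritesVar]; omega),
        hf₃.1 x (by simp [restrictCol, Program.WritesVar]; omega),
        hf₂.1 x (by simp [restrictAdj, Program.WritesVar]; omega)]
    have f8a : τ₄.arr 8 = pos := by
      rw [hf₄.2 8 (by simp [WordRAM.recolor, findFirst, Program.WritesArr]),
        hf₃.2 8 (by simp [restrictCol, Program.WritesArr]),
        hf₂.2 8 (by simp [restrictAdj, Program.WritesArr]), hposn]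
    have f1a : τ₄.arr 1 = τ₂.arr 1 := by
      rw [hf₄.2 1 (by simp [WordRAM.recolor, findFirst, Program.WritesArr]),
        hf₃.2 1 (by simp [restrictCol, Program.WritesArr])]
    have e2 : (Expr.get 8 (.var 2)).Ev W τ₄ (pos I.s) := Expr.Ev.get (Expr.Ev.var
      ((fv 2 (by omega)).trans hτ₁.s_eq) (by have := I.s.2; omega)) (by rw [f8a]) (by omega)
    have e3 : (Expr.get 8 (.var 3)).Ev W (τ₄.setVar 2 (pos I.s)) (pos I.t) :=
      Expr.Ev.get (Expr.Ev.var (by rw [setVar_var_ne _ _ (by omega), fv 3 (by omega), hτ₁.t_eq])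
        (by have := I.t.2; omega)) (by rw [setVar_arr, f8a]) (by omega)
    have e8 : (Expr.var 8).Ev W ((τ₄.setVar 2 (pos I.s)).setVar 3 (pos I.t)) l :=
      Expr.Ev.var (by rw [setVar_var_ne _ _ (by omega), setVar_var_ne _ _ (by omega), f84])
        (by omega)
    refine (Runs.seq_assign e2 (Runs.seq_assign e3 (Runs.assign e8 ?_))).le (by decide)
    refine ⟨I.restrict l c' (pos I.s) (pos I.t) old (τ₄.arr 0) hsl htl hgc, old,
      ⟨?_, ?_, ?_, ?_, fun v => rfl, fun u v huv => ?_, fun u v huv => ?_⟩,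
      ⟨fun i hi j hj => restrict_adj hi hj, hl.old_pos _ I.s.2 hsV, hl.old_pos _ I.t.2 htV,
        hl.inj, hl.lt, fun v hv => ⟨pos v, hl.pos_lt v (hlt v hv) hv, hl.old_pos v (hlt v hv) hv⟩,
        ?_⟩, hl.le_card, hcl⟩
    · simp [setVar_var]; rfl
    · simp [setVar_var]; exact hc'
    · simp [setVar_var]; rfl
    · simp [setVar_var]; rfl
    · simp only [setVar_arr, f1a]
      refine (hadj u u.2 v v.2).trans ?_
      rw [hτ₁.adj_eq _ (hl.lt u u.2) _ (hl.lt v v.2)]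
      exact ind_pos huv
    · simp only [setVar_arr, f1a]
      refine (hadj u u.2 v v.2).trans ?_
      rw [hτ₁.adj_eq _ (hl.lt u u.2) _ (hl.lt v v.2)]
      exact ind_neg huv
    · rcases hcases with ⟨h1, h2⟩ | ⟨h1, h2, h3⟩
      · exact Or.inl ⟨h1, fun i hi => (restrict_col hi).trans (h2 i hi)⟩
      · refine Or.inr ⟨h1, h2, fun i hi j hj => ?_⟩
        change i < l at hi
        change j < l at hj
        rw [restrict_col hi, restrict_col hj]
        exact h3 i hi j hj
  · have h1 : l * l ≤ I.n ^ 2 := by nlinarith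
    have h2 : (Expr.op .lt (.var 8 + .lit 1) (.var 1)).cost = 5 := rfl
    rw [h2]
    nlinarith

end BFSPInstance

/-! ### The exponent of matrix multiplication is at least two -/

/-- The schoolbook algorithm puts `3` into the set whose infimum is `ω`. Without a member, the lower
bound for that infimum would not follow. -/
theorem hasBilinearAlgorithm_cube (F : Type*) [Field F] (n : ℕ) :
    HasBilinearAlgorithm F n (n ^ 3) := by
  classical
  have hcard : Fintype.card (Fin n × Fin n × Fin n) = n ^ 3 := by
    simp only [Fintype.card_prod, Fintype.card_fin]; ring
  let e : Fin (n ^ 3) ≃ Fin n × Fin n × Fin n :=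
    (finCongr hcard.symm).trans (Fintype.equivFin _).symm
  refine ⟨fun x => Matrix.entryLinearMap F F (e x).1 (e x).2.1,
    fun x => Matrix.entryLinearMap F F (e x).2.1 (e x).2.2,
    fun x => Matrix.single (e x).1 (e x).2.2 1, fun A B => ?_⟩
  rw [e.sum_comp fun y : Fin n × Fin n × Fin n => (Matrix.entryLinearMap F F y.1 y.2.1 A *
    Matrix.entryLinearMap F F y.2.1 y.2.2 B) • Matrix.single y.1 y.2.2 (1 : F)]
  ext i j
  simp only [Fintype.sum_prod_type, Matrix.sum_apply, Matrix.smul_apply, Matrix.mul_apply,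
    Matrix.entryLinearMap_apply, Matrix.single_apply, smul_eq_mul, mul_ite, mul_one, mul_zero]
  simp [ite_and]

/-- Writing `A = A * 1` shows that the matrices `M i` span the whole `n²`-dimensional space. -/
theorem HasBilinearAlgorithm.sq_le {F : Type*} [Field F] {n r : ℕ}
    (h : HasBilinearAlgorithm F n r) : n ^ 2 ≤ r := by
  obtain ⟨f, g, M, hM⟩ := h
  have hspan : Submodule.span F (Set.range M) = ⊤ := by
    rw [eq_top_iff]
    intro A _
    rw [← mul_one A, hM]
    exact Submodule.sum_mem _ fun i _ =>
      Submodule.smul_mem _ _ (Submodule.subset_span (Set.mem_range_self i))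
  have := finrank_range_le_card (R := F) M
  rw [Set.finrank, hspan, finrank_top, Module.finrank_matrix] at this
  simpa [pow_two] using this

theorem two_le_matMulExponent (F : Type*) [Field F] : 2 ≤ matMulExponent F := by
  refine le_csInf ⟨3, 1, fun n _ => ⟨n ^ 3, ?_, hasBilinearAlgorithm_cube F n⟩⟩ ?_
  · rw [one_mul]
    exact_mod_cast le_refl ((n : ℝ) ^ 3)
  · rintro τ ⟨C, hC⟩
    by_contra hlt
    push Not at hlt
    -- From `n² ≤ r ≤ C n ^ τ`; the left side is unbounded in `n` if `τ < 2`.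
    have hbound : ∀ n : ℕ, 1 ≤ n → (n : ℝ) ^ (2 - τ) ≤ C := fun n hn => by
      obtain ⟨r, hr, hbil⟩ := hC n hn
      have hn' : (0 : ℝ) < n := by exact_mod_cast hn
      have h1 : (n : ℝ) ^ 2 ≤ r := by exact_mod_cast hbil.sq_le
      rw [Real.rpow_sub hn', div_le_iff₀ (Real.rpow_pos_of_pos hn' τ)]
      exact_mod_cast h1.trans hr
    have htends : Filter.Tendsto (fun n : ℕ => (n : ℝ) ^ (2 - τ)) Filter.atTop Filter.atTop :=
      (tendsto_rpow_atTop (by linarith)).comp tendsto_natCast_atTop_atTop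
    obtain ⟨n, hn1, hn⟩ := ((Filter.eventually_ge_atTop 1).and
      (htends.eventually_gt_atTop C)).exists
    exact (hbound n hn1).not_gt hn

/-! ### Size bounds -/

theorem sum_pow_succ_le {M : ℕ} (hM : 2 ≤ M) (r : ℕ) :
    ∑ i ∈ Finset.range r, M ^ (i + 1) ≤ 2 * M ^ r := by
  induction r with
  | zero => simp
  | succ r ih =>
    rw [Finset.sum_range_succ]
    have : 2 * M ^ r ≤ M * M ^ r := Nat.mul_le_mul_right _ hM
    rw [pow_succ'] at *
    omega

/-- With `M = h (k + 1)`, one has `s ≤ 2 M`, and the sum is at most `2 h M ^ (h - 1)` by comparison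
with a geometric series. The constant is `18 = 2 + 2 * 4 * 2`; the outer factor 2 stands for the two
selections. -/
theorem kernel_card_le {h k m s : ℕ} (hh : 1 ≤ h) (hm : m ≤ h * (k + 1)) (hs : s ≤ h * k + 2) :
    s + 2 * (s ^ 2 * ∑ i ∈ Finset.range (h - 1), (i + 1) * m ^ (i + 1)) ≤
      18 * (h ^ (h + 2) * (k + 1) ^ (h + 1)) := by
  set M := h * (k + 1) with hM
  have hM1 : 1 ≤ M := Nat.mul_pos hh (Nat.succ_pos k)
  have hsM : s ≤ 2 * M := by
    rw [hM, mul_add]; omega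
  have hsum : ∑ i ∈ Finset.range (h - 1), (i + 1) * m ^ (i + 1) ≤ h * (2 * M ^ (h - 1)) := by
    rcases Nat.lt_or_ge h 2 with h2 | h2
    · obtain rfl : h = 1 := by omega
      simp
    · have hM2 : 2 ≤ M := h2.trans (Nat.le_mul_of_pos_right h (Nat.succ_pos k))
      calc ∑ i ∈ Finset.range (h - 1), (i + 1) * m ^ (i + 1)
          ≤ ∑ i ∈ Finset.range (h - 1), h * M ^ (i + 1) := by
            refine Finset.sum_le_sum fun i hi => ?_
            have := Finset.mem_range.1 hi
            exact Nat.mul_le_mul (by omega) (Nat.pow_le_pow_left hm _)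
        _ = h * ∑ i ∈ Finset.range (h - 1), M ^ (i + 1) := by rw [Finset.mul_sum]
        _ ≤ h * (2 * M ^ (h - 1)) := Nat.mul_le_mul_left _ (sum_pow_succ_le hM2 _)
  have hpow : M ^ 2 * M ^ (h - 1) = M ^ (h + 1) := by
    rw [← pow_add]; congr 1; omega
  have hle : M ≤ M ^ (h + 1) := Nat.le_self_pow (by omega) M
  have hfin : h ^ (h + 2) * (k + 1) ^ (h + 1) = h * M ^ (h + 1) := by
    rw [hM, mul_pow, pow_succ h (h + 1)]; ring
  have hle' : M ^ (h + 1) ≤ h * M ^ (h + 1) := Nat.le_mul_of_pos_left _ hh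
  rw [hfin]
  calc s + 2 * (s ^ 2 * ∑ i ∈ Finset.range (h - 1), (i + 1) * m ^ (i + 1))
      ≤ 2 * M + 2 * ((2 * M) ^ 2 * (h * (2 * M ^ (h - 1)))) := by gcongr
    _ = 2 * M + 16 * (h * (M ^ 2 * M ^ (h - 1))) := by ring
    _ ≤ 18 * (h * M ^ (h + 1)) := by rw [hpow]; omega

theorem size_le_self (n : ℕ) : Nat.size n ≤ n := Nat.size_le.2 Nat.lt_two_pow_self

/-- A bound for the bit length and the parameter of an instance with at most `N` vertices and at
most one colour more than vertices. -/
def sizeBound (N : ℕ) : ℕ := 3 * N + (N + 1) + N * (N + 1) + N * N + N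

/-- The parameter of the output needs no finer estimate than its number of vertices. -/
theorem bitLength_add_le {I : BFSPInstance} {h N : ℕ} (hh : 1 ≤ h) (hn : I.n ≤ N)
    (hc : I.c ≤ I.n + 1) : I.bitLength + distToPathFree h I.G ≤ sizeBound N := by
  have h1 := size_le_self I.n
  have h2 := size_le_self I.c
  have h3 := I.distToPathFree_le hh
  unfold BFSPInstance.bitLength sizeBound
  rw [pow_two]
  have h4 : I.n * Nat.size I.c ≤ N * (N + 1) := Nat.mul_le_mul hn (by omega)
  have h5 : I.n * I.n ≤ N * N := Nat.mul_le_mul hn hn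
  omega

theorem primrec_pow_const {f : ℕ → ℕ} (hf : Primrec f) (e : ℕ) : Primrec fun k => f k ^ e := by
  induction e with
  | zero => simpa using Primrec.const 1
  | succ e ih => simpa only [pow_succ] using Primrec.nat_mul.comp ih hf

theorem computable_sizeBound (h : ℕ) :
    Computable fun k => sizeBound (18 * (h ^ (h + 2) * (k + 1) ^ (h + 1))) := by
  have hN : Primrec fun k => 18 * (h ^ (h + 2) * (k + 1) ^ (h + 1)) :=
    Primrec.nat_mul.comp (Primrec.const 18) (Primrec.nat_mul.comp (Primrec.const (h ^ (h + 2)))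
      (primrec_pow_const Primrec.succ (h + 1)))
  have hb : Primrec sizeBound := by
    unfold sizeBound
    exact Primrec.nat_add.comp (Primrec.nat_add.comp (Primrec.nat_add.comp (Primrec.nat_add.comp
      (Primrec.nat_mul.comp (Primrec.const 3) Primrec.id) Primrec.succ)
      (Primrec.nat_mul.comp Primrec.id Primrec.succ)) (Primrec.nat_mul.comp Primrec.id Primrec.id))
      Primrec.id
  exact (hb.comp hN).to_comp

namespace BFSPInstance

/-! ### The kernelization -/

/-- The kernelization program. -/
def kernelize (h : ℕ) : Program :=
  .seq bfs (.seq (modulator h) (.seq (.assign 7 (.op .lt (.var 1) (.var 6 + .lit 1)))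
    (.seq (selectUpTo 0 (h - 1)) (.seq (.assign 7 (.op .lt (.lit 1) (.var 6 + .lit 1)))
      (.seq (selectUpTo 7 (h - 1)) output)))))

variable {I : BFSPInstance} {h W : ℕ} {σ : State}

/-- As `n` and `c` are positive, `n + c + 2 ≤ (n + c)²`; this accounts for the factor 2 in the
exponent of the word bound. -/
theorem IsInput.loaded (hσ : I.IsInput σ) (hW : W = (I.n + I.c) ^ (2 * (h + 5))) :
    I.Loaded h W σ := by
  obtain ⟨⟨h0, h1, h2, h3, -, hadj, hnadj⟩, -⟩ := hσ
  have hn := I.n_pos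
  have hc := I.c_pos
  have hsq : I.n + I.c + 2 ≤ (I.n + I.c) ^ 2 := by nlinarith
  refine ⟨h0, h1, h2, h3, fun u hu v hv => ?_, ?_, ?_⟩
  · by_cases hA : I.Adj u v
    · rw [ind_pos hA]
      exact hadj ⟨u, hu⟩ ⟨v, hv⟩ ((adj_fin ⟨u, hu⟩ ⟨v, hv⟩).1 hA)
    · rw [ind_neg hA]
      exact hnadj ⟨u, hu⟩ ⟨v, hv⟩ fun h => hA ((adj_fin ⟨u, hu⟩ ⟨v, hv⟩).2 h)
  · rw [hW, pow_mul]
    exact Nat.pow_le_pow_left (by omega) _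
  · rw [hW]
    calc I.c + 2 ≤ (I.n + I.c) ^ 2 := by omega
      _ ≤ (I.n + I.c) ^ (2 * (h + 5)) := Nat.pow_le_pow_right (by omega) (by omega)

theorem level_eq {r : ℕ} (hr : I.WalkLen r I.s I.t) : I.level = I.terminalDist + 1 := by
  rw [level, ind_pos ⟨r, hr⟩, one_mul]

theorem level_le_mul (hh : 1 ≤ h) (I : BFSPInstance) :
    I.level ≤ h * (distToPathFree h I.G + 1) := by
  by_cases hr : ∃ r, I.WalkLen r I.s I.t
  · obtain ⟨x, hx⟩ := hr.choose_spec.exists_pathSeq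
    rw [level_eq hr.choose_spec]
    exact (terminalDist_lt hh hx).le
  · rw [level, ind_neg hr, zero_mul]
    exact Nat.zero_le _

theorem exists_runs_kernelize (hh : 1 ≤ h) : ∃ D, ∀ (I : BFSPInstance) (σ : State), I.IsInput σ →
    Runs ((I.n + I.c) ^ (2 * (h + 5))) (kernelize h) σ (D * (I.n ^ (2 * h) + I.n ^ 4)) fun τ =>
      ∃ I' : BFSPInstance, I'.StoredIn τ ∧ (I'.IsYes ↔ I.IsYes) ∧
        I'.n ≤ 18 * (h ^ (h + 2) * (distToPathFree h I.G + 1) ^ (h + 1)) ∧ I'.c ≤ I'.n + 1 := by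
  obtain ⟨D₁, hD₁⟩ := exists_runs_bfs
  obtain ⟨D₂, hD₂⟩ := exists_runs_modulator hh
  refine ⟨D₁ + D₂ + selectUpToCost 0 (h - 1) + selectUpToCost 7 (h - 1) + 2000,
    fun I σ hσ => ?_⟩
  generalize hW : (I.n + I.c) ^ (2 * (h + 5)) = W
  have hl := IsInput.loaded hσ hW.symm
  have hn := hl.n_le
  have hc := hl.c_le
  have hlev := I.level_le
  have hcol0 : ∀ v < I.n, σ.arr 0 v = I.col v := fun v hv => by
    rw [col, dif_pos hv]; exact hσ.1.2.2.2.2.1 ⟨v, hv⟩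
  have hzero : ∀ b ≥ 2, ∀ v, σ.arr b v = 0 := fun b hb v => hσ.2.2.2.2 b v hb
  -- Two factors `n` for the pair of ends and `h - 1` each for the candidate and for the selected
  -- words give the exponent `2 h`.
  have hexp : 2 + (h - 1 + (h - 1)) = 2 * h := by omega
  have hsel := fun {a} {few : Prop} {col : ℕ → ℕ} {S K₀ : Finset ℕ} {τ : State}
    (hτ : I.Ready h W col a few I.level S τ) =>
      hτ.runs_selectUpTo (q := h - 1) (K₀ := K₀) (by omega)
  refine (Runs.seq (hD₁ I h W σ hl (hzero 2 le_rfl)) fun τ₁ hf₁ h6₁ => Runs.seq (B' := 100 +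
    selectUpToCost 0 (h - 1) * I.n ^ (2 * h) + selectUpToCost 7 (h - 1) * I.n ^ (2 * h) +
      1000 * I.n ^ 2)
    (hD₂ I W τ₁ (hl.frame hf₁ (by intro x hx; simp [bfs, relax, Program.WritesVar]; omega)
      (by simp [bfs, relax, Program.WritesArr])) (fun v => by
        rw [hf₁.2 3 (by simp [bfs, relax, Program.WritesArr])]; exact hzero 3 (by omega) v))
    fun τ₂ hf₂ ⟨S, hS, hSn, hs, ht, hScard, hSh⟩ => ?_).le ?_
  · have hl₂ : I.Loaded h W τ₂ := (hl.frame hf₁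
      (by intro x hx; simp [bfs, relax, Program.WritesVar]; omega)
      (by simp [bfs, relax, Program.WritesArr])).frame hf₂
        (by intro x hx; simp [modulator, Program.WritesVar]; omega)
        (by simp [modulator, Program.WritesArr])
    have h6₂ : τ₂.var 6 = I.level := by
      rw [hf₂.1 6 (by simp [modulator, Program.WritesVar]), h6₁]
    have harr₂ : ∀ b, b ≠ 2 → b ≠ 3 → τ₂.arr b = σ.arr b := fun b h2 h3 => by
      rw [hf₂.2 b (by simp [modulator, Program.WritesArr, h3]),
        hf₁.2 b (by simp [bfs, relax, Program.WritesArr, h2])]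
    have hR₁ : I.Ready h W I.col 0 (I.c < I.level + 1) I.level S
        (τ₂.setVar 7 (ind (I.c < I.level + 1))) :=
      { loaded := hl₂.setVar (by omega)
        m_eq := by rw [setVar_var_ne _ _ (by omega), h6₂]
        m_le := hlev
        few_eq := setVar_var_self _ _ _
        col_eq := fun v hv => by rw [setVar_arr, harr₂ 0 (by omega) (by omega), hcol0 v hv]
        col_le := fun v hv => by have := col_lt hv; omega
        mem_eq := hS
        a_ne := by omega }
    have e6 : ∀ {τ : State}, τ.var 6 = I.level → (Expr.var 6 + Expr.lit 1).Ev W τ (I.level + 1) :=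
      fun h6 => Expr.Ev.add (Expr.Ev.var h6 (by omega)) (Expr.Ev.lit (by omega)) (by omega)
    refine (Runs.seq_assign (Expr.Ev.lt (by omega) (Expr.Ev.var hl₂.c_eq (by omega)) (e6 h6₂))
      (Runs.seq (B' := 50 + selectUpToCost 7 (h - 1) * I.n ^ (2 * h) + 1000 * I.n ^ 2)
        (hsel hR₁ (K₀ := ∅) (fun v => ?_) (by simp))
          fun τ₃ hf₃ ⟨K, hK, _, hKn, hKcard, hKrep⟩ => ?_)).le ?_
    · rw [setVar_arr, harr₂ 4 (by omega) (by omega), hzero 4 (by omega)]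
      exact (ind_neg (by simp)).symm
    · have hv₃ : ∀ x < 8, ¬(selectUpTo 0 (h - 1)).WritesVar x := fun x hx hw => by
        have := writesVar_selectUpTo _ _ _ hw; omega
      have ha₃ : ∀ b, b ≠ 4 → b ≠ 5 → ¬(selectUpTo 0 (h - 1)).WritesArr b := fun b h4 h5 hw => by
        have := writesArr_selectUpTo _ _ _ hw; omega
      have hR₁' := hR₁.frame hf₃ hv₃ ha₃
      -- Array `7` is never written and therefore zero, which makes it the colouring with a single
      -- colour. The marks of the first selection are kept.
      have hR₂ : I.Ready h W I.monochrome.col 7 (1 < I.level + 1) I.level S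
          (τ₃.setVar 7 (ind (1 < I.level + 1))) :=
        { loaded := hR₁'.loaded.setVar (by omega)
          m_eq := by rw [setVar_var_ne _ _ (by omega), hR₁'.m_eq]
          m_le := hlev
          few_eq := setVar_var_self _ _ _
          col_eq := fun v hv => by
            rw [setVar_arr, hf₃.2 7 (ha₃ 7 (by omega) (by omega)), setVar_arr,
              harr₂ 7 (by omega) (by omega), hzero 7 (by omega), monochrome_col]
          col_le := fun v hv => by rw [monochrome_col]; exact Nat.zero_le _
          mem_eq := hR₁'.mem_eq
          a_ne := by omega }
      refine (Runs.seq_assign (Expr.Ev.lt (by omega) (Expr.Ev.lit (by omega)) (e6 hR₁'.m_eq))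
        (Runs.seq (B' := 1000 * I.n ^ 2) (hsel hR₂ (K₀ := K) hK hKn)
          fun τ₄ hf₄ ⟨K', hK', hKK', hKn', hKcard', hKrep'⟩ => ?_)).le ?_
      · have hv₄ : ∀ x < 8, ¬(selectUpTo 7 (h - 1)).WritesVar x := fun x hx hw => by
          have := writesVar_selectUpTo _ _ _ hw; omega
        have ha₄ : ∀ b, b ≠ 4 → b ≠ 5 → ¬(selectUpTo 7 (h - 1)).WritesArr b :=
          fun b h4 h5 hw => by have := writesArr_selectUpTo _ _ _ hw; omega
        have hR₂' := hR₂.frame hf₄ hv₄ ha₄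
        refine (hR₂'.loaded.runs_output (S := S) (K := K') (fun v hv => ?_) hR₂'.mem_eq hK'
          (fun v hv => ?_) hs ht).mono le_rfl ?_
        · rw [hf₄.2 0 (ha₄ 0 (by omega) (by omega)), setVar_arr,
            hf₃.2 0 (ha₃ 0 (by omega) (by omega)), setVar_arr, harr₂ 0 (by omega) (by omega),
            hcol0 v hv]
        · rcases Finset.mem_union.1 hv with hv | hv
          · exact hSn v hv
          · exact hKn' v hv
        · rintro τ - ⟨I', old, hstored, hrestr, hcard, hc'⟩
          have hsub : (K : Set ℕ) ⊆ ((S ∪ K' : Finset ℕ) : Set ℕ) := by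
            exact_mod_cast hKK'.trans Finset.subset_union_right
          have hsub' : (K' : Set ℕ) ⊆ ((S ∪ K' : Finset ℕ) : Set ℕ) := by
            exact_mod_cast Finset.subset_union_right
          have hSsub : (S : Set ℕ) ⊆ ((S ∪ K' : Finset ℕ) : Set ℕ) := by
            exact_mod_cast Finset.subset_union_left
          refine ⟨I', hstored, hrestr.isYes_iff (h := h) (S := S)
            ⟨hs, ht, hSsub, hSh, fun hw q hq1 hqh u hu v hv => ?_⟩
            ⟨hs, ht, hSsub, hSh, fun hw q hq1 hqh u hu v hv => ?_⟩, ?_, hc'⟩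
          -- The computed `level` equals `d + 1` as soon as a walk between the terminals exists, and
          -- only then is a representation required.
          · have := (hKrep q hq1 (by omega) u hu v hv (hSn u hu) (hSn v hv)).mono hsub
            rwa [level_eq hw, Nat.lt_succ_iff] at this
          · have := (hKrep' q hq1 (by omega) u hu v hv (hSn u hu) (hSn v hv)).mono hsub'
            have hw' : I.WalkLen I.terminalDist I.s I.t := hw
            rw [level_eq hw', Nat.lt_succ_iff] at this
            exact this
          · refine le_trans ?_ (kernel_card_le hh (level_le_mul hh I) hScard)
            have := Finset.card_union_le S K'
            rw [Finset.card_empty, zero_add] at hKcard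
            omega
      · rw [hexp]
        simp only [Expr.cost]
        omega
    · rw [hexp]
      simp only [Expr.cost]
      omega
  · have h1 : I.n ^ h ≤ I.n ^ (2 * h) := Nat.pow_le_pow_right I.n_pos (by omega)
    have h2 : I.n ^ 2 ≤ I.n ^ 4 := Nat.pow_le_pow_right I.n_pos (by omega)
    have h3 : 1 ≤ I.n ^ 4 := Nat.one_le_pow _ _ I.n_pos
    have h4 : D₂ * I.n ^ h ≤ D₂ * I.n ^ (2 * h) := Nat.mul_le_mul_left _ h1
    simp only [add_mul, mul_add]
    omega

end BFSPInstance

theorem mainTheorem1 :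
    ∃ C : ℕ, ∀ (F : Type) [Field F] (h : ℕ), 1 ≤ h →
      ∃ (prog : WordRAM.Program) (b : ℕ) (D : ℝ) (f : ℕ → ℕ), Computable f ∧
        ∀ (I : BFSPInstance) (σ : WordRAM.State), I.IsInput σ →
          ∃ (T : ℕ) (τ : WordRAM.State) (I' : BFSPInstance),
            WordRAM.Exec ((I.n + I.c) ^ b) prog σ T τ ∧
            (T : ℝ) ≤ D * ((I.n : ℝ) ^ (matMulExponent F * (h : ℝ)) + (I.n : ℝ) ^ 4) ∧
            I'.StoredIn τ ∧
            (I'.IsYes ↔ I.IsYes) ∧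
            I'.n ≤ C * (h ^ (h + 2) * (distToPathFree h I.G + 1) ^ (h + 1)) ∧
            I'.bitLength + distToPathFree h I'.G ≤ f (distToPathFree h I.G) := by
  refine ⟨18, fun F _ h hh => ?_⟩
  obtain ⟨D, hD⟩ := BFSPInstance.exists_runs_kernelize hh
  refine ⟨BFSPInstance.kernelize h, 2 * (h + 5), D, _, computable_sizeBound h, fun I σ hσ => ?_⟩
  obtain ⟨T, τ, hT, hexec, I', hstored, hyes, hcard, hc⟩ := hD I σ hσ
  refine ⟨T, τ, I', hexec, ?_, hstored, hyes, hcard, bitLength_add_le hh hcard hc⟩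
  have hn : (1 : ℝ) ≤ I.n := by exact_mod_cast I.n_pos
  -- The field enters only through `ω ≥ 2`; neither the program nor its step bound `n ^ (2 h) + n ^
  -- 4` depends on it.
  have hpow : (I.n : ℝ) ^ (2 * h) ≤ (I.n : ℝ) ^ (matMulExponent F * (h : ℝ)) := by
    rw [← Real.rpow_natCast]
    refine Real.rpow_le_rpow_of_exponent_le hn ?_
    push_cast
    exact mul_le_mul_of_nonneg_right (two_le_matMulExponent F) (Nat.cast_nonneg h)
  calc (T : ℝ) ≤ D * ((I.n : ℝ) ^ (2 * h) + (I.n : ℝ) ^ 4) := by exact_mod_cast hT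
    _ ≤ _ := by gcongr
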